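/- Let $N\ge 2$, $L>0$, and let $\Xi=\{z\in\mathbb R^2: e^{-2\pi L}\le |z|\le 1\}$. Let $M=(\Omega-O)\cup\partial O\subset\mathbb R^2$ be a workspace and let $\tau:M\to\Xi$ be a $C^1$ diffeomorphism (up to the boundary). Let $\eta'$ be the pull-back to $M$ by $\tau$ of the standard metric $\eta$ of $\Xi$, i.e. $\eta'_x(v,w)=\langle D\tau_x v,D\tau_x w\rangle$. Let $\rho:\Xi\to(0,\infty)$ be continuous and $\rho'=\rho\circ\tau$. For $E\subset M$ let $d_l^{E}(x,y)$ be the infimum of the $\eta'$-lengths of the $C^1$ paths in $E$ from $x$ to $y$ ($\infty$ if there is none). For phase angles $\psi=(\psi_1,\dots,\psi_N)$ (real numbers, lifts of angles modulo $2\pi$, with $\psi_{N+1}=\psi_1+2\pi$) let $E'_i(\psi)\subset M$ be the preimage by $\tau$ of the closed sector $\{se^{\mathrm i\theta}: e^{-2\pi L}\le s\le 1,\ \psi_i\le\theta\le\psi_{i+1}\}$ of $\Xi$, and let $m'_i(\psi)=\int_{E'_i(\psi)}\rho'(q)\,dq$ be its workload (indices of $m'$ are read modulo $N$). An optimal centroid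 of $E'_i(\psi)$ is a minimizer over $x\in E'_i(\psi)$ of $$\int_{E'_i(\psi)} d_l^{E'_i(\psi)}(q,x)^2\,\rho'(q)\,dq .$$ Fix gains $k_{\psi},k_p>0$ and a (possibly empty) set $H$ of indices of bars that are held fixed. Let $\psi(t)$, $t\ge0$, satisfy $0\le\psi_1(0)<\dots<\psi_N(0)<2\pi$ and $$\dot\psi_i=k_\psi\bigl(m'_i(\psi)-m'_{i-1}(\psi)\bigr)\ (i\notin H),\qquad \dot\psi_i=0\ (i\in H).$$ Let $p'_i(t)\in E'_i(\psi(t))$, $t\ge0$, $i=1,\dots,N$, satisfy $\dot p'_i=u'_i$ with the control input $$u'_i=-2k_p\int_{E\setminus(\{p'_i\}\cup C_{p'_i})} d_l^{E}(q,p'_i)\,\frac{z_{q p'_i}}{\sqrt{\eta'_{p'_i}(z_{qp'_i},z_{qp'_i})}}\;\rho'(q)\,dq,\qquad E=E'_i(\psi(t)),$$ where $z_{qx}$ is the tangent vector at $x$ to the shortest path in $E$ from $q$ to $x$ (parametrized on $[0,1]$ with constant speed), and the cut locus $C_x$ is the closure of the set of points of $E$ that are joined to $x$ by more than one such shortest path.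 Then $\psi(t)$ converges, as $t\to\infty$, to some $\psi^*$ with $m'_i(\psi^*)=m'_{i-1}(\psi^*)$ for all $i\notin H$, and for every $i$: 1. for every $t\ge0$ the subregion $E'_i(\psi(t))$ has exactly one optimal centroid $p_i^*(t)$, and $d_l^{E'_i(\psi(t))}\bigl(p'_i(t),p_i^*(t)\bigr)\to0$ as $t\to\infty$; 2. $E'_i(\psi^*)$ has exactly one optimal centroid $q_i^*$, and $d_l^{E'_i(\psi(t))}\bigl(p'_i(t),q_i^*\bigr)\to0$ and $d_l^{M}\bigl(p'_i(t),q_i^*\bigr)\to0$ as $t\to\infty$. -/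

import Mathlib

open Set Filter Topology MeasureTheory
open scoped ENNReal

noncomputable section

namespace Coverage

/-! ### The mapped region, the workspace and the diffeomorphism between them -/

/-- The mapped region `Ξ`: the points `(s cos θ, s sin θ)` with `s = R + r cos φ`, where
`R = (1 + e^{-2πL}) / 2` and `r = (1 - e^{-2πL}) / 2`, that is, the closed annulus with inner
radius `e^{-2πL}` and outer radius `1`. -/
def mappedRegion (L : ℝ) : Set ℂ :=
  {z | Real.exp (-(2 * Real.pi * L)) ≤ ‖z‖ ∧ ‖z‖ ≤ 1}

/-- The original workspace `(Ω - O) ∪ ∂O`. -/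
def workspace (Ω O : Set ℂ) : Set ℂ := (Ω \ O) ∪ frontier O

/-- `τ` is a `C¹` diffeomorphism of `M` onto `X`, up to the boundary. -/
def IsDiffeo (τ : ℂ → ℂ) (M X : Set ℂ) : Prop :=
  ContDiffOn ℝ 1 τ M ∧ MapsTo τ M X ∧
    ∃ σ : ℂ → ℂ, ContDiffOn ℝ 1 σ X ∧ MapsTo σ X M ∧ LeftInvOn σ τ M ∧ RightInvOn σ τ X

/-! ### The Riemannian metric and the length metric -/

/-- The Riemannian metric `η'` on the workspace `M`: the pull-back by `τ` of the standard metric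
`η` of the mapped region.  In the coordinates `(θ, φ)` the latter has the matrix
`diag((R + r cos φ)², r² sin² φ)`; it is the Euclidean metric of the plane. -/
def metric (M : Set ℂ) (τ : ℂ → ℂ) (x v w : ℂ) : ℝ :=
  inner ℝ (fderivWithin ℝ τ M x v) (fderivWithin ℝ τ M x w)

/-- The length of the tangent vector `v` at `x`. -/
def tangentNorm (M : Set ℂ) (τ : ℂ → ℂ) (x v : ℂ) : ℝ :=
  Real.sqrt (metric M τ x v v)

/-- `γ`, restricted to `[0, 1]`, is a `C¹` path in `E` from `x` to `y`. -/
def IsPath (E : Set ℂ) (x y : ℂ) (γ : ℝ → ℂ) : Prop :=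
  ContDiffOn ℝ 1 γ (Icc 0 1) ∧ MapsTo γ (Icc 0 1) E ∧ γ 0 = x ∧ γ 1 = y

/-- The length of a path: the integral of its speed. -/
def pathLength (M : Set ℂ) (τ : ℂ → ℂ) (γ : ℝ → ℂ) : ℝ≥0∞ :=
  ∫⁻ t in Icc (0 : ℝ) 1, ENNReal.ofReal (tangentNorm M τ (γ t) (derivWithin γ (Icc 0 1) t))

/-- The length metric `d_l` of `E ⊆ M`: the infimum of the lengths of the paths that stay in `E`
(`∞` if there is none). -/
def lengthDist (M : Set ℂ) (τ : ℂ → ℂ) (E : Set ℂ) (x y : ℂ) : ℝ≥0∞ :=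
  ⨅ (γ : ℝ → ℂ) (_ : IsPath E x y γ), pathLength M τ γ

/-- `γ` is a shortest path of `E` from `x` to `y`, parametrized with constant speed. -/
def IsShortestPath (M : Set ℂ) (τ : ℂ → ℂ) (E : Set ℂ) (x y : ℂ) (γ : ℝ → ℂ) : Prop :=
  IsPath E x y γ ∧
    ∀ t ∈ Icc (0 : ℝ) 1,
      ENNReal.ofReal (tangentNorm M τ (γ t) (derivWithin γ (Icc 0 1) t)) = lengthDist M τ E x y

/-- The cut locus of `x` in `E`: the closure of the set of the points that are connected to `x` by
more than one shortest path. -/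
def cutLocus (M : Set ℂ) (τ : ℂ → ℂ) (E : Set ℂ) (x : ℂ) : Set ℂ :=
  closure {y | y ∈ E ∧ ∃ γ₁ γ₂ : ℝ → ℂ, IsShortestPath M τ E x y γ₁ ∧ IsShortestPath M τ E x y γ₂ ∧
    ¬ EqOn γ₁ γ₂ (Icc 0 1)}

open Classical in
/-- The vector `z_{qx}`: the tangent vector at `x` of the shortest path of `E` from `q` to `x`.
(It does not depend on the choice if the shortest path is unique.) -/
def shortestTangent (M : Set ℂ) (τ : ℂ → ℂ) (E : Set ℂ) (q x : ℂ) : ℂ :=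
  if h : ∃ γ : ℝ → ℂ, IsShortestPath M τ E q x γ then derivWithin h.choose (Icc 0 1) 1 else 0

/-! ### The partition, the workloads, the cost and the control law -/

/-- The part of the annulus `Ξ` between the phase angles `α` and `β`, with its bounding bars. -/
def sector (L α β : ℝ) : Set ℂ :=
  {z | ∃ s θ : ℝ, Real.exp (-(2 * Real.pi * L)) ≤ s ∧ s ≤ 1 ∧ α ≤ θ ∧ θ ≤ β ∧
    z = s * Complex.exp (θ * Complex.I)}

/-- The bar `ψ_{i+1}` that follows the `i`-th one.  The phase angles are real numbers (lifts of
angles modulo `2π`), so the bar after the last one is the first one, one turn later. -/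
def nextBar {N : ℕ} [NeZero N] (ψ : Fin N → ℝ) (i : Fin N) : ℝ :=
  ψ (i + 1) + if i + 1 = 0 then 2 * Real.pi else 0

/-- The subregion `E'_i(ψ)` of the workspace `M`: the preimage by `τ` of the sector between the
bars `ψ_i` and `ψ_{i+1}`. -/
def subregion {N : ℕ} [NeZero N] (M : Set ℂ) (τ : ℂ → ℂ) (L : ℝ) (ψ : Fin N → ℝ) (i : Fin N) :
    Set ℂ :=
  {x | x ∈ M ∧ τ x ∈ sector L (ψ i) (nextBar ψ i)}

/-- The workload of `E ⊆ M` for the density `ρ' = ρ ∘ τ`. -/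
def workload (τ : ℂ → ℂ) (ρ : ℂ → ℝ) (E : Set ℂ) : ℝ :=
  ∫ q in E, ρ (τ q)

/-- The contribution `∫_E d_l(q, x)² ρ'(q) dq` of a subregion `E` to the performance index `J'`,
when the agent in charge of `E` is at `x`. -/
def cost (M : Set ℂ) (τ : ℂ → ℂ) (ρ : ℂ → ℝ) (E : Set ℂ) (x : ℂ) : ℝ :=
  ∫ q in E, (lengthDist M τ E q x).toReal ^ 2 * ρ (τ q)

/-- `c` is an optimal centroid of `E`: a point of `E` at which the cost is minimal. -/
def IsOptimalCentroid (M : Set ℂ) (τ : ℂ → ℂ) (ρ : ℂ → ℝ) (E : Set ℂ) (c : ℂ) : Prop :=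
  c ∈ E ∧ ∀ x ∈ E, cost M τ ρ E c ≤ cost M τ ρ E x

/-- The control input `u'` of an agent at `x ∈ E` with gain `k`:
`-2k ∫ d_l(q, x) z_{qx} / |z_{qx}| ρ'(q) dq` over `E` without `x` and its cut locus. -/
def controlInput (M : Set ℂ) (τ : ℂ → ℂ) (ρ : ℂ → ℝ) (k : ℝ) (E : Set ℂ) (x : ℂ) : ℂ :=
  (-(2 * k)) • ∫ q in E \ ({x} ∪ cutLocus M τ E x),
    ((lengthDist M τ E q x).toReal / tangentNorm M τ x (shortestTangent M τ E q x) * ρ (τ q)) •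
      shortestTangent M τ E q x

open Classical in
/-- The velocity of the `i`-th bar: `k (m'_i - m'_{i-1})` (indices modulo `N`), and `0` if the
bar is one of those that are held fixed. -/
def barVelocity {N : ℕ} [NeZero N] (M : Set ℂ) (τ : ℂ → ℂ) (ρ : ℂ → ℝ) (L k : ℝ)
    (held : Set (Fin N)) (ψ : Fin N → ℝ) (i : Fin N) : ℝ :=
  if i ∈ held then 0
  else k * (workload τ ρ (subregion M τ L ψ i) - workload τ ρ (subregion M τ L ψ (i - 1)))

end Coverage

end

/-! In log-polar coordinates a sector of `Ξ` of opening less than `2π` becomes a box in the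
universal cover of the exterior of the disc of radius `a = exp (-2πL)`. This cover is nonpositively
curved: a geodesic is a chord, or else a tangent segment, an arc of the circle and another tangent
segment. `geoLog a p q` is the initial velocity, at `exp p`, of the geodesic from `p` to `q`, in
closed form; its norm is the distance. One geometric fact carries the rest,
`norm_geoLog_sub_geoLog_le`: the map `geoLog a p` to the Euclidean plane does not lengthen paths. It
makes geodesics minimizing and unique and yields the semi-parallelogram inequality. Since geodesics
between points of a box stay in the box, it also identifies the length metric of a sector
(`lengthDist_eq`). Cut loci are then empty, and `τ` carries the control input to `2 k_p` times the
weighted integral of `geoLog` (`fderivWithin_controlInput`). The bars form a system of their own. A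
gap shrinks at a rate at most proportional to itself, so it never closes. The sum of the logarithms
of the workloads does not decrease; this keeps the workloads away from zero and makes the velocities
small along a sequence of times, so the bars accumulate at an equilibrium with positive gaps
(`exists_equilibrium_clusterPt`). An energy relative to this equilibrium decreases, which turns
accumulation into convergence (`tendsto_equilibrium`). For an agent, squaring and integrating the
comparison inequality gives `boxCost_add_le`, a form of strong convexity of the cost. The centroid
is unique, varies continuously with the box, and never lies on a bar. If `U` is the squared distance
from the agent to the limit centroid, then `U' ≤ -κ U + δ` in the sense of Dini, where `δ` is
proportional to the excess cost of the limit centroid in the current sector. Since `δ` tends to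
zero, so does `U`. -/

namespace Coverage

open Complex (I)
open scoped ComplexConjugate

/-! ### The logarithm map of the exterior of a disc, in closed form. -/

/-- The angle between the direction of a point at radius `exp u` and that of the points where the
tangent lines through it touch the circle of radius `a`. -/
noncomputable def touchAngle (a u : ℝ) : ℝ := Real.arccos (a / Real.exp u)

/-- The length of the tangent segment from a point at radius `exp u` to the circle of radius `a`. -/
noncomputable def touchLength (a u : ℝ) : ℝ := √(Real.exp u ^ 2 - a ^ 2)

/-- The logarithm map at `exp p` of the universal cover of the exterior of the disc of radius `a`;
the points of the cover are given by their log-polar coordinates. -/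
noncomputable def geoLog (a : ℝ) (p q : ℂ) : ℂ :=
  Complex.exp (p.im * I) *
    (Real.exp q.re * Complex.exp (((q.im - p.im
        - max 0 ((q.im - p.im) - (touchAngle a p.re + touchAngle a q.re))
        + max 0 (-(q.im - p.im) - (touchAngle a p.re + touchAngle a q.re)) : ℝ)) * I)
      - Real.exp p.re
      + ((a * max 0 ((q.im - p.im) - (touchAngle a p.re + touchAngle a q.re)) : ℝ) : ℂ)
        * (I * Complex.exp (touchAngle a p.re * I))
      - ((a * max 0 (-(q.im - p.im) - (touchAngle a p.re + touchAngle a q.re)) : ℝ) : ℂ)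
        * (I * Complex.exp (-(touchAngle a p.re * I))))

/-- The length of the tangent segment minus the length of the arc below it. -/
noncomputable def involute (a u : ℝ) : ℝ := touchLength a u - a * touchAngle a u

lemma continuous_touchAngle (a : ℝ) : Continuous (touchAngle a) := by
  unfold touchAngle
  exact Real.continuous_arccos.comp (continuous_const.div Real.continuous_exp fun u => (Real.exp_pos u).ne')

lemma continuous_touchLength (a : ℝ) : Continuous (touchLength a) := by
  unfold touchLength; fun_prop

lemma continuous_geoLog (a : ℝ) : Continuous fun x : ℂ × ℂ => geoLog a x.1 x.2 := by
  have := continuous_touchAngle a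
  unfold geoLog
  fun_prop

lemma touchAngle_nonneg (a u : ℝ) : 0 ≤ touchAngle a u := Real.arccos_nonneg _

lemma touchLength_nonneg (a u : ℝ) : 0 ≤ touchLength a u := Real.sqrt_nonneg _

lemma touchAngle_lt {a : ℝ} (ha : 0 < a) (u : ℝ) : touchAngle a u < Real.pi / 2 :=
  Real.arccos_lt_pi_div_two.2 (div_pos ha (Real.exp_pos u))

lemma exp_mul_cos_touchAngle {a u : ℝ} (ha : 0 < a) (hu : a ≤ Real.exp u) :
    Real.exp u * Real.cos (touchAngle a u) = a := by
  have h := Real.exp_pos u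
  rw [touchAngle, Real.cos_arccos _ ((div_le_one h).2 hu)]
  · field_simp
  · linarith [div_pos ha h]

lemma exp_mul_sin_touchAngle {a u : ℝ} :
    Real.exp u * Real.sin (touchAngle a u) = touchLength a u := by
  have h := Real.exp_pos u
  rw [touchAngle, Real.sin_arccos, touchLength]
  rw [show Real.exp u ^ 2 - a ^ 2 = Real.exp u ^ 2 * (1 - (a / Real.exp u) ^ 2) by field_simp,
    Real.sqrt_mul (by positivity), Real.sqrt_sq h.le]

lemma exp_mul_exp_touchAngle {a u : ℝ} (ha : 0 < a) (hu : a ≤ Real.exp u) :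
    (Real.exp u : ℂ) * Complex.exp (touchAngle a u * I) = a + touchLength a u * I := by
  rw [Complex.exp_mul_I, ← Complex.ofReal_cos, ← Complex.ofReal_sin, mul_add, ← mul_assoc,
    ← Complex.ofReal_mul, ← Complex.ofReal_mul, exp_mul_cos_touchAngle ha hu, exp_mul_sin_touchAngle]

lemma exp_eq_mul_exp_touchAngle {a u : ℝ} (ha : 0 < a) (hu : a ≤ Real.exp u) :
    (Real.exp u : ℂ) = (a - touchLength a u * I) * Complex.exp (touchAngle a u * I) := by
  have h : (Real.exp u : ℂ) * Complex.exp (-(touchAngle a u * I)) = a - touchLength a u * I := by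
    rw [← neg_mul, ← Complex.ofReal_neg, Complex.exp_mul_I, ← Complex.ofReal_cos,
      ← Complex.ofReal_sin, Real.cos_neg, Real.sin_neg]
    have h1 := congrArg (fun x : ℝ => (x : ℂ)) (exp_mul_cos_touchAngle ha hu)
    have h2 := congrArg (fun x : ℝ => (x : ℂ)) (exp_mul_sin_touchAngle (a := a) (u := u))
    push_cast at h1 h2 ⊢
    linear_combination h1 - I * h2
  rw [← h, mul_assoc, ← Complex.exp_add]; simp

lemma exp_eq_ofReal_mul (p : ℂ) :
    Complex.exp p = (Real.exp p.re : ℂ) * Complex.exp (p.im * I) := by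
  conv_lhs => rw [← Complex.re_add_im p]
  rw [Complex.exp_add, Complex.ofReal_exp]

/-- In this range of angles the chord does not enter the disc, both excess angles vanish, and the
geodesic is the chord. -/
lemma geoLog_of_visible {a : ℝ} {p q : ℂ}
    (h : |q.im - p.im| ≤ touchAngle a p.re + touchAngle a q.re) :
    geoLog a p q = Complex.exp q - Complex.exp p := by
  obtain ⟨h1, h2⟩ := abs_le.1 h
  rw [geoLog, max_eq_left (by linarith), max_eq_left (by linarith), exp_eq_ofReal_mul q,
    exp_eq_ofReal_mul p]
  have : Complex.exp (q.im * I) = Complex.exp (p.im * I) * Complex.exp (((q.im - p.im : ℝ) : ℂ) * I) := by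
    rw [← Complex.exp_add]; push_cast; ring_nf
  rw [this]
  simp only [sub_zero, add_zero, mul_zero, Complex.ofReal_zero, zero_mul]
  ring

/-- The taut string leaves `exp p` along the tangent that touches the circle at the angle `p.im +
touchAngle a p.re`. The scalar factor is its length, two tangent segments and an arc, split into one
term for each end and a term linear in the angle. -/
lemma geoLog_of_far {a : ℝ} {p q : ℂ} (ha : 0 < a) (hp : a ≤ Real.exp p.re)
    (hq : a ≤ Real.exp q.re) (h : touchAngle a p.re + touchAngle a q.re ≤ q.im - p.im) :
    geoLog a p q = ((involute a p.re + involute a q.re + a * (q.im - p.im) : ℝ) : ℂ) *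
      (I * Complex.exp (((p.im + touchAngle a p.re : ℝ) : ℂ) * I)) := by
  have h1 := touchAngle_nonneg a p.re
  have h2 := touchAngle_nonneg a q.re
  rw [geoLog, max_eq_right (by linarith), max_eq_left (by linarith)]
  have e1 : Complex.exp (((q.im - p.im
      - ((q.im - p.im) - (touchAngle a p.re + touchAngle a q.re)) + 0 : ℝ)) * I)
      = Complex.exp (touchAngle a p.re * I) * Complex.exp (touchAngle a q.re * I) := by
    rw [← Complex.exp_add]; push_cast; ring_nf
  have e2 : Complex.exp (((p.im + touchAngle a p.re : ℝ) : ℂ) * I) =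
      Complex.exp (p.im * I) * Complex.exp (touchAngle a p.re * I) := by
    rw [← Complex.exp_add]; push_cast; ring_nf
  have e3 := exp_mul_exp_touchAngle ha hq
  have e4 := exp_eq_mul_exp_touchAngle ha hp
  rw [e1, e2, involute, involute]
  push_cast at e3 e4 ⊢
  linear_combination (Complex.exp (p.im * I) * Complex.exp (touchAngle a p.re * I)) * e3
    - Complex.exp (p.im * I) * e4

/-- Reflection exchanges the two senses of rotation, so only `p.im ≤ q.im` needs treatment below. -/
lemma geoLog_conj (a : ℝ) (p q : ℂ) : geoLog a (conj p) (conj q) = conj (geoLog a p q) := by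
  simp only [geoLog, Complex.conj_re, Complex.conj_im, map_mul, map_add, map_sub, ← Complex.exp_conj,
    Complex.conj_ofReal, Complex.conj_I, map_neg]
  have e : -q.im - -p.im = -(q.im - p.im) := by ring
  rw [e, neg_neg]
  have e1 : (((-(q.im - p.im) - max 0 (-(q.im - p.im) - (touchAngle a p.re + touchAngle a q.re)) +
        max 0 (q.im - p.im - (touchAngle a p.re + touchAngle a q.re)) : ℝ) : ℂ) * I) =
     (((q.im - p.im - max 0 (q.im - p.im - (touchAngle a p.re + touchAngle a q.re)) +
        max 0 (-(q.im - p.im) - (touchAngle a p.re + touchAngle a q.re)) : ℝ) : ℂ) * -I) := by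
    push_cast; ring
  rw [e1]
  push_cast
  ring_nf

/-- Off the circle this is a computation; inside it both terms have the default value `0`. On the
circle the singularities of the two terms cancel: the derivative found on both sides is continuous
there. With it, the far distance has a gradient of length one. -/
lemma hasDerivAt_involute {a : ℝ} (ha : 0 < a) (u : ℝ) :
    HasDerivAt (involute a) (touchLength a u) u := by
  have key : ∀ v, v ≠ Real.log a → HasDerivAt (involute a) (touchLength a v) v := by
    intro v hv
    rcases lt_or_gt_of_ne hv with hv | hv
    · have e : involute a =ᶠ[𝓝 v] fun _ => 0 := by
        filter_upwards [eventually_lt_nhds hv] with w hw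
        have hw' : Real.exp w < a := (Real.lt_log_iff_exp_lt ha).1 hw
        have := Real.exp_pos w
        rw [involute, touchLength, touchAngle, Real.sqrt_eq_zero_of_nonpos (by nlinarith),
          Real.arccos_eq_zero.2 ((one_le_div this).2 hw'.le)]
        ring
      have hw' : Real.exp v < a := (Real.lt_log_iff_exp_lt ha).1 hv
      have := Real.exp_pos v
      rw [touchLength, Real.sqrt_eq_zero_of_nonpos (by nlinarith)]
      exact (hasDerivAt_const v (0 : ℝ)).congr_of_eventuallyEq e
    · have hw : a < Real.exp v := (Real.log_lt_iff_lt_exp ha).1 hv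
      have h0 := Real.exp_pos v
      have hpos : 0 < Real.exp v ^ 2 - a ^ 2 := by nlinarith
      have hY : 0 < touchLength a v := Real.sqrt_pos.2 hpos
      have hY2 : touchLength a v ^ 2 = Real.exp v ^ 2 - a ^ 2 := Real.sq_sqrt hpos.le
      have d1 : HasDerivAt (touchLength a) (Real.exp v ^ 2 / touchLength a v) v := by
        have := (((Real.hasDerivAt_exp v).pow 2).sub_const (a ^ 2)).sqrt hpos.ne'
        refine this.congr_deriv ?_
        change _ / (2 * touchLength a v) = _
        field_simp; norm_num; ring
      have hq : a / Real.exp v < 1 := (div_lt_one h0).2 hw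
      have hq0 : 0 < a / Real.exp v := div_pos ha h0
      have d2 : HasDerivAt (touchAngle a) (a / touchLength a v) v := by
        have h3 := (Real.hasDerivAt_arccos (by linarith : a / Real.exp v ≠ -1) hq.ne).comp v
          ((hasDerivAt_const v a).div (Real.hasDerivAt_exp v) h0.ne')
        refine h3.congr_deriv ?_
        have : √(1 - (a / Real.exp v) ^ 2) = touchLength a v / Real.exp v := by
          rw [touchLength, show 1 - (a / Real.exp v) ^ 2 = (Real.exp v ^ 2 - a ^ 2) / Real.exp v ^ 2 by
            field_simp, Real.sqrt_div hpos.le, Real.sqrt_sq h0.le]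
        rw [this]; field_simp; ring
      have := d1.sub (d2.const_mul a)
      refine this.congr_deriv ?_
      field_simp
      rw [hY2]
  by_cases hu : u = Real.log a
  · rw [hu]
    refine hasDerivAt_of_hasDerivAt_of_ne key ?_ (continuous_touchLength a).continuousAt
    exact ((continuous_touchLength a).sub (continuous_const.mul (continuous_touchAngle a))).continuousAt
  · exact key u hu

lemma involute_nonneg {a u : ℝ} (ha : 0 < a) (hu : a ≤ Real.exp u) :
    0 ≤ involute a u := by
  have hm : MonotoneOn (involute a) univ := by
    refine monotoneOn_of_deriv_nonneg convex_univ
      (fun x _ => (hasDerivAt_involute ha x).continuousAt.continuousWithinAt)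
      (fun x _ => (hasDerivAt_involute ha x).differentiableAt.differentiableWithinAt) ?_
    intro x _
    rw [(hasDerivAt_involute ha x).deriv]
    exact touchLength_nonneg a x
  have h0 : involute a (Real.log a) = 0 := by
    rw [involute, touchLength, touchAngle, Real.exp_log ha, div_self ha.ne']
    simp
  rw [← h0]
  exact hm (mem_univ _) (mem_univ _) ((Real.log_le_iff_le_exp ha).2 hu)

lemma norm_geoLog_of_far {a : ℝ} {p q : ℂ} (ha : 0 < a) (hp : a ≤ Real.exp p.re)
    (hq : a ≤ Real.exp q.re) (h : touchAngle a p.re + touchAngle a q.re ≤ q.im - p.im) :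
    ‖geoLog a p q‖ = touchLength a p.re + touchLength a q.re
      + a * (q.im - p.im - (touchAngle a p.re + touchAngle a q.re)) := by
  rw [geoLog_of_far ha hp hq h, norm_mul, norm_mul, Complex.norm_exp_ofReal_mul_I, Complex.norm_I,
    Complex.norm_real, Real.norm_eq_abs, abs_of_nonneg]
  · simp only [involute]; ring
  · have h1 := touchAngle_nonneg a p.re
    have h2 := touchAngle_nonneg a q.re
    have := involute_nonneg ha hp
    have := involute_nonneg ha hq
    have := mul_nonneg ha.le (by linarith : 0 ≤ q.im - p.im)
    linarith

/-- To first order, the logarithm map at `exp p` is the translation by `-exp p`. -/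
lemma norm_geoLog_sub_sub_le {a : ℝ} {p q : ℂ} (ha : 0 < a) (hp : a ≤ Real.exp p.re)
    (hq : a ≤ Real.exp q.re) (h : |q.im - p.im| ≤ 1) :
    ‖geoLog a p q - (Complex.exp q - Complex.exp p)‖ ≤ |q.im - p.im| * ‖geoLog a p q‖ := by
  have key : ∀ p q : ℂ, a ≤ Real.exp p.re → a ≤ Real.exp q.re → |q.im - p.im| ≤ 1 →
      touchAngle a p.re + touchAngle a q.re ≤ q.im - p.im →
      ‖geoLog a p q - (Complex.exp q - Complex.exp p)‖ ≤ |q.im - p.im| * ‖geoLog a p q‖ := by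
    intro p q hp hq h1 h
    have h2 := touchAngle_nonneg a p.re
    have h3 := touchAngle_nonneg a q.re
    rw [abs_of_nonneg (by linarith)] at h1 ⊢
    set Φ := q.im - p.im - (touchAngle a p.re + touchAngle a q.re) with hΦ
    have hΦ0 : 0 ≤ Φ := by linarith
    have hn := norm_geoLog_of_far ha hp hq h
    -- Only the excess angle `Φ` contributes to the error: the second tangent segment is turned by
    -- `Φ`, and the arc is replaced by its tangent. The first effect is linear in `Φ` and the second
    -- quadratic.
    have e : geoLog a p q - (Complex.exp q - Complex.exp p) =
        -(Complex.exp (((p.im + touchAngle a p.re : ℝ) : ℂ) * I) *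
          (touchLength a q.re * I * (Complex.exp (I * Φ) - 1)
            + a * (Complex.exp (Φ * I) - 1 - Φ * I))) := by
      have e1 : Complex.exp (((p.im + touchAngle a p.re : ℝ) : ℂ) * I) =
        Complex.exp (p.im * I) * Complex.exp (touchAngle a p.re * I) := by
        rw [← Complex.exp_add]; push_cast; ring_nf
      have e2 : Complex.exp (q.im * I) = Complex.exp (p.im * I) *
          Complex.exp (touchAngle a p.re * I) * Complex.exp (touchAngle a q.re * I) *
            Complex.exp (Φ * I) := by
        rw [← Complex.exp_add, ← Complex.exp_add, ← Complex.exp_add, hΦ]; push_cast; ring_nf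
      have e3 := exp_mul_exp_touchAngle ha hq
      have e4 := exp_eq_mul_exp_touchAngle ha hp
      rw [geoLog_of_far ha hp hq h, exp_eq_ofReal_mul q, exp_eq_ofReal_mul p, e1, e2, e4,
        mul_comm I (Φ : ℂ), involute, involute,
        show q.im - p.im = Φ + (touchAngle a p.re + touchAngle a q.re) by rw [hΦ]; ring]
      push_cast at e3 ⊢
      linear_combination (-Complex.exp (p.im * I) * Complex.exp (touchAngle a p.re * I) * Complex.exp (Φ * I)) * e3
    rw [e, norm_neg, norm_mul, Complex.norm_exp_ofReal_mul_I, one_mul]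
    have n1 : ‖(touchLength a q.re : ℂ) * I * (Complex.exp (I * Φ) - 1)‖ ≤ touchLength a q.re * Φ := by
      rw [norm_mul, norm_mul, Complex.norm_I, Complex.norm_real, Real.norm_eq_abs,
        abs_of_nonneg (touchLength_nonneg a _), mul_one]
      have := Real.norm_exp_I_mul_ofReal_sub_one_le (x := Φ)
      rw [Real.norm_eq_abs, abs_of_nonneg hΦ0] at this
      exact mul_le_mul_of_nonneg_left this (touchLength_nonneg a _)
    have n2 : ‖(a : ℂ) * (Complex.exp (Φ * I) - 1 - Φ * I)‖ ≤ a * Φ ^ 2 := by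
      rw [norm_mul, Complex.norm_real, Real.norm_eq_abs, abs_of_pos ha]
      have hh : ‖(Φ : ℂ) * I‖ = Φ := by
        rw [norm_mul, Complex.norm_I, Complex.norm_real, Real.norm_eq_abs, abs_of_nonneg hΦ0, mul_one]
      have := Complex.norm_exp_sub_one_sub_id_le (x := (Φ : ℂ) * I) (by rw [hh]; linarith)
      rw [hh] at this
      exact mul_le_mul_of_nonneg_left this ha.le
    refine (norm_add_le _ _).trans ((add_le_add n1 n2).trans ?_)
    rw [hn]
    have := touchLength_nonneg a p.re
    have := touchLength_nonneg a q.re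
    calc touchLength a q.re * Φ + a * Φ ^ 2 ≤ Φ * (touchLength a p.re + touchLength a q.re + a * Φ) := by
          nlinarith [mul_nonneg hΦ0 this]
      _ ≤ _ := mul_le_mul_of_nonneg_right (by linarith) (by positivity)
  rcases le_total (|q.im - p.im|) (touchAngle a p.re + touchAngle a q.re) with hv | hf
  · rw [geoLog_of_visible hv, sub_self, norm_zero]; positivity
  rcases le_abs'.1 hf with h' | h'
  · have := key (conj p) (conj q) (by simpa using hp) (by simpa using hq)
      (by rw [Complex.conj_im, Complex.conj_im, ← abs_neg]; convert h using 2; ring)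
      (by simp only [Complex.conj_re, Complex.conj_im]; linarith)
    rw [geoLog_conj, Complex.exp_conj, Complex.exp_conj, ← map_sub, ← map_sub, RCLike.norm_conj,
      RCLike.norm_conj, Complex.conj_im, Complex.conj_im, ← abs_neg] at this
    convert this using 3; ring
  · exact key p q hp hq h h'

/-! ### The logarithm map does not lengthen paths. -/

/-- A map on an interval is controlled by a function `Λ` if it is so on each piece of a finite
closed cover. -/
lemma norm_sub_le_of_closed_cover {E ι : Type*} [NormedAddCommGroup E] [DecidableEq ι] {f : ℝ → E}
    {Λ : ℝ → ℝ} {t : ℝ} (K : ι → Set ℝ) (hK : ∀ i, IsClosed (K i)) (S : Finset ι) :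
    ∀ s ≤ t, (∀ x ∈ Icc s t, ∃ i ∈ S, x ∈ K i) →
      (∀ i, ∀ u ∈ K i, ∀ v ∈ K i, s ≤ u → u ≤ v → v ≤ t → ‖f v - f u‖ ≤ Λ v - Λ u) →
      ‖f t - f s‖ ≤ Λ t - Λ s := by
  induction S using Finset.strongInduction with
  | H S ih =>
    intro s hst hcov hf
    obtain ⟨i, hi, hsi⟩ := hcov s ⟨le_rfl, hst⟩
    have hne : (K i ∩ Icc s t).Nonempty := ⟨s, hsi, le_rfl, hst⟩
    have hcpt : IsCompact (K i ∩ Icc s t) := isCompact_Icc.inter_left (hK i)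
    -- After the last visit `r` to `K i` this piece is no longer needed. The remaining pieces cover
    -- `(r, t]`, hence also `r` because their union is closed.
    obtain ⟨r, hr⟩ : ∃ r, IsGreatest (K i ∩ Icc s t) r := hcpt.exists_isGreatest hne
    have h1 := hf i s hsi r hr.1.1 le_rfl hr.1.2.1 hr.1.2.2
    rcases eq_or_lt_of_le hr.1.2.2 with hrt | hrt
    · rwa [hrt] at h1
    have h2 : ‖f t - f r‖ ≤ Λ t - Λ r := by
      refine ih (S.erase i) (Finset.erase_ssubset hi) r hrt.le ?_
        (fun j u hu v hv h => hf j u hu v hv (hr.1.2.1.trans h))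
      have hcl : IsClosed (⋃ j ∈ S.erase i, K j) :=
        (S.erase i).finite_toSet.isClosed_biUnion fun j _ => hK j
      have hsub : Ioc r t ⊆ ⋃ j ∈ S.erase i, K j := by
        intro x hx
        obtain ⟨j, hj, hxj⟩ := hcov x ⟨hr.1.2.1.trans hx.1.le, hx.2⟩
        simp only [mem_iUnion]
        refine ⟨j, Finset.mem_erase.2 ⟨?_, hj⟩, hxj⟩
        rintro rfl
        exact absurd (hr.2 ⟨hxj, hr.1.2.1.trans hx.1.le, hx.2⟩) (not_le.2 hx.1)
      intro x hx
      have := hcl.closure_subset_iff.2 hsub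
      rw [closure_Ioc hrt.ne] at this
      have := this hx
      simpa only [mem_iUnion, exists_prop] using this
    calc ‖f t - f s‖ ≤ ‖f t - f r‖ + ‖f r - f s‖ := by
          simpa using norm_add_le (f t - f r) (f r - f s)
      _ ≤ Λ t - Λ s := by linarith

lemma norm_sub_le_of_hasDerivWithinAt {E : Type*} [NormedAddCommGroup E] [NormedSpace ℝ E]
    {f f' : ℝ → E} {Λ l : ℝ → ℝ} (hf : ∀ t ∈ Icc (0 : ℝ) 1, HasDerivWithinAt f (f' t) (Icc 0 1) t)
    (hΛ : ∀ t ∈ Icc (0 : ℝ) 1, HasDerivWithinAt Λ (l t) (Icc 0 1) t)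
    (hl : ∀ t ∈ Icc (0 : ℝ) 1, ‖f' t‖ ≤ l t) {s t : ℝ} (hs : 0 ≤ s) (hst : s ≤ t) (ht : t ≤ 1) :
    ‖f t - f s‖ ≤ Λ t - Λ s := by
  have hsub : Icc s t ⊆ Icc 0 1 := Icc_subset_Icc hs ht
  have hmem : ∀ x ∈ Ico s t, Icc (0 : ℝ) 1 ∈ 𝓝[≥] x := fun x hx =>
    mem_of_superset (Icc_mem_nhdsGE (hx.2.trans_le ht)) (Icc_subset_Icc_left (hs.trans hx.1))
  have := image_norm_le_of_norm_deriv_right_le_deriv_boundary' (f := fun x => f x - f s) (f' := f')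
    (B := fun x => Λ x - Λ s) (B' := l) (a := s) (b := t)
    (fun x hx => ((hf x (hsub hx)).continuousWithinAt.mono hsub).sub continuousWithinAt_const)
    (fun x hx => ((hf x (hsub ⟨hx.1, hx.2.le⟩)).mono_of_mem_nhdsWithin (hmem x hx)).sub_const _)
    (by simp)
    (fun x hx => ((hΛ x (hsub hx)).continuousWithinAt.mono hsub).sub continuousWithinAt_const)
    (fun x hx => ((hΛ x (hsub ⟨hx.1, hx.2.le⟩)).mono_of_mem_nhdsWithin (hmem x hx)).sub_const _)
    (fun x hx => hl x (hsub ⟨hx.1, hx.2.le⟩))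
  exact this ⟨hst, le_rfl⟩

/-- The logarithm map does not increase the length of a path. -/
theorem norm_geoLog_sub_geoLog_le {a : ℝ} (ha : 0 < a) {p : ℂ} (hp : a ≤ Real.exp p.re)
    {ζ ζ' : ℝ → ℂ} {Λ l : ℝ → ℝ}
    (hζ : ∀ t ∈ Icc (0 : ℝ) 1, HasDerivWithinAt ζ (ζ' t) (Icc 0 1) t)
    (hζa : ∀ t ∈ Icc (0 : ℝ) 1, a ≤ Real.exp (ζ t).re)
    (hΛ : ∀ t ∈ Icc (0 : ℝ) 1, HasDerivWithinAt Λ (l t) (Icc 0 1) t)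
    (hl : ∀ t ∈ Icc (0 : ℝ) 1, ‖ζ' t‖ * Real.exp (ζ t).re ≤ l t)
    {s t : ℝ} (hs : 0 ≤ s) (hst : s ≤ t) (ht : t ≤ 1) :
    ‖geoLog a p (ζ t) - geoLog a p (ζ s)‖ ≤ Λ t - Λ s := by
  have hcont : ContinuousOn ζ (Icc 0 1) := fun x hx => (hζ x hx).continuousWithinAt
  have hre : ∀ t ∈ Icc (0 : ℝ) 1, HasDerivWithinAt (fun x => (ζ x).re) (ζ' t).re (Icc 0 1) t :=
    fun t ht => Complex.reCLM.hasFDerivAt.comp_hasDerivWithinAt t (hζ t ht)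
  have him : ∀ t ∈ Icc (0 : ℝ) 1, HasDerivWithinAt (fun x => (ζ x).im) (ζ' t).im (Icc 0 1) t :=
    fun t ht => Complex.imCLM.hasFDerivAt.comp_hasDerivWithinAt t (hζ t ht)
  -- Cauchy–Schwarz for the vector `(touchLength, a)`, whose norm is the radius; `ε = ±1` is the
  -- sense of rotation.
  have hspeed : ∀ ε : ℝ, ε ^ 2 = 1 → ∀ t ∈ Icc (0 : ℝ) 1,
      ‖touchLength a (ζ t).re * (ζ' t).re + a * (ε * (ζ' t).im)‖ ≤ l t := by
    intro ε hε t ht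
    refine le_trans ?_ (hl t ht)
    have h0 := Real.exp_pos (ζ t).re
    have hY : touchLength a (ζ t).re ^ 2 = Real.exp (ζ t).re ^ 2 - a ^ 2 :=
      Real.sq_sqrt (by nlinarith [hζa t ht])
    refine abs_le_of_sq_le_sq ?_ (by positivity)
    rw [mul_pow, ← Complex.normSq_eq_norm_sq, Complex.normSq_apply]
    have : Real.exp (ζ t).re ^ 2 = touchLength a (ζ t).re ^ 2 + a ^ 2 := by linarith
    rw [this]
    have him2 : (ζ' t).im * (ζ' t).im = (ε * (ζ' t).im) ^ 2 := by rw [mul_pow, hε]; ring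
    rw [him2]
    nlinarith [sq_nonneg (touchLength a (ζ t).re * (ε * (ζ' t).im) - a * (ζ' t).re)]
  have hinv : ∀ ε : ℝ, ∀ t ∈ Icc (0 : ℝ) 1,
      HasDerivWithinAt (fun x => involute a (ζ x).re + a * (ε * (ζ x).im))
        (touchLength a (ζ t).re * (ζ' t).re + a * (ε * (ζ' t).im)) (Icc 0 1) t := fun ε t ht =>
    ((hasDerivAt_involute ha _).comp_hasDerivWithinAt t (hre t ht)).add
      (((him t ht).const_mul ε).const_mul a)
  have hfar : ∀ ε : ℝ, ε ^ 2 = 1 → ∀ s t, 0 ≤ s → s ≤ t → t ≤ 1 →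
      |(involute a (ζ t).re + a * (ε * (ζ t).im)) - (involute a (ζ s).re + a * (ε * (ζ s).im))|
        ≤ Λ t - Λ s := fun ε hε s t hs hst ht =>
    norm_sub_le_of_hasDerivWithinAt (hinv ε) hΛ (hspeed ε hε) hs hst ht
  have hexp : ∀ t ∈ Icc (0 : ℝ) 1,
      HasDerivWithinAt (fun x => Complex.exp (ζ x)) (Complex.exp (ζ t) * ζ' t) (Icc 0 1) t :=
    fun t ht => (hζ t ht).cexp
  let σ : ℝ → ℝ := fun x => touchAngle a p.re + touchAngle a (ζ x).re
  have hσ : ContinuousOn σ (Icc 0 1) :=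
    continuousOn_const.add ((continuous_touchAngle a).comp_continuousOn
      (Complex.continuous_re.comp_continuousOn hcont))
  have hΔ : ContinuousOn (fun x => (ζ x).im - p.im) (Icc 0 1) :=
    (Complex.continuous_im.comp_continuousOn hcont).sub continuousOn_const
  -- Visible, far in the positive sense, far in the negative sense. The path may switch infinitely
  -- often. On each piece the logarithm is given by an expression that is controlled along the whole
  -- path, so the path may leave the piece between `u` and `v`.
  let K : Fin 3 → Set ℝ := fun i => Icc 0 1 ∩
    (fun x => (match i with
      | 0 => σ x - |(ζ x).im - p.im|
      | 1 => ((ζ x).im - p.im) - σ x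
      | 2 => -((ζ x).im - p.im) - σ x : ℝ)) ⁻¹' Ici 0
  have hK : ∀ i, IsClosed (K i) := by
    intro i
    refine ContinuousOn.preimage_isClosed_of_isClosed ?_ isClosed_Icc isClosed_Ici
    fin_cases i
    · exact hσ.sub hΔ.abs
    · exact hΔ.sub hσ
    · exact hΔ.neg.sub hσ
  refine norm_sub_le_of_closed_cover (f := fun x => geoLog a p (ζ x)) K hK Finset.univ s hst ?_ ?_
  · intro x hx
    have hx' : x ∈ Icc (0 : ℝ) 1 := ⟨hs.trans hx.1, hx.2.trans ht⟩
    rcases le_total (|(ζ x).im - p.im|) (σ x) with h | h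
    · exact ⟨0, Finset.mem_univ _, hx', sub_nonneg.2 h⟩
    rcases le_abs'.1 h with h | h
    · exact ⟨2, Finset.mem_univ _, hx', by simp only [mem_preimage, mem_Ici]; linarith⟩
    · exact ⟨1, Finset.mem_univ _, hx', sub_nonneg.2 h⟩
  · intro i u hu v hv hsu huv hvt
    have hu0 := hu.1
    have hv0 := hv.1
    have hu := hu.2
    have hv := hv.2
    fin_cases i
    · have hu : |(ζ u).im - p.im| ≤ σ u := sub_nonneg.1 hu
      have hv : |(ζ v).im - p.im| ≤ σ v := sub_nonneg.1 hv
      simp only [geoLog_of_visible hu, geoLog_of_visible hv, sub_sub_sub_cancel_right]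
      refine norm_sub_le_of_hasDerivWithinAt hexp hΛ (fun x hx => ?_) hu0.1 huv hv0.2
      rw [norm_mul, Complex.norm_exp, mul_comm]
      exact hl x hx
    · have hu : σ u ≤ (ζ u).im - p.im := sub_nonneg.1 hu
      have hv : σ v ≤ (ζ v).im - p.im := sub_nonneg.1 hv
      simp only [geoLog_of_far ha hp (hζa u hu0) hu, geoLog_of_far ha hp (hζa v hv0) hv]
      rw [← sub_mul, norm_mul, norm_mul, Complex.norm_exp_ofReal_mul_I, Complex.norm_I, mul_one,
        mul_one, ← Complex.ofReal_sub, Complex.norm_real, Real.norm_eq_abs]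
      convert hfar 1 (by norm_num) u v hu0.1 huv hv0.2 using 2
      ring
    · have hu : 0 ≤ -((ζ u).im - p.im) - σ u := hu
      have hv : 0 ≤ -((ζ v).im - p.im) - σ v := hv
      have eu := geoLog_of_far (p := conj p) (q := conj (ζ u)) ha hp (hζa u hu0)
        (by simp only [Complex.conj_re, Complex.conj_im]; linarith)
      have ev := geoLog_of_far (p := conj p) (q := conj (ζ v)) ha hp (hζa v hv0)
        (by simp only [Complex.conj_re, Complex.conj_im]; linarith)
      have e : ‖geoLog a p (ζ v) - geoLog a p (ζ u)‖ =
          ‖geoLog a (conj p) (conj (ζ v)) - geoLog a (conj p) (conj (ζ u))‖ := by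
        rw [geoLog_conj, geoLog_conj, ← map_sub, RCLike.norm_conj]
      change ‖geoLog a p (ζ v) - geoLog a p (ζ u)‖ ≤ _
      rw [e, eu, ev, ← sub_mul, norm_mul, norm_mul, Complex.norm_exp_ofReal_mul_I, Complex.norm_I,
        mul_one, mul_one, ← Complex.ofReal_sub, Complex.norm_real, Real.norm_eq_abs]
      convert hfar (-1) (by norm_num) u v hu0.1 huv hv0.2 using 2
      simp only [Complex.conj_re, Complex.conj_im]
      ring

/-! ### Existence of geodesics, with bounds on radius and angle. -/

/-- `ζ`, with derivative `ζ'`, gives in log-polar coordinates a path from `p` to `q` in the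
exterior of the disc of radius `a` that has the constant speed `‖geoLog a p q‖`. -/
structure IsGeodesic (a : ℝ) (p q : ℂ) (ζ ζ' : ℝ → ℂ) : Prop where
  deriv : ∀ t ∈ Icc (0 : ℝ) 1, HasDerivWithinAt ζ (ζ' t) (Icc 0 1) t
  mem : ∀ t ∈ Icc (0 : ℝ) 1, a ≤ Real.exp (ζ t).re
  zero : ζ 0 = p
  one : ζ 1 = q
  speed : ∀ t ∈ Icc (0 : ℝ) 1, ‖ζ' t‖ * Real.exp (ζ t).re = ‖geoLog a p q‖

lemma IsGeodesic.conj {a : ℝ} {p q : ℂ} {ζ ζ' : ℝ → ℂ} (h : IsGeodesic a p q ζ ζ') :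
    IsGeodesic a (conj p) (conj q) (fun t => conj (ζ t)) (fun t => conj (ζ' t)) where
  deriv t ht := Complex.conjCLE.toContinuousLinearMap.hasFDerivAt.comp_hasDerivWithinAt t (h.deriv t ht)
  mem t ht := by simpa using h.mem t ht
  zero := by simp [h.zero]
  one := by simp [h.one]
  speed t ht := by
    have := h.speed t ht
    rw [geoLog_conj, RCLike.norm_conj, RCLike.norm_conj, Complex.conj_re, this]

/-- The lift to log-polar coordinates of a path of the plane. -/
lemma IsGeodesic.of_exp {a : ℝ} {p q : ℂ} {ζ Γ Γ' : ℝ → ℂ}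
    (hζ : ∀ t ∈ Icc (0 : ℝ) 1, HasDerivWithinAt ζ (Γ' t / Γ t) (Icc 0 1) t)
    (he : ∀ t ∈ Icc (0 : ℝ) 1, Complex.exp (ζ t) = Γ t)
    (h0 : ζ 0 = p) (h1 : ζ 1 = q) (hmem : ∀ t ∈ Icc (0 : ℝ) 1, a ≤ ‖Γ t‖)
    (hs : ∀ t ∈ Icc (0 : ℝ) 1, ‖Γ' t‖ = ‖geoLog a p q‖) :
    IsGeodesic a p q ζ (fun t => Γ' t / Γ t) where
  deriv := hζ
  mem t ht := by rw [← Complex.norm_exp, he t ht]; exact hmem t ht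
  zero := h0
  one := h1
  speed t ht := by
    have : Γ t ≠ 0 := by rw [← he t ht]; exact Complex.exp_ne_zero _
    rw [← Complex.norm_exp, he t ht, norm_div, div_mul_cancel₀ _ (norm_ne_zero_iff.2 this), hs t ht]

/-- The geodesic lifts the chord. The chord turned by `-p.im` is `G`; as its angular width is less
than `π`, it stays in the slit plane and the principal logarithm lifts it. -/
lemma exists_isGeodesic_of_visible {a : ℝ} (ha : 0 < a) {p q : ℂ} (hp : a ≤ Real.exp p.re)
    (hq : a ≤ Real.exp q.re) (h0 : p.im ≤ q.im)
    (h : q.im - p.im ≤ touchAngle a p.re + touchAngle a q.re) :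
    ∃ ζ ζ' : ℝ → ℂ, IsGeodesic a p q ζ ζ' ∧ ContinuousOn ζ' (Icc 0 1) ∧
      ∀ t ∈ Icc (0 : ℝ) 1, (ζ t).re ≤ max p.re q.re ∧ p.im ≤ (ζ t).im ∧ (ζ t).im ≤ q.im := by
  have hp1 := touchAngle_lt ha p.re
  have hq1 := touchAngle_lt ha q.re
  have hpi : q.im - p.im < Real.pi := by linarith
  have hrp := Real.exp_pos p.re
  have hrq := Real.exp_pos q.re
  set Δ := q.im - p.im with hΔ
  have hΔ0 : 0 ≤ Δ := sub_nonneg.2 h0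
  let G : ℝ → ℂ := fun t => (1 - t) * Real.exp p.re + t * (Real.exp q.re * Complex.exp (Δ * I))
  have hG : ∀ t, G t = ⟨(1 - t) * Real.exp p.re + t * (Real.exp q.re * Real.cos Δ),
      t * (Real.exp q.re * Real.sin Δ)⟩ := by
    intro t
    rw [Complex.mk_eq_add_mul_I]
    simp only [G, Complex.exp_mul_I, ← Complex.ofReal_cos, ← Complex.ofReal_sin]
    push_cast; ring
  have hGre : ∀ t, (G t).re = (1 - t) * Real.exp p.re + t * (Real.exp q.re * Real.cos Δ) :=
    fun t => by rw [hG]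
  have hGim : ∀ t, (G t).im = t * (Real.exp q.re * Real.sin Δ) := fun t => by rw [hG]
  have hsin : 0 ≤ Real.sin Δ := Real.sin_nonneg_of_nonneg_of_le_pi hΔ0 hpi.le
  -- the segment stays beyond the tangent line of the circle at a point between its ends
  obtain ⟨δ, hδ0, hδΔ, hδp, hδq⟩ : ∃ δ, 0 ≤ δ ∧ δ ≤ Δ ∧ δ ≤ touchAngle a p.re ∧
      Δ - δ ≤ touchAngle a q.re := by
    refine ⟨min Δ (touchAngle a p.re), le_min hΔ0 (touchAngle_nonneg _ _), min_le_left _ _,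
      min_le_right _ _, ?_⟩
    rcases min_cases Δ (touchAngle a p.re) with ⟨h1, -⟩ | ⟨h1, -⟩ <;> rw [h1]
    · simpa using touchAngle_nonneg a q.re
    · linarith
  have hproj : ∀ t ∈ Icc (0 : ℝ) 1, a ≤ (G t).re * Real.cos δ + (G t).im * Real.sin δ := by
    intro t ht
    rw [hGre, hGim]
    have e1 : a ≤ Real.exp p.re * Real.cos δ := by
      rw [← exp_mul_cos_touchAngle ha hp]
      exact mul_le_mul_of_nonneg_left (Real.cos_le_cos_of_nonneg_of_le_pi hδ0 (by linarith) hδp) hrp.le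
    have e2 : a ≤ Real.exp q.re * (Real.cos Δ * Real.cos δ + Real.sin Δ * Real.sin δ) := by
      rw [← Real.cos_sub, ← exp_mul_cos_touchAngle ha hq]
      exact mul_le_mul_of_nonneg_left
        (Real.cos_le_cos_of_nonneg_of_le_pi (by linarith) (by linarith) hδq) hrq.le
    nlinarith [mul_le_mul_of_nonneg_left e1 (sub_nonneg.2 ht.2), mul_le_mul_of_nonneg_left e2 ht.1]
  have hnorm : ∀ t ∈ Icc (0 : ℝ) 1, a ≤ ‖G t‖ := by
    intro t ht
    refine (hproj t ht).trans (le_trans (le_abs_self _) ?_)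
    refine abs_le_of_sq_le_sq ?_ (norm_nonneg _)
    rw [← Complex.normSq_eq_norm_sq, Complex.normSq_apply]
    nlinarith [sq_nonneg ((G t).re * Real.sin δ - (G t).im * Real.cos δ), Real.sin_sq_add_cos_sq δ]
  have hslit : ∀ t ∈ Icc (0 : ℝ) 1, G t ∈ Complex.slitPlane := by
    intro t ht
    rw [Complex.mem_slitPlane_iff]
    by_cases him : (G t).im = 0
    · left
      rw [hGim] at him
      rw [hGre]
      rcases mul_eq_zero.1 him with h | h
      · simp [h, hrp]
      · have hs0 : Real.sin Δ = 0 := by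
          rcases mul_eq_zero.1 h with h | h
          · exact absurd h hrq.ne'
          · exact h
        have : Δ = 0 := by
          rcases eq_or_lt_of_le hΔ0 with h' | h'
          · exact h'.symm
          · exact absurd hs0 (Real.sin_pos_of_pos_of_lt_pi h' hpi).ne'
        rw [this, Real.cos_zero]
        rcases eq_or_lt_of_le ht.1 with h' | h'
        · simp [← h', hrp]
        · have := mul_pos h' hrq
          have := mul_nonneg (sub_nonneg.2 ht.2) hrp.le
          linarith
    · right; exact him
  let Γ : ℝ → ℂ := fun t => Complex.exp p + t * (Complex.exp q - Complex.exp p)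
  let ζ : ℝ → ℂ := fun t => Complex.log (G t) + p.im * I
  have hΓG : ∀ t, Γ t = G t * Complex.exp (p.im * I) := by
    intro t
    have e : Complex.exp (q.im * I) = Complex.exp (Δ * I) * Complex.exp (p.im * I) := by
      rw [← Complex.exp_add, hΔ]; push_cast; ring_nf
    simp only [Γ, G]
    rw [exp_eq_ofReal_mul q, exp_eq_ofReal_mul p, e]; ring
  have hΓd : ∀ t, HasDerivAt Γ (Complex.exp q - Complex.exp p) t := by
    intro t
    exact (((Complex.ofRealCLM.hasDerivAt (x := t)).mul_const
      (Complex.exp q - Complex.exp p)).const_add (Complex.exp p)).congr_deriv (by simp)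
  have hGd : ∀ t, HasDerivAt G ((Complex.exp q - Complex.exp p) / Complex.exp (p.im * I)) t := by
    intro t
    have e : G = fun t : ℝ => Γ t / Complex.exp (p.im * I) := by
      funext t; rw [hΓG, mul_div_cancel_right₀ _ (Complex.exp_ne_zero _)]
    rw [e]
    exact (hΓd t).div_const _
  have hvis := geoLog_of_visible (a := a) (p := p) (q := q) (by rw [abs_of_nonneg hΔ0]; exact h)
  refine ⟨ζ, fun t => (Complex.exp q - Complex.exp p) / Γ t, ?_, ?_, ?_⟩
  · refine IsGeodesic.of_exp (Γ := Γ) (Γ' := fun _ => Complex.exp q - Complex.exp p) ?_ ?_ ?_ ?_ ?_ ?_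
    · intro t ht
      have := ((hGd t).hasDerivWithinAt.clog_real (s := Icc 0 1) (hslit t ht)).add_const ((p.im : ℂ) * I)
      refine this.congr_deriv ?_
      rw [hΓG, div_div, mul_comm (Complex.exp _)]
    · intro t ht
      rw [Complex.exp_add, Complex.exp_log (Complex.slitPlane_ne_zero (hslit t ht)), hΓG]
    · have : G 0 = Complex.exp (p.re : ℝ) := by simp [G]
      simp only [ζ]
      rw [this, Complex.log_exp (by simp [Real.pi_pos]) (by simp [Real.pi_pos.le]), Complex.re_add_im]
    · have : G 1 = Complex.exp ((q.re : ℂ) + Δ * I) := by simp [G, Complex.exp_add]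
      simp only [ζ]
      rw [this, Complex.log_exp (by simp; linarith [Real.pi_pos]) (by simp [hpi.le]), hΔ]
      push_cast
      conv_rhs => rw [← Complex.re_add_im q]
      ring
    · intro t ht
      rw [hΓG, norm_mul, Complex.norm_exp_ofReal_mul_I, mul_one]; exact hnorm t ht
    · intro t _
      rw [hvis]
  · refine ContinuousOn.div continuousOn_const (fun t _ => (hΓd t).continuousAt.continuousWithinAt) ?_
    intro t ht
    rw [hΓG]
    exact mul_ne_zero (Complex.slitPlane_ne_zero (hslit t ht)) (Complex.exp_ne_zero _)
  · intro t ht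
    have hG0 := Complex.slitPlane_ne_zero (hslit t ht)
    have hn0 := norm_pos_iff.2 hG0
    have hζre : (ζ t).re = Real.log ‖G t‖ := by simp [ζ, Complex.log_re]
    have hζim : (ζ t).im = (G t).arg + p.im := by simp [ζ, Complex.log_im]
    have hGimn : 0 ≤ (G t).im := by
      rw [hGim]; exact mul_nonneg ht.1 (mul_nonneg hrq.le hsin)
    have harg0 : 0 ≤ (G t).arg := Complex.arg_nonneg_iff.2 hGimn
    refine ⟨?_, by linarith, ?_⟩
    · rw [hζre, Real.log_le_iff_le_exp hn0]
      calc ‖G t‖ ≤ (1 - t) * Real.exp p.re + t * Real.exp q.re := by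
            refine (norm_add_le _ _).trans_eq ?_
            rw [norm_mul, norm_mul, norm_mul, Complex.norm_exp_ofReal_mul_I, mul_one,
              Complex.norm_real, Complex.norm_real, Complex.norm_real, Real.norm_of_nonneg hrp.le,
              Real.norm_of_nonneg hrq.le, Real.norm_of_nonneg ht.1, ← Complex.ofReal_one,
              ← Complex.ofReal_sub, Complex.norm_real, Real.norm_of_nonneg (sub_nonneg.2 ht.2)]
        _ ≤ (1 - t) * Real.exp (max p.re q.re) + t * Real.exp (max p.re q.re) :=
            add_le_add (mul_le_mul_of_nonneg_left (Real.exp_le_exp.2 (le_max_left _ _))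
              (sub_nonneg.2 ht.2)) (mul_le_mul_of_nonneg_left (Real.exp_le_exp.2 (le_max_right _ _)) ht.1)
        _ = _ := by ring
    · rw [hζim]
      by_contra! hcon
      have hgt : Δ < (G t).arg := by linarith
      have hle : (G t).arg < Real.pi :=
        lt_of_le_of_ne (Complex.arg_le_pi _) (Complex.mem_slitPlane_iff_arg.1 (hslit t ht)).1
      have hpos : 0 < Real.sin ((G t).arg - Δ) :=
        Real.sin_pos_of_pos_of_lt_pi (by linarith) (by linarith)
      -- The signed distance from the ray at angle `Δ`; its sign shows that the chord does not cross
      -- this ray.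
      have e : ‖G t‖ * Real.sin ((G t).arg - Δ) = -((1 - t) * Real.exp p.re * Real.sin Δ) := by
        rw [Real.sin_sub, mul_sub, ← mul_assoc, ← mul_assoc, Complex.norm_mul_sin_arg,
          Complex.norm_mul_cos_arg, hGre, hGim]
        ring
      have := mul_pos hn0 hpos
      have := mul_nonneg (mul_nonneg (sub_nonneg.2 ht.2) hrp.le) hsin
      linarith

/-- By continuity the increments of `ζ` near `t` have imaginary part in `(-π, π)`, where
`Complex.log` inverts the exponential. -/
lemma hasDerivWithinAt_of_cexp {ζ : ℝ → ℂ} {s : Set ℝ} {t : ℝ} {G' : ℂ}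
    (h : HasDerivWithinAt (fun x => Complex.exp (ζ x)) G' s t) (hc : ContinuousWithinAt ζ s t) :
    HasDerivWithinAt ζ (G' / Complex.exp (ζ t)) s t := by
  have h1 : HasDerivWithinAt (fun x => ζ t + Complex.log (Complex.exp (ζ x) / Complex.exp (ζ t)))
      (G' / Complex.exp (ζ t)) s t := by
    have := (h.div_const (Complex.exp (ζ t))).clog_real
      (by rw [div_self (Complex.exp_ne_zero _)]; exact Complex.one_mem_slitPlane)
    refine (this.const_add (ζ t)).congr_deriv ?_
    rw [div_self (Complex.exp_ne_zero _), div_one]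
  refine h1.congr_of_eventuallyEq ?_ ?_
  · have hlim : Tendsto (fun x => (ζ x - ζ t).im) (𝓝[s] t) (𝓝 0) := by
      have : ContinuousWithinAt (fun x => (ζ x - ζ t).im) s t :=
        Complex.continuous_im.continuousAt.comp_continuousWithinAt (hc.sub continuousWithinAt_const)
      simpa [ContinuousWithinAt] using this
    filter_upwards [hlim.eventually (Ioo_mem_nhds (neg_lt_zero.2 Real.pi_pos) Real.pi_pos)] with x hx
    rw [← Complex.exp_sub, Complex.log_exp hx.1 hx.2.le]; ring
  · rw [div_self (Complex.exp_ne_zero _), Complex.log_one, add_zero]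

/-- A curve of unit speed: the tangent line at `a` for `x < 0`, then the circle. It is `C¹` at the
junction because the velocities agree. -/
lemma hasDerivAt_segment_arc {a : ℝ} (ha : 0 < a) (x : ℝ) :
    HasDerivAt (fun x : ℝ => ((a : ℂ) + ((x - max x 0 : ℝ) : ℂ) * I) *
        Complex.exp (((max x 0 / a : ℝ) : ℂ) * I)) (I * Complex.exp (((max x 0 / a : ℝ) : ℂ) * I)) x := by
  have key : ∀ y : ℝ, y ≠ 0 → HasDerivAt (fun x : ℝ => ((a : ℂ) + ((x - max x 0 : ℝ) : ℂ) * I) *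
        Complex.exp (((max x 0 / a : ℝ) : ℂ) * I)) (I * Complex.exp (((max y 0 / a : ℝ) : ℂ) * I)) y := by
    intro y hy
    have hid : HasDerivAt (fun x : ℝ => (x : ℂ)) 1 y := Complex.ofRealCLM.hasDerivAt
    rcases lt_or_gt_of_ne hy with hy | hy
    · have h1 : HasDerivAt (fun x : ℝ => (a : ℂ) + (x : ℂ) * I) I y :=
        ((hid.mul_const I).const_add _).congr_deriv (one_mul _)
      refine (h1.congr_of_eventuallyEq ?_).congr_deriv ?_
      · filter_upwards [eventually_lt_nhds hy] with z hz
        rw [max_eq_right hz.le]; simp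
      · rw [max_eq_right hy.le]; simp
    · have h1 : HasDerivAt (fun x : ℝ => (a : ℂ) * Complex.exp ((x / a : ℂ) * I))
          ((a : ℂ) * (Complex.exp ((y / a : ℂ) * I) * (1 / a * I))) y :=
        (((hid.div_const _).mul_const I).cexp).const_mul _
      refine (h1.congr_of_eventuallyEq ?_).congr_deriv ?_
      · filter_upwards [eventually_gt_nhds hy] with z hz
        rw [max_eq_left hz.le]; simp
      · rw [max_eq_left hy.le]
        have : (a : ℂ) ≠ 0 := Complex.ofReal_ne_zero.2 ha.ne'
        push_cast; field_simp
  by_cases hx : x = 0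
  · rw [hx]
    exact hasDerivAt_of_hasDerivAt_of_ne (x := 0)
      (g := fun y : ℝ => I * Complex.exp (((max y 0 / a : ℝ) : ℂ) * I)) key
      (by fun_prop) (by fun_prop)
  · exact key x hx

/-- The previous curve run backwards, reflected and turned by `l / a`: first the circle, then a
tangent line from `x = l` on. -/
lemma hasDerivAt_arc_segment {a : ℝ} (ha : 0 < a) (l x : ℝ) :
    HasDerivAt (fun x : ℝ => ((a : ℂ) + ((x - min x l : ℝ) : ℂ) * I) *
        Complex.exp (((min x l / a : ℝ) : ℂ) * I)) (I * Complex.exp (((min x l / a : ℝ) : ℂ) * I)) x := by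
  have h := ((hasDerivAt_segment_arc ha (l - x)).star).scomp x ((hasDerivAt_id x).const_sub l)
  have h2 := h.const_mul (Complex.exp (((l / a : ℝ) : ℂ) * I))
  have e : ∀ z : ℝ, max (l - z) 0 = l - min z l := by
    intro z
    rcases le_total z l with hz | hz
    · rw [min_eq_left hz, max_eq_left (sub_nonneg.2 hz)]
    · rw [min_eq_right hz, max_eq_right (sub_nonpos.2 hz), sub_self]
  have e2 : ∀ z : ℝ, Complex.exp (((l / a : ℝ) : ℂ) * I) *
      conj (Complex.exp ((((l - min z l) / a : ℝ) : ℂ) * I)) = Complex.exp (((min z l / a : ℝ) : ℂ) * I) := by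
    intro z
    rw [← Complex.exp_conj, ← Complex.exp_add, map_mul, Complex.conj_I, Complex.conj_ofReal]
    congr 1; push_cast; ring
  refine (h2.congr_of_eventuallyEq (Eventually.of_forall fun z => ?_)).congr_deriv ?_
  · simp only [Function.comp, e, ← starRingEnd_apply]
    rw [map_mul, map_add, map_mul, Complex.conj_ofReal, Complex.conj_ofReal, Complex.conj_I, ← e2 z]
    push_cast; ring
  · simp only [e, ← starRingEnd_apply]
    rw [map_mul, Complex.conj_I, ← e2 x]
    simp; ring

/-- The taut string by arc length `s`, from `-touchLength a p.re` to `l + touchLength a q.re`: the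
arc is `0 ≤ s ≤ l`, which is why `m` clamps to `[0, l]`, and `Y` is the signed position on the
tangent lines. -/
lemma exists_isGeodesic_of_far {a : ℝ} (ha : 0 < a) {p q : ℂ} (hp : a ≤ Real.exp p.re)
    (hq : a ≤ Real.exp q.re)
    (h : touchAngle a p.re + touchAngle a q.re < q.im - p.im) :
    ∃ ζ ζ' : ℝ → ℂ, IsGeodesic a p q ζ ζ' ∧ ContinuousOn ζ' (Icc 0 1) ∧
      ∀ t ∈ Icc (0 : ℝ) 1, (ζ t).re ≤ max p.re q.re ∧ p.im ≤ (ζ t).im ∧ (ζ t).im ≤ q.im := by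
  set l := a * (q.im - p.im - (touchAngle a p.re + touchAngle a q.re)) with hl
  have hl0 : 0 < l := mul_pos ha (by linarith)
  have hn : ‖geoLog a p q‖ = touchLength a p.re + touchLength a q.re + l :=
    norm_geoLog_of_far ha hp hq h.le
  set D := ‖geoLog a p q‖ with hD
  have hY0 := touchLength_nonneg a p.re
  have hY1 := touchLength_nonneg a q.re
  let m : ℝ → ℝ := fun x => max 0 (min x l)
  have hm : Continuous m := by fun_prop
  have hm0 : ∀ x, 0 ≤ m x := fun x => le_max_left _ _
  have hml : ∀ x, m x ≤ l := fun x => max_le hl0.le (min_le_right _ _)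
  let β := p.im + touchAngle a p.re
  have hg : ∀ x : ℝ, HasDerivAt (fun x : ℝ => ((a : ℂ) + ((x - m x : ℝ) : ℂ) * I) *
      Complex.exp (((m x / a : ℝ) : ℂ) * I)) (I * Complex.exp (((m x / a : ℝ) : ℂ) * I)) x := by
    intro x
    -- The two one-junction formulas overlap on `(0, l)`, so together they cover the curve; this
    -- needs `l > 0`, that is, the strict inequality of the hypothesis.
    rcases lt_or_ge x l with hx | hx
    · have e : ∀ z < l, m z = max z 0 := fun z hz => by
        simp only [m]; rw [min_eq_left hz.le, max_comm]
      rw [e x hx]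
      refine (hasDerivAt_segment_arc ha x).congr_of_eventuallyEq ?_
      filter_upwards [eventually_lt_nhds hx] with z hz
      rw [e z hz]
    · have e : ∀ z, 0 < z → m z = min z l := fun z hz => by
        simp only [m]; rw [max_eq_right (le_min hz.le hl0.le)]
      have hx0 := hl0.trans_le hx
      rw [e x hx0]
      refine (hasDerivAt_arc_segment ha l x).congr_of_eventuallyEq ?_
      filter_upwards [eventually_gt_nhds hx0] with z hz
      rw [e z hz]
  let s : ℝ → ℝ := fun t => t * D - touchLength a p.re
  have hs : ∀ t, HasDerivAt s D t := fun t => (hasDerivAt_mul_const D).sub_const _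
  have hsc : Continuous s := by fun_prop
  let Y : ℝ → ℝ := fun t => s t - m (s t)
  have hYc : Continuous Y := by fun_prop
  -- The first summand comes from the right half-plane, where the principal logarithm is continuous.
  -- The rotation along the arc is added outside it, so the total angle may be arbitrarily large.
  let ζ : ℝ → ℂ := fun t => Complex.log (a + Y t * I) + ((β + m (s t) / a : ℝ) : ℂ) * I
  have hslit : ∀ t, (a + Y t * I : ℂ) ∈ Complex.slitPlane := fun t => by
    left; simpa using ha
  let Γ : ℝ → ℂ := fun t => (a + Y t * I) * Complex.exp (((m (s t) / a : ℝ) : ℂ) * I) *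
    Complex.exp (β * I)
  let Γ' : ℝ → ℂ := fun t => D * (I * Complex.exp (((m (s t) / a : ℝ) : ℂ) * I)) * Complex.exp (β * I)
  have hΓ : ∀ t, HasDerivAt Γ (Γ' t) t := fun t => by
    have := ((hg (s t)).scomp t (hs t)).mul_const (Complex.exp (β * I))
    refine this.congr_deriv ?_
    simp only [Γ', Complex.real_smul]
  have hexp : ∀ t, Complex.exp (ζ t) = Γ t := by
    intro t
    simp only [ζ, Γ]
    rw [Complex.exp_add, Complex.exp_log (Complex.slitPlane_ne_zero (hslit t)), mul_assoc,
      ← Complex.exp_add]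
    congr 2; push_cast; ring
  have hζc : Continuous ζ := by
    refine Continuous.add (Continuous.clog (by fun_prop) hslit) (by fun_prop)
  have hζd : ∀ t ∈ Icc (0 : ℝ) 1, HasDerivWithinAt ζ (Γ' t / Γ t) (Icc 0 1) t := by
    intro t _
    rw [← hexp]
    refine hasDerivWithinAt_of_cexp ?_ hζc.continuousWithinAt
    simp only [hexp]
    exact (hΓ t).hasDerivWithinAt
  have hYb : ∀ t ∈ Icc (0 : ℝ) 1, -touchLength a p.re ≤ Y t ∧ Y t ≤ touchLength a q.re := by
    intro t ht
    have hD0 : 0 ≤ D := norm_nonneg _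
    have h1 : 0 ≤ t * D := mul_nonneg ht.1 hD0
    have h2 : t * D ≤ D := mul_le_of_le_one_left hD0 ht.2
    simp only [Y, s, m]
    rcases le_total (t * D - touchLength a p.re) 0 with h3 | h3
    · rw [min_eq_left (h3.trans hl0.le), max_eq_left h3]; constructor <;> linarith
    rcases le_total (t * D - touchLength a p.re) l with h4 | h4
    · rw [min_eq_left h4, max_eq_right h3]; constructor <;> linarith
    · rw [min_eq_right h4, max_eq_right hl0.le]; constructor <;> linarith
  have hnorm2 : ∀ y : ℝ, ‖(a + y * I : ℂ)‖ ^ 2 = a ^ 2 + y ^ 2 := by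
    intro y
    rw [← Complex.normSq_eq_norm_sq, Complex.normSq_apply]; simp; ring
  have hnormΓ : ∀ t, ‖Γ t‖ = ‖(a + Y t * I : ℂ)‖ := by
    intro t
    simp only [Γ, norm_mul, Complex.norm_exp_ofReal_mul_I, mul_one]
  have hα : ∀ u, a ≤ Real.exp u → Complex.arg (a + touchLength a u * I) = touchAngle a u := by
    intro u hu
    rw [← exp_mul_exp_touchAngle ha hu, Complex.exp_mul_I]
    exact Complex.arg_mul_cos_add_sin_mul_I (Real.exp_pos u)
      ⟨by linarith [Real.pi_pos, touchAngle_nonneg a u], by linarith [Real.pi_pos, touchAngle_lt ha u]⟩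
  have harctan : ∀ y : ℝ, Complex.arg (a + y * I) = Real.arctan (y / a) := by
    intro y
    rw [← Complex.mk_eq_add_mul_I, Complex.arg, if_pos ha.le, Real.arctan_eq_arcsin]
    congr 1
    simp only [Complex.norm_def, Complex.normSq_mk]
    rw [show 1 + (y / a) ^ 2 = (a * a + y * y) / a ^ 2 by field_simp, Real.sqrt_div (add_nonneg (mul_self_nonneg a) (mul_self_nonneg y)),
      Real.sqrt_sq ha.le]
    field_simp
  refine ⟨ζ, fun t => Γ' t / Γ t, ?_, ?_, ?_⟩
  · refine IsGeodesic.of_exp (Γ := Γ) (Γ' := Γ') hζd (fun t _ => hexp t) ?_ ?_ ?_ ?_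
    · have e0 : s 0 = -touchLength a p.re := by simp [s]
      have e1 : m (s 0) = 0 := by
        rw [e0]; exact max_eq_left ((min_le_left _ _).trans (by linarith))
      have e2 : Y 0 = -touchLength a p.re := by simp only [Y]; rw [e1, e0, sub_zero]
      have : (a + Y 0 * I : ℂ) = Complex.exp (p.re - touchAngle a p.re * I) := by
        rw [Complex.exp_sub, ← Complex.ofReal_exp, exp_eq_mul_exp_touchAngle ha hp,
          mul_div_cancel_right₀ _ (Complex.exp_ne_zero _), e2]
        push_cast; ring
      simp only [ζ]
      have hlt := touchAngle_lt ha p.re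
      have hnn := touchAngle_nonneg a p.re
      rw [this, e1, Complex.log_exp (by simp; linarith [Real.pi_pos]) (by simp; linarith [Real.pi_pos])]
      conv_rhs => rw [← Complex.re_add_im p]
      simp only [β]; push_cast; ring
    · have e0 : s 1 = touchLength a q.re + l := by simp only [s]; rw [hn]; ring
      have e1 : m (s 1) = l := by
        rw [e0]; simp only [m]; rw [min_eq_right (by linarith), max_eq_right hl0.le]
      have e2 : Y 1 = touchLength a q.re := by simp only [Y]; rw [e1, e0]; ring
      have : (a + Y 1 * I : ℂ) = Complex.exp (q.re + touchAngle a q.re * I) := by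
        rw [Complex.exp_add, ← Complex.ofReal_exp, exp_mul_exp_touchAngle ha hq, e2]
      simp only [ζ]
      have hlt := touchAngle_lt ha q.re
      have hnn := touchAngle_nonneg a q.re
      rw [this, e1, Complex.log_exp (by simp; linarith [Real.pi_pos]) (by simp; linarith [Real.pi_pos])]
      conv_rhs => rw [← Complex.re_add_im q]
      rw [hl, mul_div_cancel_left₀ _ ha.ne']
      simp only [β]; push_cast; ring
    · intro t _
      rw [hnormΓ]
      refine le_of_sq_le_sq ?_ (norm_nonneg _)
      rw [hnorm2]; nlinarith [sq_nonneg (Y t)]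
    · intro t _
      simp only [Γ', norm_mul, Complex.norm_exp_ofReal_mul_I, mul_one, Complex.norm_I,
        Complex.norm_real]
      rw [hD, norm_norm]
  · refine Continuous.continuousOn (Continuous.div ?_ ?_ ?_)
    · fun_prop
    · exact continuous_iff_continuousAt.2 fun t => (hΓ t).continuousAt
    · intro t; rw [← hexp]; exact Complex.exp_ne_zero _
  · intro t ht
    obtain ⟨hy1, hy2⟩ := hYb t ht
    have him : (ζ t).im = Real.arctan (Y t / a) + (β + m (s t) / a) := by
      simp only [ζ, Complex.add_im, Complex.log_im, harctan]
      simp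
    have hre : Real.exp (ζ t).re = ‖(a + Y t * I : ℂ)‖ := by
      rw [← Complex.norm_exp, hexp, hnormΓ]
    have hma : 0 ≤ m (s t) / a := div_nonneg (hm0 _) ha.le
    have hma' : m (s t) / a ≤ q.im - p.im - (touchAngle a p.re + touchAngle a q.re) := by
      rw [div_le_iff₀' ha]; exact hml _
    have hap : Real.arctan (touchLength a p.re / a) = touchAngle a p.re := by rw [← harctan, hα _ hp]
    have haq : Real.arctan (touchLength a q.re / a) = touchAngle a q.re := by rw [← harctan, hα _ hq]
    have t1 : -touchAngle a p.re ≤ Real.arctan (Y t / a) := by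
      rw [← hap, ← Real.arctan_neg, ← neg_div]
      exact Real.arctan_mono (div_le_div_of_nonneg_right hy1 ha.le)
    have t2 : Real.arctan (Y t / a) ≤ touchAngle a q.re := by
      rw [← haq]
      exact Real.arctan_mono (div_le_div_of_nonneg_right hy2 ha.le)
    refine ⟨?_, by rw [him]; simp only [β]; linarith, by rw [him]; simp only [β]; linarith⟩
    have hsq : ∀ u, a ≤ Real.exp u → a ^ 2 + touchLength a u ^ 2 = Real.exp u ^ 2 := by
      intro u hu
      rw [touchLength, Real.sq_sqrt (by nlinarith [Real.exp_pos u])]; ring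
    rcases le_total 0 (Y t) with hy | hy
    · refine le_max_of_le_right (Real.exp_le_exp.1 ?_)
      rw [hre]
      refine le_of_sq_le_sq ?_ (Real.exp_pos _).le
      rw [hnorm2, ← hsq _ hq]
      nlinarith
    · refine le_max_of_le_left (Real.exp_le_exp.1 ?_)
      rw [hre]
      refine le_of_sq_le_sq ?_ (Real.exp_pos _).le
      rw [hnorm2, ← hsq _ hp]
      nlinarith

/-- Any two points are joined by a geodesic. -/
theorem exists_isGeodesic {a : ℝ} (ha : 0 < a) {p q : ℂ} (hp : a ≤ Real.exp p.re)
    (hq : a ≤ Real.exp q.re) :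
    ∃ ζ ζ' : ℝ → ℂ, IsGeodesic a p q ζ ζ' ∧ ContinuousOn ζ' (Icc 0 1) ∧
      ∀ t ∈ Icc (0 : ℝ) 1, (ζ t).re ≤ max p.re q.re ∧ (ζ t).im ∈ uIcc p.im q.im := by
  have key : ∀ p q : ℂ, a ≤ Real.exp p.re → a ≤ Real.exp q.re → p.im ≤ q.im →
      ∃ ζ ζ' : ℝ → ℂ, IsGeodesic a p q ζ ζ' ∧ ContinuousOn ζ' (Icc 0 1) ∧
      ∀ t ∈ Icc (0 : ℝ) 1, (ζ t).re ≤ max p.re q.re ∧ p.im ≤ (ζ t).im ∧ (ζ t).im ≤ q.im := by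
    intro p q hp hq h
    rcases le_or_gt (q.im - p.im) (touchAngle a p.re + touchAngle a q.re) with hv | hf
    · exact exists_isGeodesic_of_visible ha hp hq h hv
    · exact exists_isGeodesic_of_far ha hp hq hf
  rcases le_total p.im q.im with h | h
  · obtain ⟨ζ, ζ', h1, h2, h3⟩ := key p q hp hq h
    exact ⟨ζ, ζ', h1, h2, fun t ht => ⟨(h3 t ht).1, by rw [uIcc_of_le h]; exact (h3 t ht).2⟩⟩
  · obtain ⟨ζ, ζ', h1, h2, h3⟩ := key (conj p) (conj q) hp hq (by simpa using h)
    refine ⟨fun t => conj (ζ t), fun t => conj (ζ' t), by simpa using h1.conj,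
      Complex.continuous_conj.comp_continuousOn h2, fun t ht => ⟨by simpa using (h3 t ht).1, ?_⟩⟩
    have := (h3 t ht).2
    simp only [Complex.conj_im] at this ⊢
    rw [uIcc_of_ge h]
    constructor <;> linarith

/-! ### The distance: triangle inequality, uniqueness of geodesics, midpoints. -/

lemma geoLog_self (a : ℝ) (p : ℂ) : geoLog a p p = 0 := by
  rw [geoLog_of_visible, sub_self]
  rw [sub_self, abs_zero]
  exact add_nonneg (touchAngle_nonneg _ _) (touchAngle_nonneg _ _)

/-- The comparison inequality of nonpositive curvature: the logarithm map does not increase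
distances. -/
theorem norm_geoLog_sub_geoLog_le_norm {a : ℝ} (ha : 0 < a) {x p q : ℂ} (hx : a ≤ Real.exp x.re)
    (hp : a ≤ Real.exp p.re) (hq : a ≤ Real.exp q.re) :
    ‖geoLog a x q - geoLog a x p‖ ≤ ‖geoLog a p q‖ := by
  obtain ⟨ζ, ζ', h, -, -⟩ := exists_isGeodesic ha hp hq
  have := norm_geoLog_sub_geoLog_le ha hx h.deriv h.mem (Λ := fun t => t * ‖geoLog a p q‖)
    (l := fun _ => ‖geoLog a p q‖) (fun t _ => (hasDerivAt_mul_const _).hasDerivWithinAt)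
    (fun t ht => (h.speed t ht).le) le_rfl zero_le_one le_rfl
  rw [h.zero, h.one] at this
  simpa using this

/-- Symmetry is the comparison inequality with two of its points equal. -/
lemma norm_geoLog_comm {a : ℝ} (ha : 0 < a) {p q : ℂ} (hp : a ≤ Real.exp p.re)
    (hq : a ≤ Real.exp q.re) : ‖geoLog a p q‖ = ‖geoLog a q p‖ := by
  have key : ∀ p q : ℂ, a ≤ Real.exp p.re → a ≤ Real.exp q.re → ‖geoLog a p q‖ ≤ ‖geoLog a q p‖ := by
    intro p q hp hq
    have := norm_geoLog_sub_geoLog_le_norm ha hp hq hp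
    rwa [geoLog_self, zero_sub, norm_neg] at this
  exact le_antisymm (key p q hp hq) (key q p hq hp)

lemma norm_geoLog_triangle {a : ℝ} (ha : 0 < a) {p q r : ℂ} (hp : a ≤ Real.exp p.re)
    (hq : a ≤ Real.exp q.re) (hr : a ≤ Real.exp r.re) :
    ‖geoLog a p r‖ ≤ ‖geoLog a p q‖ + ‖geoLog a q r‖ := by
  have h1 := norm_geoLog_sub_geoLog_le_norm ha hp hq hr
  have h2 := norm_add_le (geoLog a p r - geoLog a p q) (geoLog a p q)
  rw [sub_add_cancel] at h2
  linarith

namespace IsGeodesic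

variable {a : ℝ} {p q : ℂ} {ζ ζ' : ℝ → ℂ}

lemma norm_geoLog_sub_le (h : IsGeodesic a p q ζ ζ') (ha : 0 < a) {x : ℂ} (hx : a ≤ Real.exp x.re)
    {s t : ℝ} (hs : s ∈ Icc (0 : ℝ) 1) (ht : t ∈ Icc (0 : ℝ) 1) :
    ‖geoLog a x (ζ t) - geoLog a x (ζ s)‖ ≤ |t - s| * ‖geoLog a p q‖ := by
  have key : ∀ s t : ℝ, 0 ≤ s → s ≤ t → t ≤ 1 →
      ‖geoLog a x (ζ t) - geoLog a x (ζ s)‖ ≤ (t - s) * ‖geoLog a p q‖ := by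
    intro s t hs hst ht
    have := norm_geoLog_sub_geoLog_le ha hx h.deriv h.mem (Λ := fun t => t * ‖geoLog a p q‖)
      (l := fun _ => ‖geoLog a p q‖) (fun t _ => (hasDerivAt_mul_const _).hasDerivWithinAt)
      (fun t ht => (h.speed t ht).le) hs hst ht
    rwa [← sub_mul] at this
  rcases le_total s t with hst | hst
  · rw [abs_of_nonneg (sub_nonneg.2 hst)]; exact key s t hs.1 hst ht.2
  · rw [abs_sub_comm, abs_of_nonneg (sub_nonneg.2 hst), norm_sub_rev]; exact key t s ht.1 hst hs.2

/-- Constant speed gives the upper bound; if it were strict somewhere, the triangle inequality from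
`p` to `q` would fail. -/
lemma norm_geoLog (h : IsGeodesic a p q ζ ζ') (ha : 0 < a) {s t : ℝ} (hs : s ∈ Icc (0 : ℝ) 1)
    (ht : t ∈ Icc (0 : ℝ) 1) : ‖geoLog a (ζ s) (ζ t)‖ = |t - s| * ‖geoLog a p q‖ := by
  have le : ∀ s t : ℝ, s ∈ Icc (0 : ℝ) 1 → t ∈ Icc (0 : ℝ) 1 →
      ‖geoLog a (ζ s) (ζ t)‖ ≤ |t - s| * ‖geoLog a p q‖ := by
    intro s t hs ht
    have := h.norm_geoLog_sub_le ha (h.mem s hs) hs ht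
    rwa [geoLog_self, sub_zero] at this
  have key : ∀ s t : ℝ, s ∈ Icc (0 : ℝ) 1 → t ∈ Icc (0 : ℝ) 1 → s ≤ t →
      (t - s) * ‖geoLog a p q‖ ≤ ‖geoLog a (ζ s) (ζ t)‖ := by
    intro s t hs ht hst
    have m0 : (0 : ℝ) ∈ Icc (0 : ℝ) 1 := ⟨le_rfl, zero_le_one⟩
    have m1 : (1 : ℝ) ∈ Icc (0 : ℝ) 1 := ⟨zero_le_one, le_rfl⟩
    have h1 := norm_geoLog_triangle ha (h.mem 0 m0) (h.mem s hs) (h.mem 1 m1)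
    have h2 := norm_geoLog_triangle ha (h.mem s hs) (h.mem t ht) (h.mem 1 m1)
    have h3 := le 0 s m0 hs
    have h4 := le t 1 ht m1
    rw [h.zero] at h1 h3
    rw [h.one] at h1 h2 h4
    rw [abs_of_nonneg (by linarith [hs.1])] at h3
    rw [abs_of_nonneg (by linarith [ht.2])] at h4
    linarith
  refine le_antisymm (le s t hs ht) ?_
  rcases le_total s t with hst | hst
  · rw [abs_of_nonneg (sub_nonneg.2 hst)]; exact key s t hs ht hst
  · rw [norm_geoLog_comm ha (h.mem s hs) (h.mem t ht), abs_sub_comm,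
      abs_of_nonneg (sub_nonneg.2 hst)]
    exact key t s ht hs hst

/-- The logarithm map unrolls a geodesic along its tangent line. -/
theorem geoLog_eq (h : IsGeodesic a p q ζ ζ') (ha : 0 < a) {t t' : ℝ} (ht : t ∈ Icc (0 : ℝ) 1)
    (ht' : t' ∈ Icc (0 : ℝ) 1) :
    geoLog a (ζ t) (ζ t') = ((t' - t : ℝ) : ℂ) * (Complex.exp (ζ t) * ζ' t) := by
  let s : ℝ → ℝ := fun r => t + r * (t' - t)
  have hs : ∀ r ∈ Icc (0 : ℝ) 1, s r ∈ Icc (0 : ℝ) 1 := by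
    intro r hr
    have := (convex_Icc (0 : ℝ) 1).add_smul_sub_mem ht ht' hr
    simpa [s] using this
  set V := geoLog a (ζ t) (ζ t') with hV
  -- The image lies at distance `r ‖V‖` from `0` and `(1 - r) ‖V‖` from `V`; by strict convexity of
  -- the Euclidean norm it is on the segment.
  have hW : ∀ r ∈ Icc (0 : ℝ) 1, geoLog a (ζ t) (ζ (s r)) = (r : ℂ) * V := by
    intro r hr
    have n1 : ‖geoLog a (ζ t) (ζ (s r))‖ = r * ‖V‖ := by
      rw [h.norm_geoLog ha ht (hs r hr), hV, h.norm_geoLog ha ht ht']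
      simp only [s, add_sub_cancel_left, abs_mul, abs_of_nonneg hr.1]; ring
    have n2 : ‖V - geoLog a (ζ t) (ζ (s r))‖ ≤ (1 - r) * ‖V‖ := by
      refine (h.norm_geoLog_sub_le ha (h.mem t ht) (hs r hr) ht').trans_eq ?_
      rw [hV, h.norm_geoLog ha ht ht',
        show t' - s r = (1 - r) * (t' - t) by simp only [s]; ring, abs_mul,
        abs_of_nonneg (sub_nonneg.2 hr.2)]; ring
    have n3 : (1 - r) * ‖V‖ ≤ ‖V - geoLog a (ζ t) (ζ (s r))‖ := by
      have := norm_sub_norm_le V (geoLog a (ζ t) (ζ (s r)))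
      rw [n1] at this; linarith
    have := eq_lineMap_of_dist_eq_mul_of_dist_eq_mul (x := (0 : ℂ)) (z := V)
      (y := geoLog a (ζ t) (ζ (s r))) (r := r) (by rw [dist_zero_left, dist_zero_left, n1])
      (by rw [dist_comm, dist_eq_norm, dist_zero_left]; exact le_antisymm n2 n3)
    rw [this, AffineMap.lineMap_apply]; simp
  have hd : HasDerivWithinAt (fun r => Complex.exp (ζ (s r)))
      (((t' - t : ℝ) : ℂ) * (Complex.exp (ζ t) * ζ' t)) (Icc 0 1) 0 := by
    have e0 : s 0 = t := by simp [s]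
    have h1 : HasDerivWithinAt s (t' - t) (Icc 0 1) 0 :=
      ((hasDerivAt_mul_const _).const_add t).hasDerivWithinAt
    have h2 : HasDerivWithinAt (fun x => Complex.exp (ζ x)) (Complex.exp (ζ t) * ζ' t) (Icc 0 1)
        (s 0) := by rw [e0]; exact (h.deriv t ht).cexp
    exact (h2.scomp (0 : ℝ) h1 hs).congr_deriv (by rw [Complex.real_smul])
  have hmem : Icc (0 : ℝ) 1 ∈ 𝓝[>] (0 : ℝ) :=
    mem_of_superset (Ioc_mem_nhdsGT one_pos) Ioc_subset_Icc_self
  have hd' : Tendsto (fun r : ℝ => r⁻¹ • (Complex.exp (ζ (s r)) - Complex.exp (ζ t))) (𝓝[>] 0)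
      (𝓝 (((t' - t : ℝ) : ℂ) * (Complex.exp (ζ t) * ζ' t))) := by
    have hd2 : HasDerivWithinAt (fun r => Complex.exp (ζ (s r)))
        (((t' - t : ℝ) : ℂ) * (Complex.exp (ζ t) * ζ' t)) (Ioi 0) 0 :=
      hd.mono_of_mem_nhdsWithin hmem
    refine ((hasDerivWithinAt_iff_tendsto_slope' self_notMem_Ioi).1 hd2).congr fun r => ?_
    have e0 : s 0 = t := by simp only [s, zero_mul, add_zero]
    rw [slope_def_module, sub_zero, e0]
  have him : Tendsto (fun r : ℝ => |(ζ (s r)).im - (ζ t).im|) (𝓝[>] 0) (𝓝 0) := by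
    have hc : ContinuousWithinAt (fun r => |(ζ (s r)).im - (ζ t).im|) (Icc 0 1) 0 := by
      have h1 : ContinuousWithinAt ζ (Icc 0 1) (s 0) := by
        have : s 0 = t := by simp [s]
        rw [this]; exact (h.deriv t ht).continuousWithinAt
      have h2 : ContinuousWithinAt s (Icc 0 1) 0 := by
        apply Continuous.continuousWithinAt; fun_prop
      exact ((Complex.continuous_im.continuousAt.comp_continuousWithinAt (h1.comp h2 hs)).sub
        continuousWithinAt_const).abs
    have h2 := hc.tendsto.mono_left (nhdsWithin_le_of_mem hmem)
    have e0 : s 0 = t := by simp only [s, zero_mul, add_zero]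
    simpa only [e0, sub_self, abs_zero] using h2
  -- To first order the logarithm is a translation, so the constant `V` is the velocity of `exp ∘ ζ
  -- ∘ s` at `0`.
  have hlim : Tendsto (fun r : ℝ => V - r⁻¹ • (Complex.exp (ζ (s r)) - Complex.exp (ζ t))) (𝓝[>] 0)
      (𝓝 0) := by
    refine squeeze_zero_norm' ?_ (by simpa using him.mul_const ‖V‖)
    filter_upwards [Ioc_mem_nhdsGT one_pos, him.eventually (Iic_mem_nhds one_pos)] with r hr hr1
    have hr0 : (0 : ℝ) < r := hr.1
    have hrI : r ∈ Icc (0 : ℝ) 1 := ⟨hr0.le, hr.2⟩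
    have h1 := norm_geoLog_sub_sub_le ha (h.mem t ht) (h.mem _ (hs r hrI)) hr1
    rw [hW r hrI] at h1
    have e : V - r⁻¹ • (Complex.exp (ζ (s r)) - Complex.exp (ζ t)) =
        r⁻¹ • ((r : ℂ) * V - (Complex.exp (ζ (s r)) - Complex.exp (ζ t))) := by
      rw [smul_sub r⁻¹ ((r : ℂ) * V), ← Complex.real_smul, smul_smul, inv_mul_cancel₀ hr0.ne',
        one_smul]
    rw [e, norm_smul, norm_inv, Real.norm_of_nonneg hr0.le, inv_mul_le_iff₀ hr0]
    refine h1.trans_eq ?_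
    rw [norm_mul, Complex.norm_real, Real.norm_of_nonneg hr0.le]; ring
  have := tendsto_nhds_unique hlim (tendsto_const_nhds.sub hd')
  exact (sub_eq_zero.1 this.symm)

lemma norm_deriv (h : IsGeodesic a p q ζ ζ') {t : ℝ} (ht : t ∈ Icc (0 : ℝ) 1) :
    ‖Complex.exp (ζ t) * ζ' t‖ = ‖geoLog a p q‖ := by
  rw [norm_mul, Complex.norm_exp, mul_comm, h.speed t ht]

end IsGeodesic

lemma eq_of_geoLog_eq_zero {a : ℝ} (ha : 0 < a) {p q : ℂ} (hp : a ≤ Real.exp p.re)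
    (hq : a ≤ Real.exp q.re) (h : geoLog a p q = 0) : p = q := by
  obtain ⟨ζ, ζ', hg, -, -⟩ := exists_isGeodesic ha hp hq
  have h0 : ∀ t ∈ Icc (0 : ℝ) 1, ‖ζ' t‖ ≤ 0 := by
    intro t ht
    have := hg.speed t ht
    rw [h, norm_zero] at this
    rcases mul_eq_zero.1 this with h | h
    · exact h.le
    · exact absurd h (Real.exp_pos _).ne'
  have := norm_sub_le_of_hasDerivWithinAt hg.deriv (Λ := fun _ => 0) (l := fun _ => 0)
    (fun t _ => (hasDerivAt_const t (0 : ℝ)).hasDerivWithinAt) h0 le_rfl zero_le_one le_rfl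
  rw [hg.one, hg.zero, sub_self, norm_le_zero_iff, sub_eq_zero] at this
  exact this.symm

/-- Geodesics are unique. -/
theorem IsGeodesic.eqOn {a : ℝ} (ha : 0 < a) {p q : ℂ} {ζ ζ' ξ ξ' : ℝ → ℂ}
    (h1 : IsGeodesic a p q ζ ζ') (h2 : IsGeodesic a p q ξ ξ') : EqOn ζ ξ (Icc 0 1) := by
  intro t ht
  have m0 : (0 : ℝ) ∈ Icc (0 : ℝ) 1 := ⟨le_rfl, zero_le_one⟩
  have m1 : (1 : ℝ) ∈ Icc (0 : ℝ) 1 := ⟨zero_le_one, le_rfl⟩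
  refine eq_of_geoLog_eq_zero ha (h1.mem t ht) (h2.mem t ht) ?_
  set V := geoLog a (ζ t) (ξ t)
  set G := Complex.exp (ζ t) * ζ' t with hG
  have e0 := h1.geoLog_eq ha ht m0
  have e1 := h1.geoLog_eq ha ht m1
  have i0 := h2.norm_geoLog_sub_le ha (h1.mem t ht) m0 ht
  have i1 := h2.norm_geoLog_sub_le ha (h1.mem t ht) m1 ht
  rw [h1.zero] at e0
  rw [h1.one] at e1
  rw [h2.zero, e0, ← h1.norm_deriv ht, abs_of_nonneg (by linarith [ht.1])] at i0
  rw [h2.one, e1, ← h1.norm_deriv ht, abs_sub_comm, abs_of_nonneg (by linarith [ht.2])] at i1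
  have j0 := pow_le_pow_left₀ (norm_nonneg _) i0 2
  have j1 := pow_le_pow_left₀ (norm_nonneg _) i1 2
  rw [mul_pow, ← Complex.normSq_eq_norm_sq, ← Complex.normSq_eq_norm_sq, Complex.normSq_apply,
    Complex.normSq_apply] at j0 j1
  simp only [Complex.sub_re, Complex.sub_im, Complex.re_ofReal_mul, Complex.im_ofReal_mul] at j0 j1
  rw [← hG] at j0 j1
  -- The bounds read `‖V + tG‖ ≤ t‖G‖` and `‖V - (1 - t)G‖ ≤ (1 - t)‖G‖`. Squared and combined with
  -- weights `1 - t` and `t`, the inner products cancel.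
  have hV : Complex.normSq V ≤ 0 := by
    rw [Complex.normSq_apply]
    have k0 := mul_le_mul_of_nonneg_left j0 (sub_nonneg.2 ht.2)
    have k1 := mul_le_mul_of_nonneg_left j1 ht.1
    nlinarith
  exact Complex.normSq_eq_zero.1 (le_antisymm hV (Complex.normSq_nonneg _))

/-- The semi-parallelogram inequality. -/
theorem exists_midpoint {a : ℝ} (ha : 0 < a) {p q : ℂ} (hp : a ≤ Real.exp p.re)
    (hq : a ≤ Real.exp q.re) :
    ∃ y : ℂ, a ≤ Real.exp y.re ∧ y.re ≤ max p.re q.re ∧ y.im ∈ uIcc p.im q.im ∧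
      ∀ z : ℂ, a ≤ Real.exp z.re → 2 * ‖geoLog a z y‖ ^ 2 + ‖geoLog a p q‖ ^ 2 / 2 ≤
        ‖geoLog a z p‖ ^ 2 + ‖geoLog a z q‖ ^ 2 := by
  obtain ⟨ζ, ζ', h, -, hb⟩ := exists_isGeodesic ha hp hq
  have m0 : (0 : ℝ) ∈ Icc (0 : ℝ) 1 := ⟨le_rfl, zero_le_one⟩
  have m1 : (1 : ℝ) ∈ Icc (0 : ℝ) 1 := ⟨zero_le_one, le_rfl⟩
  have mh : (1 / 2 : ℝ) ∈ Icc (0 : ℝ) 1 := by constructor <;> norm_num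
  refine ⟨ζ (1 / 2), h.mem _ mh, (hb _ mh).1, (hb _ mh).2, fun z hz => ?_⟩
  have hy := h.mem _ mh
  have i0 := norm_geoLog_sub_geoLog_le_norm ha hy hp hz
  have i1 := norm_geoLog_sub_geoLog_le_norm ha hy hq hz
  -- Seen from the midpoint, `p` and `q` are opposite vectors, so the comparison inequalities add up
  -- by the parallelogram law.
  have e0 := h.geoLog_eq ha mh m0
  have e1 := h.geoLog_eq ha mh m1
  rw [h.zero] at e0
  rw [h.one] at e1
  rw [e0, norm_geoLog_comm ha hp hz] at i0
  rw [e1, norm_geoLog_comm ha hq hz] at i1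
  rw [← h.norm_deriv mh, norm_geoLog_comm ha hz hy]
  have j0 := pow_le_pow_left₀ (norm_nonneg _) i0 2
  have j1 := pow_le_pow_left₀ (norm_nonneg _) i1 2
  rw [← Complex.normSq_eq_norm_sq, Complex.normSq_apply] at j0 j1
  simp only [Complex.sub_re, Complex.sub_im, Complex.re_ofReal_mul, Complex.im_ofReal_mul] at j0 j1
  rw [← Complex.normSq_eq_norm_sq (geoLog a (ζ (1 / 2)) z), ← Complex.normSq_eq_norm_sq (_ * _),
    Complex.normSq_apply, Complex.normSq_apply]
  nlinarith

/-! ### The chart and its derivative, up to the boundary. -/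

/-- `τ` and `σ` are mutually inverse `C¹` diffeomorphisms between `M` and the annulus. -/
structure IsChart (L : ℝ) (M : Set ℂ) (τ σ : ℂ → ℂ) : Prop where
  contDiffOn : ContDiffOn ℝ 1 τ M
  mapsTo : MapsTo τ M (mappedRegion L)
  contDiffOn_symm : ContDiffOn ℝ 1 σ (mappedRegion L)
  mapsTo_symm : MapsTo σ (mappedRegion L) M
  left_inv : LeftInvOn σ τ M
  right_inv : RightInvOn σ τ (mappedRegion L)

lemma IsDiffeo.exists_isChart {L : ℝ} {M : Set ℂ} {τ : ℂ → ℂ} (h : IsDiffeo τ M (mappedRegion L)) :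
    ∃ σ, IsChart L M τ σ := by
  obtain ⟨h1, h2, σ, h3, h4, h5, h6⟩ := h
  exact ⟨σ, h1, h2, h3, h4, h5, h6⟩

/-- The points of the annulus in log-polar coordinates, with angle between `α` and `β`. -/
def box (L α β : ℝ) : Set ℂ := {ζ | (-(2 * Real.pi * L) ≤ ζ.re ∧ ζ.re ≤ 0) ∧ α ≤ ζ.im ∧ ζ.im ≤ β}

/-- The inner radius of the annulus. -/
noncomputable def innerRadius (L : ℝ) : ℝ := Real.exp (-(2 * Real.pi * L))

lemma innerRadius_pos (L : ℝ) : 0 < innerRadius L := Real.exp_pos _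

lemma innerRadius_le {L : ℝ} {ζ : ℂ} (h : -(2 * Real.pi * L) ≤ ζ.re) :
    innerRadius L ≤ Real.exp ζ.re := Real.exp_le_exp.2 h

lemma innerRadius_le_of_mem_box {L α β : ℝ} {ζ : ℂ} (h : ζ ∈ box L α β) :
    innerRadius L ≤ Real.exp ζ.re := innerRadius_le h.1.1

lemma exp_mem_mappedRegion_iff {L : ℝ} {ζ : ℂ} :
    Complex.exp ζ ∈ mappedRegion L ↔ -(2 * Real.pi * L) ≤ ζ.re ∧ ζ.re ≤ 0 := by
  rw [mappedRegion, mem_ofPred_eq, Complex.norm_exp, Real.exp_le_exp, Real.exp_le_one_iff]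

lemma image_exp_box (L α β : ℝ) : Complex.exp '' box L α β = sector L α β := by
  ext z
  constructor
  · rintro ⟨ζ, hζ, rfl⟩
    exact ⟨Real.exp ζ.re, ζ.im, Real.exp_le_exp.2 hζ.1.1, Real.exp_le_one_iff.2 hζ.1.2, hζ.2.1, hζ.2.2,
      exp_eq_ofReal_mul ζ⟩
  · rintro ⟨s, θ, h1, h2, h3, h4, rfl⟩
    have hs : 0 < s := (Real.exp_pos _).trans_le h1
    refine ⟨Real.log s + θ * I, ⟨⟨?_, ?_⟩, ?_, ?_⟩, ?_⟩
    · simpa using (Real.le_log_iff_exp_le hs).2 h1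
    · simpa using Real.log_nonpos hs.le h2
    · simpa using h3
    · simpa using h4
    · rw [Complex.exp_add, ← Complex.ofReal_exp, Real.exp_log hs]

lemma box_eq_reProdIm (L α β : ℝ) : box L α β = Icc (-(2 * Real.pi * L)) 0 ×ℂ Icc α β := by
  ext ζ; simp [box, Complex.mem_reProdIm]

lemma isCompact_box (L α β : ℝ) : IsCompact (box L α β) := by
  rw [box_eq_reProdIm]; exact isCompact_Icc.reProdIm isCompact_Icc

lemma sector_subset (L α β : ℝ) : sector L α β ⊆ mappedRegion L := by
  rw [← image_exp_box]
  rintro _ ⟨ζ, hζ, rfl⟩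
  exact exp_mem_mappedRegion_iff.2 hζ.1

lemma convex_strip (L : ℝ) : Convex ℝ {ζ : ℂ | -(2 * Real.pi * L) ≤ ζ.re ∧ ζ.re ≤ 0} :=
  (convex_Icc (-(2 * Real.pi * L)) 0).linear_preimage Complex.reLm

lemma uniqueDiffOn_strip {L : ℝ} (hL : 0 < L) :
    UniqueDiffOn ℝ {ζ : ℂ | -(2 * Real.pi * L) ≤ ζ.re ∧ ζ.re ≤ 0} := by
  refine uniqueDiffOn_convex (convex_strip L) ⟨((-(Real.pi * L) : ℝ) : ℂ), ?_⟩
  have hpos := mul_pos Real.pi_pos hL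
  have : IsOpen {ζ : ℂ | -(2 * Real.pi * L) < ζ.re ∧ ζ.re < 0} :=
    (isOpen_lt continuous_const Complex.continuous_re).inter
      (isOpen_lt Complex.continuous_re continuous_const)
  have hsub : {ζ : ℂ | -(2 * Real.pi * L) < ζ.re ∧ ζ.re < 0} ⊆
      {ζ : ℂ | -(2 * Real.pi * L) ≤ ζ.re ∧ ζ.re ≤ 0} := fun ζ h => ⟨h.1.le, h.2.le⟩
  refine interior_maximal hsub this ?_
  rw [mem_ofPred_eq, Complex.ofReal_re]
  constructor <;> linarith

/-- The real derivative of the exponential map. -/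
noncomputable def expDeriv (ζ : ℂ) : ℂ →L[ℝ] ℂ :=
  Complex.exp ζ • (ContinuousLinearMap.id ℝ ℂ)

lemma hasFDerivAt_exp (ζ : ℂ) : HasFDerivAt Complex.exp (expDeriv ζ) ζ := by
  have := (Complex.hasDerivAt_exp ζ).hasFDerivAt.restrictScalars ℝ
  refine this.congr_fderiv ?_
  ext x; all_goals simp [expDeriv, mul_comm]

@[simp] lemma expDeriv_apply (ζ v : ℂ) : expDeriv ζ v = Complex.exp ζ * v := by simp [expDeriv]

/-- The convex strip has unique derivatives, and the derivative of the exponential is onto. -/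
lemma uniqueDiffOn_mappedRegion {L : ℝ} (hL : 0 < L) : UniqueDiffOn ℝ (mappedRegion L) := by
  intro z hz
  have hz0 : z ≠ 0 := norm_pos_iff.1 ((Real.exp_pos _).trans_le hz.1)
  have he := Complex.exp_log hz0
  have hmem := hz
  rw [← he, exp_mem_mappedRegion_iff] at hmem
  have h1 := (hasFDerivAt_exp (Complex.log z)).hasFDerivWithinAt.uniqueDiffWithinAt
    (uniqueDiffOn_strip hL _ hmem) ?_
  · rw [he] at h1
    refine h1.mono ?_
    rintro _ ⟨ζ, hζ, rfl⟩
    exact exp_mem_mappedRegion_iff.2 hζ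
  · refine Function.Surjective.denseRange fun w => ⟨w / z, ?_⟩
    rw [expDeriv_apply, he, mul_div_cancel₀ _ hz0]

namespace IsChart

variable {L : ℝ} {M : Set ℂ} {τ σ : ℂ → ℂ}

lemma hasFDerivWithinAt (h : IsChart L M τ σ) {x : ℂ} (hx : x ∈ M) :
    HasFDerivWithinAt τ (fderivWithin ℝ τ M x) M x :=
  (h.contDiffOn.differentiableOn one_ne_zero x hx).hasFDerivWithinAt

lemma hasFDerivWithinAt_symm (h : IsChart L M τ σ) {z : ℂ} (hz : z ∈ mappedRegion L) :
    HasFDerivWithinAt σ (fderivWithin ℝ σ (mappedRegion L) z) (mappedRegion L) z :=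
  (h.contDiffOn_symm.differentiableOn one_ne_zero z hz).hasFDerivWithinAt

lemma fderivWithin_apply_symm (h : IsChart L M τ σ) (hL : 0 < L) {x : ℂ} (hx : x ∈ M) (v : ℂ) :
    fderivWithin ℝ τ M x (fderivWithin ℝ σ (mappedRegion L) (τ x) v) = v := by
  have h2 := h.hasFDerivWithinAt_symm (h.mapsTo hx)
  have h1 : HasFDerivWithinAt τ (fderivWithin ℝ τ M x) M (σ (τ x)) := by
    rw [h.left_inv hx]; exact h.hasFDerivWithinAt hx
  have h3 := h1.comp (τ x) h2 h.mapsTo_symm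
  have h4 : HasFDerivWithinAt (τ ∘ σ) (ContinuousLinearMap.id ℝ ℂ) (mappedRegion L) (τ x) :=
    (hasFDerivWithinAt_id _ _).congr (fun z hz => h.right_inv hz) (h.right_inv (h.mapsTo hx))
  have := (uniqueDiffOn_mappedRegion hL _ (h.mapsTo hx)).eq h3 h4
  exact DFunLike.congr_fun this v

/-- The chain rule on `M` would need uniqueness of derivatives there. Instead, a right inverse of an
endomorphism in finite dimension is a left inverse. -/
lemma fderivWithin_symm_apply (h : IsChart L M τ σ) (hL : 0 < L) {x : ℂ} (hx : x ∈ M) (v : ℂ) :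
    fderivWithin ℝ σ (mappedRegion L) (τ x) (fderivWithin ℝ τ M x v) = v := by
  have := (LinearMap.comp_eq_id_comm ℝ ℂ (f := (fderivWithin ℝ τ M x : ℂ →ₗ[ℝ] ℂ))
    (g := (fderivWithin ℝ σ (mappedRegion L) (τ x) : ℂ →ₗ[ℝ] ℂ))).1
    (LinearMap.ext fun v => h.fderivWithin_apply_symm hL hx v)
  exact DFunLike.congr_fun this v

lemma tangentNorm_eq (M : Set ℂ) (τ : ℂ → ℂ) (x v : ℂ) :
    tangentNorm M τ x v = ‖fderivWithin ℝ τ M x v‖ := by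
  rw [tangentNorm, metric, real_inner_self_eq_norm_sq, Real.sqrt_sq (norm_nonneg _)]

end IsChart

/-! ### Lifts of sectors, their length metric and the control input. -/

/-- The angular sector of the workspace between the angles `α` and `β`. -/
def cell (M : Set ℂ) (τ : ℂ → ℂ) (L α β : ℝ) : Set ℂ := {x | x ∈ M ∧ τ x ∈ sector L α β}

lemma subregion_eq_cell {N : ℕ} [NeZero N] (M : Set ℂ) (τ : ℂ → ℂ) (L : ℝ) (ψ : Fin N → ℝ) (i : Fin N) :
    subregion M τ L ψ i = cell M τ L (ψ i) (nextBar ψ i) := rfl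

/-- The log-polar coordinates of a point with an angle near that of the middle of `[α, β]`. -/
noncomputable def lift (α β : ℝ) (z : ℂ) : ℂ :=
  Complex.log (z * Complex.exp (-(((α + β) / 2 : ℝ) * I))) + ((α + β) / 2 : ℝ) * I

/-- Once the middle angle is turned to `0`, an opening below `2π` is exactly what keeps all angles
in `(-π, π)`. -/
lemma lift_exp {L α β : ℝ} (hαβ : β - α < 2 * Real.pi) {ζ : ℂ} (hζ : ζ ∈ box L α β) :
    lift α β (Complex.exp ζ) = ζ := by
  have h := hζ.2
  rw [lift, ← Complex.exp_add, Complex.log_exp]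
  · ring
  · simp; linarith
  · simp; linarith

lemma lift_mem_box {L α β : ℝ} (hαβ : β - α < 2 * Real.pi) {z : ℂ} (hz : z ∈ sector L α β) :
    lift α β z ∈ box L α β := by
  rw [← image_exp_box] at hz
  obtain ⟨ζ, hζ, rfl⟩ := hz
  rwa [lift_exp hαβ hζ]

lemma exp_lift {L α β : ℝ} (hαβ : β - α < 2 * Real.pi) {z : ℂ} (hz : z ∈ sector L α β) :
    Complex.exp (lift α β z) = z := by
  rw [← image_exp_box] at hz
  obtain ⟨ζ, hζ, rfl⟩ := hz
  rw [lift_exp hαβ hζ]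

lemma mul_exp_mem_slitPlane {L α β : ℝ} (hαβ : β - α < 2 * Real.pi) {z : ℂ} (hz : z ∈ sector L α β) :
    z * Complex.exp (-(((α + β) / 2 : ℝ) * I)) ∈ Complex.slitPlane := by
  rw [← image_exp_box] at hz
  obtain ⟨ζ, hζ, rfl⟩ := hz
  have h := hζ.2
  have e : (ζ + -(((α + β) / 2 : ℝ) * I)).im = ζ.im - (α + β) / 2 := by simp; ring
  rw [← Complex.exp_add, Complex.mem_slitPlane_iff_arg]
  refine ⟨?_, Complex.exp_ne_zero _⟩
  rw [Complex.arg_exp, e]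
  intro hcon
  rw [(toIocMod_eq_self Real.two_pi_pos).2 ⟨by linarith, by linarith⟩] at hcon
  linarith

lemma hasDerivWithinAt_lift {L α β : ℝ} (hαβ : β - α < 2 * Real.pi) {Γ : ℝ → ℂ} {Γ' : ℂ} {s : Set ℝ}
    {t : ℝ} (hz : Γ t ∈ sector L α β) (h : HasDerivWithinAt Γ Γ' s t) :
    HasDerivWithinAt (fun x => lift α β (Γ x)) (Γ' / Γ t) s t := by
  have := ((h.mul_const (Complex.exp (-(((α + β) / 2 : ℝ) * I)))).clog_real
    (mul_exp_mem_slitPlane hαβ hz)).add_const ((((α + β) / 2 : ℝ) : ℂ) * I)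
  exact this.congr_deriv (mul_div_mul_right _ _ (Complex.exp_ne_zero _))

lemma continuousOn_lift {L α β : ℝ} (hαβ : β - α < 2 * Real.pi) :
    ContinuousOn (lift α β) (sector L α β) := by
  intro z hz
  have h1 : ContinuousWithinAt (fun z => z * Complex.exp (-(((α + β) / 2 : ℝ) * I))) (sector L α β) z :=
    (continuous_id.mul continuous_const).continuousWithinAt
  exact (h1.clog (mul_exp_mem_slitPlane hαβ hz)).add continuousWithinAt_const

namespace IsChart

variable {L : ℝ} {M : Set ℂ} {τ σ : ℂ → ℂ}

lemma symm_exp_mem_cell (h : IsChart L M τ σ) {α β : ℝ} {ζ : ℂ} (hζ : ζ ∈ box L α β) :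
    σ (Complex.exp ζ) ∈ cell M τ L α β := by
  have h1 : Complex.exp ζ ∈ sector L α β := by rw [← image_exp_box]; exact mem_image_of_mem _ hζ
  have h2 := sector_subset L α β h1
  exact ⟨h.mapsTo_symm h2, by rw [h.right_inv h2]; exact h1⟩

lemma apply_symm_exp (h : IsChart L M τ σ) {α β : ℝ} {ζ : ℂ} (hζ : ζ ∈ box L α β) :
    τ (σ (Complex.exp ζ)) = Complex.exp ζ := h.right_inv (exp_mem_mappedRegion_iff.2 hζ.1)

lemma lift_apply_symm_exp (h : IsChart L M τ σ) {α β : ℝ} (hαβ : β - α < 2 * Real.pi) {ζ : ℂ}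
    (hζ : ζ ∈ box L α β) : lift α β (τ (σ (Complex.exp ζ))) = ζ := by
  rw [h.apply_symm_exp hζ, lift_exp hαβ hζ]

lemma symm_exp_lift (h : IsChart L M τ σ) {α β : ℝ} (hαβ : β - α < 2 * Real.pi) {x : ℂ}
    (hx : x ∈ cell M τ L α β) : σ (Complex.exp (lift α β (τ x))) = x := by
  rw [exp_lift hαβ hx.2, h.left_inv hx.1]

lemma hasDerivWithinAt_comp (h : IsChart L M τ σ) {γ : ℝ → ℂ} {s : Set ℝ} {t : ℝ} {v : ℂ}
    (hγ : HasDerivWithinAt γ v s t) (hm : MapsTo γ s M) (ht : t ∈ s) :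
    HasDerivWithinAt (fun x => τ (γ x)) (fderivWithin ℝ τ M (γ t) v) s t :=
  (h.hasFDerivWithinAt (hm ht)).comp_hasDerivWithinAt t hγ hm

lemma hasDerivWithinAt_isPath {E : Set ℂ} {x y : ℂ} {γ : ℝ → ℂ} (hγ : IsPath E x y γ) {t : ℝ}
    (ht : t ∈ Icc (0 : ℝ) 1) : HasDerivWithinAt γ (derivWithin γ (Icc 0 1) t) (Icc 0 1) t :=
  (hγ.1.differentiableOn one_ne_zero t ht).hasDerivWithinAt

/-- The velocity of the image in the annulus of a path in the workspace. -/
lemma hasDerivWithinAt_apply_isPath (h : IsChart L M τ σ) {α β : ℝ} {x y : ℂ} {γ : ℝ → ℂ}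
    (hγ : IsPath (cell M τ L α β) x y γ) {t : ℝ} (ht : t ∈ Icc (0 : ℝ) 1) :
    HasDerivWithinAt (fun x => τ (γ x)) (fderivWithin ℝ τ M (γ t) (derivWithin γ (Icc 0 1) t))
      (Icc 0 1) t :=
  h.hasDerivWithinAt_comp (hasDerivWithinAt_isPath hγ ht) (fun _ hs => (hγ.2.1 hs).1) ht

/-- The velocity is that of the `C¹` path `τ ∘ γ`, so continuity of `fderivWithin ℝ τ M` is not
needed. -/
lemma continuousOn_velocity (h : IsChart L M τ σ) {α β : ℝ} {x y : ℂ} {γ : ℝ → ℂ}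
    (hγ : IsPath (cell M τ L α β) x y γ) :
    ContinuousOn (fun t => fderivWithin ℝ τ M (γ t) (derivWithin γ (Icc 0 1) t)) (Icc 0 1) := by
  have hU : UniqueDiffOn ℝ (Icc (0 : ℝ) 1) := uniqueDiffOn_Icc zero_lt_one
  have hΓ : ContDiffOn ℝ 1 (fun x => τ (γ x)) (Icc 0 1) :=
    h.contDiffOn.comp hγ.1 fun _ hs => (hγ.2.1 hs).1
  refine (hΓ.continuousOn_derivWithin hU le_rfl).congr fun t ht => ?_
  exact ((h.hasDerivWithinAt_apply_isPath hγ ht).derivWithin (hU t ht)).symm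

/-- The lower bound for the length metric: the logarithm map based at the start of the path does not
lengthen it. -/
lemma ofReal_norm_geoLog_le_pathLength (h : IsChart L M τ σ) {α β : ℝ} (hαβ : β - α < 2 * Real.pi)
    {x y : ℂ} {γ : ℝ → ℂ} (hγ : IsPath (cell M τ L α β) x y γ) :
    ENNReal.ofReal ‖geoLog (innerRadius L) (lift α β (τ x)) (lift α β (τ y))‖ ≤ pathLength M τ γ := by
  set V : ℝ → ℂ := fun t => fderivWithin ℝ τ M (γ t) (derivWithin γ (Icc 0 1) t) with hV
  have hVc : ContinuousOn V (Icc 0 1) := h.continuousOn_velocity hγ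
  -- The speed is extended by constants, so that the arc length is differentiable at the end points
  -- as well.
  let v : ℝ → ℝ := IccExtend (zero_le_one' ℝ) ((Icc (0 : ℝ) 1).domRestrict fun t => ‖V t‖)
  have hv : Continuous v := (continuousOn_iff_continuous_domRestrict.1 hVc.norm).Icc_extend'
  have hvV : ∀ t ∈ Icc (0 : ℝ) 1, v t = ‖V t‖ := fun t ht => by
    simp only [v]; rw [IccExtend_of_mem _ _ ht]; rfl
  have hmem : ∀ t ∈ Icc (0 : ℝ) 1, lift α β (τ (γ t)) ∈ box L α β := fun t ht =>
    lift_mem_box hαβ (hγ.2.1 ht).2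
  have m0 : (0 : ℝ) ∈ Icc (0 : ℝ) 1 := ⟨le_rfl, zero_le_one⟩
  have hx := hmem 0 m0
  have key := norm_geoLog_sub_geoLog_le (innerRadius_pos L) (innerRadius_le_of_mem_box hx)
    (ζ := fun t => lift α β (τ (γ t))) (ζ' := fun t => V t / τ (γ t))
    (Λ := fun t => ∫ s in (0 : ℝ)..t, v s) (l := v)
    (fun t ht => hasDerivWithinAt_lift hαβ (hγ.2.1 ht).2 (h.hasDerivWithinAt_apply_isPath hγ ht))
    (fun t ht => innerRadius_le_of_mem_box (hmem t ht))
    (fun t _ => (intervalIntegral.integral_hasDerivAt_right (hv.intervalIntegrable _ _)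
      (hv.stronglyMeasurableAtFilter _ _) hv.continuousAt).hasDerivWithinAt)
    (fun t ht => ?_) le_rfl zero_le_one le_rfl
  · simp only [hγ.2.2.1, hγ.2.2.2, geoLog_self, sub_zero, intervalIntegral.integral_same] at key
    refine (ENNReal.ofReal_le_ofReal key).trans_eq ?_
    rw [pathLength, intervalIntegral.integral_of_le zero_le_one, ← integral_Icc_eq_integral_Ioc,
      ofReal_integral_eq_lintegral_ofReal hv.continuousOn.integrableOn_Icc]
    · refine setLIntegral_congr_fun measurableSet_Icc fun t ht => ?_
      simp only [hvV t ht, tangentNorm_eq, hV]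
    · refine (ae_restrict_iff' measurableSet_Icc).2 (Eventually.of_forall fun t ht => ?_)
      simp only [hvV t ht]; exact norm_nonneg _
  · have hne : τ (γ t) ≠ 0 := by
      rw [← exp_lift hαβ (hγ.2.1 ht).2]; exact Complex.exp_ne_zero _
    rw [← Complex.norm_exp, exp_lift hαβ (hγ.2.1 ht).2, norm_div,
      div_mul_cancel₀ _ (norm_ne_zero_iff.2 hne), hvV t ht]

/-- The path in the workspace that corresponds to a geodesic in log-polar coordinates. -/
lemma exists_path_of_mem (h : IsChart L M τ σ) {α β : ℝ} (hαβ : β - α < 2 * Real.pi)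
    {x y : ℂ} (hx : x ∈ cell M τ L α β) (hy : y ∈ cell M τ L α β) :
    ∃ γ : ℝ → ℂ, IsPath (cell M τ L α β) x y γ ∧ ∀ t ∈ Icc (0 : ℝ) 1,
      tangentNorm M τ (γ t) (derivWithin γ (Icc 0 1) t) =
        ‖geoLog (innerRadius L) (lift α β (τ x)) (lift α β (τ y))‖ := by
  have hx' := lift_mem_box hαβ hx.2
  have hy' := lift_mem_box hαβ hy.2
  obtain ⟨ζ, ζ', hg, hc, hb⟩ := exists_isGeodesic (innerRadius_pos L)
    (innerRadius_le_of_mem_box hx') (innerRadius_le_of_mem_box hy')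
  have hU : UniqueDiffOn ℝ (Icc (0 : ℝ) 1) := uniqueDiffOn_Icc zero_lt_one
  -- Geodesic convexity of the box: the inner side is the circle that geodesics avoid, and the other
  -- sides are the bounds that come with `exists_isGeodesic`.
  have hbox : ∀ t ∈ Icc (0 : ℝ) 1, ζ t ∈ box L α β := fun t ht =>
    ⟨⟨Real.exp_le_exp.1 (hg.mem t ht), (hb t ht).1.trans (max_le hx'.1.2 hy'.1.2)⟩,
      uIcc_subset_Icc hx'.2 hy'.2 (hb t ht).2⟩
  have hΓ : ∀ t ∈ Icc (0 : ℝ) 1, HasDerivWithinAt (fun t => Complex.exp (ζ t))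
      (Complex.exp (ζ t) * ζ' t) (Icc 0 1) t := fun t ht => (hg.deriv t ht).cexp
  have hζc : ContinuousOn ζ (Icc 0 1) := fun t ht => (hg.deriv t ht).continuousWithinAt
  have hΓc : ContDiffOn ℝ 1 (fun t => Complex.exp (ζ t)) (Icc 0 1) := by
    refine (contDiffOn_one_iff_derivWithin hU).2 ⟨fun t ht => (hΓ t ht).differentiableWithinAt, ?_⟩
    exact (hζc.cexp.mul hc).congr fun t ht => (hΓ t ht).derivWithin (hU t ht)
  have hmaps : MapsTo (fun t => Complex.exp (ζ t)) (Icc 0 1) (mappedRegion L) := fun t ht =>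
    exp_mem_mappedRegion_iff.2 (hbox t ht).1
  have hpath : IsPath (cell M τ L α β) x y (fun t => σ (Complex.exp (ζ t))) := by
    refine ⟨h.contDiffOn_symm.comp hΓc hmaps, fun t ht => h.symm_exp_mem_cell (hbox t ht), ?_, ?_⟩
    · simp only [hg.zero, h.symm_exp_lift hαβ hx]
    · simp only [hg.one, h.symm_exp_lift hαβ hy]
  refine ⟨_, hpath, fun t ht => ?_⟩
  have h1 := h.hasDerivWithinAt_apply_isPath hpath ht
  have h2 := (hΓ t ht).congr (fun s hs => h.apply_symm_exp (hbox s hs)) (h.apply_symm_exp (hbox t ht))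
  rw [tangentNorm_eq, (hU t ht).eq_deriv _ h1 h2, hg.norm_deriv ht]

/-- The length metric of a sector in log-polar coordinates. -/
theorem lengthDist_eq (h : IsChart L M τ σ) {α β : ℝ} (hαβ : β - α < 2 * Real.pi)
    {x y : ℂ} (hx : x ∈ cell M τ L α β) (hy : y ∈ cell M τ L α β) :
    lengthDist M τ (cell M τ L α β) x y =
      ENNReal.ofReal ‖geoLog (innerRadius L) (lift α β (τ x)) (lift α β (τ y))‖ := by
  refine le_antisymm ?_ (le_iInf₂ fun γ hγ => h.ofReal_norm_geoLog_le_pathLength hαβ hγ)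
  obtain ⟨γ, hγ, hs⟩ := h.exists_path_of_mem hαβ hx hy
  refine (iInf₂_le γ hγ).trans_eq ?_
  rw [pathLength, setLIntegral_congr_fun measurableSet_Icc (fun t ht => by rw [hs t ht])]
  simp

lemma exists_isShortestPath (h : IsChart L M τ σ) {α β : ℝ} (hαβ : β - α < 2 * Real.pi)
    {x y : ℂ} (hx : x ∈ cell M τ L α β) (hy : y ∈ cell M τ L α β) :
    ∃ γ, IsShortestPath M τ (cell M τ L α β) x y γ := by
  obtain ⟨γ, hγ, hs⟩ := h.exists_path_of_mem hαβ hx hy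
  exact ⟨γ, hγ, fun t ht => by rw [hs t ht, h.lengthDist_eq hαβ hx hy]⟩

lemma isGeodesic_of_isShortestPath (h : IsChart L M τ σ) {α β : ℝ}
    (hαβ : β - α < 2 * Real.pi) {x y : ℂ} (hx : x ∈ cell M τ L α β) (hy : y ∈ cell M τ L α β)
    {γ : ℝ → ℂ} (hγ : IsShortestPath M τ (cell M τ L α β) x y γ) :
    IsGeodesic (innerRadius L) (lift α β (τ x)) (lift α β (τ y)) (fun t => lift α β (τ (γ t)))
      (fun t => fderivWithin ℝ τ M (γ t) (derivWithin γ (Icc 0 1) t) / τ (γ t)) where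
  deriv t ht := hasDerivWithinAt_lift hαβ (hγ.1.2.1 ht).2 (h.hasDerivWithinAt_apply_isPath hγ.1 ht)
  mem t ht := innerRadius_le_of_mem_box (lift_mem_box hαβ (hγ.1.2.1 ht).2)
  zero := by rw [hγ.1.2.2.1]
  one := by rw [hγ.1.2.2.2]
  speed t ht := by
    have hne : τ (γ t) ≠ 0 := by
      rw [← exp_lift hαβ (hγ.1.2.1 ht).2]; exact Complex.exp_ne_zero _
    rw [← Complex.norm_exp, exp_lift hαβ (hγ.1.2.1 ht).2, norm_div,
      div_mul_cancel₀ _ (norm_ne_zero_iff.2 hne), ← tangentNorm_eq]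
    have := hγ.2 t ht
    rwa [h.lengthDist_eq hαβ hx hy, tangentNorm_eq,
      ENNReal.ofReal_eq_ofReal_iff (norm_nonneg _) (norm_nonneg _), ← tangentNorm_eq] at this

/-- Two shortest paths lift to geodesics with the same ends, and these coincide. -/
lemma cutLocus_eq_empty (h : IsChart L M τ σ) {α β : ℝ}
    (hαβ : β - α < 2 * Real.pi) {x : ℂ} (hx : x ∈ cell M τ L α β) :
    cutLocus M τ (cell M τ L α β) x = ∅ := by
  rw [cutLocus, closure_empty_iff, eq_empty_iff_forall_notMem]
  rintro y ⟨hy, γ₁, γ₂, h1, h2, hne⟩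
  refine hne fun t ht => ?_
  have := (h.isGeodesic_of_isShortestPath hαβ hx hy h1).eqOn (innerRadius_pos L)
    (h.isGeodesic_of_isShortestPath hαβ hx hy h2) ht
  rw [← h.symm_exp_lift hαβ (h1.1.2.1 ht), ← h.symm_exp_lift hαβ (h2.1.2.1 ht)]
  exact congrArg (fun z => σ (Complex.exp z)) this

/-- The path arrives at `x`, whereas the logarithm at `x` points back along it; hence the sign. -/
lemma fderivWithin_shortestTangent (h : IsChart L M τ σ) {α β : ℝ}
    (hαβ : β - α < 2 * Real.pi) {q x : ℂ} (hq : q ∈ cell M τ L α β) (hx : x ∈ cell M τ L α β) :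
    fderivWithin ℝ τ M x (shortestTangent M τ (cell M τ L α β) q x) =
      -geoLog (innerRadius L) (lift α β (τ x)) (lift α β (τ q)) := by
  have hex := h.exists_isShortestPath hαβ hq hx
  rw [shortestTangent, dif_pos hex]
  set γ := hex.choose
  have hγ : IsShortestPath M τ (cell M τ L α β) q x γ := hex.choose_spec
  have m0 : (0 : ℝ) ∈ Icc (0 : ℝ) 1 := ⟨le_rfl, zero_le_one⟩
  have m1 : (1 : ℝ) ∈ Icc (0 : ℝ) 1 := ⟨zero_le_one, le_rfl⟩
  have hg := h.isGeodesic_of_isShortestPath hαβ hq hx hγ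
  have e := hg.geoLog_eq (innerRadius_pos L) m1 m0
  have hne : τ x ≠ 0 := by
    rw [← exp_lift hαβ hx.2]; exact Complex.exp_ne_zero _
  simp only [hγ.1.2.2.1, hγ.1.2.2.2, exp_lift hαβ hx.2, mul_div_cancel₀ _ hne] at e
  rw [e]; simp

/-- The control input moves an agent of the annulus along the mean of the logarithm maps. -/
theorem fderivWithin_controlInput (h : IsChart L M τ σ) (hL : 0 < L) {α β : ℝ}
    (hαβ : β - α < 2 * Real.pi) (hE : MeasurableSet (cell M τ L α β)) (ρ : ℂ → ℝ) (k : ℝ) {x : ℂ}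
    (hx : x ∈ cell M τ L α β) :
    fderivWithin ℝ τ M x (controlInput M τ ρ k (cell M τ L α β) x) =
      (2 * k) • ∫ q in cell M τ L α β,
        ρ (τ q) • geoLog (innerRadius L) (lift α β (τ x)) (lift α β (τ q)) := by
  -- As an equivalence the derivative commutes with the integral without an integrability condition.
  let e : ℂ ≃L[ℝ] ℂ := ContinuousLinearEquiv.equivOfInverse (fderivWithin ℝ τ M x)
    (fderivWithin ℝ σ (mappedRegion L) (τ x)) (h.fderivWithin_symm_apply hL hx.1)
    (h.fderivWithin_apply_symm hL hx.1)
  have he : ∀ v, fderivWithin ℝ τ M x v = e v := fun v => rfl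
  rw [controlInput, h.cutLocus_eq_empty hαβ hx, union_empty, he, map_smul,
    ← e.integral_comp_comm, neg_smul, ← smul_neg, ← integral_neg]
  congr 1
  rw [← setIntegral_congr_set (s := cell M τ L α β \ {x}) (t := cell M τ L α β)
    (sdiff_null_ae_eq_self (measure_singleton x))]
  refine setIntegral_congr_fun (hE.diff (measurableSet_singleton x)) fun q hq => ?_
  -- Away from `x` the distance is nonzero, so its quotient by the norm of the tangent is `1` and
  -- not the default value of a division by zero.
  have hne : lift α β (τ x) ≠ lift α β (τ q) := by
    intro hcon
    apply hq.2
    rw [mem_singleton_iff, ← h.symm_exp_lift hαβ hx, ← h.symm_exp_lift hαβ hq.1, hcon]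
  have hx' := innerRadius_le_of_mem_box (lift_mem_box hαβ hx.2)
  have hq' := innerRadius_le_of_mem_box (lift_mem_box hαβ hq.1.2)
  have hpos : ‖geoLog (innerRadius L) (lift α β (τ x)) (lift α β (τ q))‖ ≠ 0 := fun hcon =>
    hne (eq_of_geoLog_eq_zero (innerRadius_pos L) hx' hq' (norm_eq_zero.1 hcon))
  simp only [map_smul, ← he]
  rw [tangentNorm_eq, h.fderivWithin_shortestTangent hαβ hq.1 hx, norm_neg,
    h.lengthDist_eq hαβ hq.1 hx, ENNReal.toReal_ofReal (norm_nonneg _),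
    norm_geoLog_comm (innerRadius_pos L) hq' hx', div_self hpos, one_mul, smul_neg, neg_neg]

end IsChart

/-! ### Integration in log-polar coordinates. -/

/-- The nearest point of the strip of the log-polar coordinates of the annulus. -/
noncomputable def clampRe (L : ℝ) (ζ : ℂ) : ℂ :=
  (max (-(2 * Real.pi * L)) (min ζ.re 0) : ℝ) + ζ.im * I

lemma continuous_clampRe (L : ℝ) : Continuous (clampRe L) := by unfold clampRe; fun_prop

lemma clampRe_mem {L : ℝ} (hL : 0 < L) (ζ : ℂ) :
    -(2 * Real.pi * L) ≤ (clampRe L ζ).re ∧ (clampRe L ζ).re ≤ 0 := by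
  have := mul_pos Real.pi_pos hL
  have e : (clampRe L ζ).re = max (-(2 * Real.pi * L)) (min ζ.re 0) := by simp [clampRe]
  rw [e]
  exact ⟨le_max_left _ _, max_le (by linarith) (min_le_right _ _)⟩

lemma clampRe_of_mem {L : ℝ} {ζ : ℂ} (h1 : -(2 * Real.pi * L) ≤ ζ.re) (h2 : ζ.re ≤ 0) :
    clampRe L ζ = ζ := by
  rw [clampRe, min_eq_left h2, max_eq_right h1, Complex.re_add_im]

/-- The density of the workload in log-polar coordinates, extended to the plane. -/
noncomputable def weight (L : ℝ) (σ : ℂ → ℂ) (ρ : ℂ → ℝ) (ζ : ℂ) : ℝ :=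
  |((fderivWithin ℝ σ (mappedRegion L) (Complex.exp (clampRe L ζ))).comp
    (expDeriv (clampRe L ζ))).det| * ρ (Complex.exp (clampRe L ζ))

lemma weight_add_two_pi (L : ℝ) (σ : ℂ → ℂ) (ρ : ℂ → ℝ) (ζ : ℂ) :
    weight L σ ρ (ζ + (2 * Real.pi : ℝ) * I) = weight L σ ρ ζ := by
  have h1 : clampRe L (ζ + (2 * Real.pi : ℝ) * I) = clampRe L ζ + 2 * Real.pi * I := by
    simp [clampRe]; ring
  have h2 : Complex.exp (clampRe L ζ + 2 * Real.pi * I) = Complex.exp (clampRe L ζ) :=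
    Complex.exp_periodic _
  rw [weight, weight, h1, expDeriv, expDeriv, h2]

namespace IsChart

variable {L : ℝ} {M : Set ℂ} {τ σ : ℂ → ℂ} {ρ : ℂ → ℝ}

lemma continuous_weight (h : IsChart L M τ σ) (hL : 0 < L) (hρ : ContinuousOn ρ (mappedRegion L)) :
    Continuous (weight L σ ρ) := by
  have h1 : Continuous fun ζ => Complex.exp (clampRe L ζ) :=
    Complex.continuous_exp.comp (continuous_clampRe L)
  have h2 : ∀ ζ, Complex.exp (clampRe L ζ) ∈ mappedRegion L := fun ζ =>
    exp_mem_mappedRegion_iff.2 (clampRe_mem hL ζ)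
  have h3 : Continuous fun ζ => fderivWithin ℝ σ (mappedRegion L) (Complex.exp (clampRe L ζ)) :=
    (h.contDiffOn_symm.continuousOn_fderivWithin (uniqueDiffOn_mappedRegion hL) le_rfl).comp_continuous
      h1 h2
  have h4 : Continuous fun ζ => expDeriv (clampRe L ζ) := h1.smul continuous_const
  exact (ContinuousLinearMap.continuous_det.comp (h3.clm_comp h4)).abs.mul
    (hρ.comp_continuous h1 h2)

/-- A vanishing determinant would give a nonzero vector killed by the derivative of `σ`, which has a
left inverse. -/
lemma weight_pos (h : IsChart L M τ σ) (hL : 0 < L) (hρ : ∀ q ∈ mappedRegion L, 0 < ρ q) (ζ : ℂ) :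
    0 < weight L σ ρ ζ := by
  have hz : Complex.exp (clampRe L ζ) ∈ mappedRegion L :=
    exp_mem_mappedRegion_iff.2 (clampRe_mem hL ζ)
  refine mul_pos (abs_pos.2 fun hdet => ?_) (hρ _ hz)
  have hker := LinearMap.bot_lt_ker_of_det_eq_zero hdet
  obtain ⟨v, hv, hv0⟩ := (Submodule.ne_bot_iff _).1 hker.ne'
  rw [LinearMap.mem_ker] at hv
  have hv : fderivWithin ℝ σ (mappedRegion L) (Complex.exp (clampRe L ζ))
    (Complex.exp (clampRe L ζ) * v) = 0 := by simpa using hv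
  have h1 := h.fderivWithin_apply_symm hL (h.mapsTo_symm hz) (Complex.exp (clampRe L ζ) * v)
  rw [h.right_inv hz, hv, map_zero] at h1
  rcases mul_eq_zero.1 h1.symm with h2 | h2
  · exact Complex.exp_ne_zero _ h2
  · exact hv0 h2

lemma cell_eq_image (h : IsChart L M τ σ) (α β : ℝ) :
    cell M τ L α β = (fun ζ => σ (Complex.exp ζ)) '' box L α β := by
  ext x
  constructor
  · rintro ⟨hx, hs⟩
    rw [← image_exp_box] at hs
    obtain ⟨ζ, hζ, e⟩ := hs
    exact ⟨ζ, hζ, by simp only [e]; exact h.left_inv hx⟩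
  · rintro ⟨ζ, hζ, rfl⟩
    exact h.symm_exp_mem_cell hζ

lemma isCompact_cell (h : IsChart L M τ σ) (α β : ℝ) : IsCompact (cell M τ L α β) := by
  rw [h.cell_eq_image]
  refine (isCompact_box L α β).image_of_continuousOn ?_
  exact h.contDiffOn_symm.continuousOn.comp Complex.continuous_exp.continuousOn fun ζ hζ =>
    exp_mem_mappedRegion_iff.2 hζ.1

lemma measurableSet_cell (h : IsChart L M τ σ) (α β : ℝ) : MeasurableSet (cell M τ L α β) :=
  (h.isCompact_cell α β).measurableSet

/-- Integrals over a sector of the workspace in log-polar coordinates. -/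
theorem setIntegral_cell (h : IsChart L M τ σ) {α β : ℝ} (hαβ : β - α < 2 * Real.pi)
    {E : Type*} [NormedAddCommGroup E] [NormedSpace ℝ E] (f : ℂ → E) :
    ∫ q in cell M τ L α β, ρ (τ q) • f (lift α β (τ q)) =
      ∫ ζ in box L α β, weight L σ ρ ζ • f ζ := by
  have hmeas : MeasurableSet (box L α β) := (isCompact_box L α β).measurableSet
  have hd : ∀ ζ ∈ box L α β, HasFDerivWithinAt (fun ζ => σ (Complex.exp ζ))
      ((fderivWithin ℝ σ (mappedRegion L) (Complex.exp ζ)).comp (expDeriv ζ)) (box L α β) ζ := by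
    intro ζ hζ
    exact (h.hasFDerivWithinAt_symm (exp_mem_mappedRegion_iff.2 hζ.1)).comp ζ
      (hasFDerivAt_exp ζ).hasFDerivWithinAt fun ξ hξ => exp_mem_mappedRegion_iff.2 hξ.1
  have hinj : InjOn (fun ζ => σ (Complex.exp ζ)) (box L α β) := by
    intro ζ hζ ξ hξ e
    rw [← h.lift_apply_symm_exp hαβ hζ, ← h.lift_apply_symm_exp hαβ hξ]
    exact congrArg (fun x => lift α β (τ x)) e
  rw [h.cell_eq_image, integral_image_eq_integral_abs_det_fderiv_smul volume hmeas hd hinj]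
  refine setIntegral_congr_fun hmeas fun ζ hζ => ?_
  rw [h.lift_apply_symm_exp hαβ hζ, h.apply_symm_exp hζ, smul_smul, weight,
    clampRe_of_mem hζ.1.1 hζ.1.2]

lemma workload_cell (h : IsChart L M τ σ) {α β : ℝ} (hαβ : β - α < 2 * Real.pi) :
    workload τ ρ (cell M τ L α β) = ∫ ζ in box L α β, weight L σ ρ ζ := by
  have := h.setIntegral_cell (ρ := ρ) hαβ (fun _ => (1 : ℝ))
  simpa [workload] using this

lemma cost_cell (h : IsChart L M τ σ) {α β : ℝ} (hαβ : β - α < 2 * Real.pi) {x : ℂ}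
    (hx : x ∈ cell M τ L α β) : cost M τ ρ (cell M τ L α β) x =
      ∫ ζ in box L α β, weight L σ ρ ζ * ‖geoLog (innerRadius L) ζ (lift α β (τ x))‖ ^ 2 := by
  have := h.setIntegral_cell (ρ := ρ) hαβ
    (fun ζ => ‖geoLog (innerRadius L) ζ (lift α β (τ x))‖ ^ 2)
  simp only [smul_eq_mul] at this
  rw [← this, cost]
  refine setIntegral_congr_fun (h.measurableSet_cell α β) fun q hq => ?_
  rw [h.lengthDist_eq hαβ hq hx, ENNReal.toReal_ofReal (norm_nonneg _), mul_comm]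

lemma eq_cell (h : IsChart L M τ σ) : M = cell M τ L 0 (2 * Real.pi) := by
  refine Subset.antisymm (fun x hx => ⟨hx, ?_⟩) fun x hx => hx.1
  have hz := h.mapsTo hx
  have h0 : τ x ≠ 0 := norm_pos_iff.1 ((Real.exp_pos _).trans_le hz.1)
  refine ⟨‖τ x‖, toIcoMod Real.two_pi_pos 0 (τ x).arg, hz.1, hz.2, ?_, ?_, ?_⟩
  · exact (toIcoMod_mem_Ico Real.two_pi_pos 0 _).1
  · simpa using (toIcoMod_mem_Ico Real.two_pi_pos 0 (τ x).arg).2.le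
  · conv_lhs => rw [← Complex.norm_mul_exp_arg_mul_I (τ x)]
    congr 1
    rw [Complex.exp_eq_exp_iff_exists_int]
    refine ⟨toIcoDiv Real.two_pi_pos 0 (τ x).arg, ?_⟩
    have := toIcoMod_add_toIcoDiv_zsmul Real.two_pi_pos 0 (τ x).arg
    conv_lhs => rw [← this]
    push_cast
    simp; ring

lemma isCompact (h : IsChart L M τ σ) : IsCompact M := by
  rw [h.eq_cell]; exact h.isCompact_cell _ _

/-- A bound for every pair of angles, also for openings of `2π` or more, which cannot be excluded
before the order of the bars is known. -/
lemma workload_cell_le (h : IsChart L M τ σ) (hρ : ContinuousOn ρ (mappedRegion L))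
    (hρpos : ∀ q ∈ mappedRegion L, 0 < ρ q) (α β : ℝ) :
    workload τ ρ (cell M τ L α β) ≤ workload τ ρ M := by
  have hi : IntegrableOn (fun q => ρ (τ q)) M :=
    (hρ.comp h.contDiffOn.continuousOn h.mapsTo).integrableOn_compact h.isCompact
  refine setIntegral_mono_set hi ?_ (Eventually.of_forall fun x hx => hx.1)
  exact (ae_restrict_iff' h.isCompact.measurableSet).2
    (Eventually.of_forall fun q hq => (hρpos _ (h.mapsTo hq)).le)

end IsChart

/-- The integral over a box in log-polar coordinates as an iterated integral. -/
lemma setIntegral_box {L : ℝ} (hL : 0 < L) {α β : ℝ} (hαβ : α ≤ β) {E : Type*} [NormedAddCommGroup E]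
    [NormedSpace ℝ E] {f : ℂ → E} (hf : Continuous f) :
    ∫ ζ in box L α β, f ζ = ∫ θ in α..β, ∫ u in (-(2 * Real.pi * L))..0, f (u + θ * I) := by
  have hl : -(2 * Real.pi * L) ≤ 0 := by linarith [mul_pos Real.pi_pos hL]
  let e := Complex.measurableEquivRealProd
  have h1 := Complex.volume_preserving_equiv_real_prod.setIntegral_preimage_emb
    e.measurableEmbedding (fun x : ℝ × ℝ => f (x.1 + x.2 * I)) (Icc (-(2 * Real.pi * L)) 0 ×ˢ Icc α β)
  have h2 : (e : ℂ → ℝ × ℝ) ⁻¹' (Icc (-(2 * Real.pi * L)) 0 ×ˢ Icc α β) = box L α β := by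
    ext ζ; rfl
  have h3 : ∀ ζ : ℂ, f (((e ζ).1 : ℝ) + ((e ζ).2 : ℝ) * I) = f ζ := fun ζ => by
    rw [show ((((e ζ).1 : ℝ) : ℂ) + ((e ζ).2 : ℝ) * I) = ζ from Complex.re_add_im ζ]
  rw [h2] at h1
  simp only [h3, e] at h1
  rw [h1]
  have hg : Continuous fun x : ℝ × ℝ => f (x.1 + x.2 * I) := by fun_prop
  have hi : IntegrableOn (fun x : ℝ × ℝ => f (x.1 + x.2 * I))
      (Icc (-(2 * Real.pi * L)) 0 ×ˢ Icc α β) (volume.prod volume) :=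
    hg.continuousOn.integrableOn_compact (isCompact_Icc.prod isCompact_Icc)
  rw [IntegrableOn, ← Measure.prod_restrict] at hi
  rw [Measure.volume_eq_prod, ← Measure.prod_restrict, integral_prod_symm _ hi,
    intervalIntegral.integral_of_le hαβ, ← integral_Icc_eq_integral_Ioc]
  refine setIntegral_congr_fun measurableSet_Icc fun θ _ => ?_
  simp only
  rw [intervalIntegral.integral_of_le hl, ← integral_Icc_eq_integral_Ioc]

/-- The iterated integral over a box depends continuously on the box and on parameters. -/
lemma continuous_iterated_integral {X E : Type*} [TopologicalSpace X] [NormedAddCommGroup E]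
    [NormedSpace ℝ E] {f : X → ℂ → E} (hf : Continuous (Function.uncurry f)) (l : ℝ) :
    Continuous fun y : X × ℝ × ℝ => ∫ θ in y.2.1..y.2.2, ∫ u in l..0, f y.1 (u + θ * I) := by
  have h1 : Continuous fun z : X × ℝ => ∫ u in l..0, f z.1 (u + z.2 * I) := by
    refine intervalIntegral.continuous_parametric_intervalIntegral_of_continuous'
      (f := fun (z : X × ℝ) (u : ℝ) => f z.1 (u + z.2 * I)) ?_ l 0
    exact hf.comp (f := fun w : (X × ℝ) × ℝ => (w.1.1, (w.2 : ℂ) + w.1.2 * I)) (by fun_prop)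
  have h2 : ∀ s : X × ℝ × ℝ → ℝ, Continuous s →
      Continuous fun y : X × ℝ × ℝ => ∫ θ in (0 : ℝ)..s y, ∫ u in l..0, f y.1 (u + θ * I) := by
    intro s hs
    refine intervalIntegral.continuous_parametric_intervalIntegral_of_continuous
      (f := fun (y : X × ℝ × ℝ) (θ : ℝ) => ∫ u in l..0, f y.1 (u + θ * I)) ?_ hs
    exact h1.comp (f := fun w : (X × ℝ × ℝ) × ℝ => (w.1.1, w.2)) (by fun_prop)
  refine ((h2 _ (by fun_prop : Continuous fun y : X × ℝ × ℝ => y.2.2)).sub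
    (h2 _ (by fun_prop : Continuous fun y : X × ℝ × ℝ => y.2.1))).congr fun y => ?_
  have hc : Continuous fun θ : ℝ => ∫ u in l..0, f y.1 (u + θ * I) :=
    h1.comp (f := fun θ : ℝ => (y.1, θ)) (by fun_prop)
  exact intervalIntegral.integral_interval_sub_left (hc.intervalIntegrable _ _)
    (hc.intervalIntegrable _ _)

/-! ### Gaps between bars and a positivity criterion. -/

section Bars

variable {N : ℕ} [NeZero N]

lemma sum_shift (c : ℝ) : ∑ i : Fin N, (if i + 1 = 0 then c else 0) = c := by
  refine (Equiv.sum_comp (Equiv.addRight (1 : Fin N)) (fun j => if j = 0 then c else 0)).trans ?_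
  simp

lemma sum_comp_add_one {A : Type*} [AddCommMonoid A] (f : Fin N → A) :
    ∑ i, f (i + 1) = ∑ i, f i := Equiv.sum_comp (Equiv.addRight (1 : Fin N)) f

lemma sum_gap (φ : Fin N → ℝ) : ∑ i, (nextBar φ i - φ i) = 2 * Real.pi := by
  simp only [nextBar, Finset.sum_sub_distrib, Finset.sum_add_distrib, sum_shift, sum_comp_add_one]
  ring

/-- The gaps add up to a full turn, and a second gap takes a positive share of it. -/
lemma gap_lt (hN : 2 ≤ N) {φ : Fin N → ℝ} (h : ∀ i, φ i < nextBar φ i) (i : Fin N) :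
    nextBar φ i - φ i < 2 * Real.pi := by
  have : Nontrivial (Fin N) := Fin.nontrivial_iff_two_le.2 hN
  obtain ⟨j, hj⟩ := exists_ne i
  rw [← sum_gap φ, ← Finset.add_sum_erase _ _ (Finset.mem_univ i)]
  have : 0 < ∑ j ∈ Finset.univ.erase i, (nextBar φ j - φ j) :=
    Finset.sum_pos (fun j _ => sub_pos.2 (h j)) ⟨j, Finset.mem_erase.2 ⟨hj, Finset.mem_univ _⟩⟩
  linarith

lemma abs_sub_le_of_gap {φ : Fin N → ℝ} (h : ∀ i, φ i < nextBar φ i)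
    (h' : ∀ i, nextBar φ i - φ i < 2 * Real.pi) (i j : Fin N) :
    |φ i - φ j| ≤ 4 * Real.pi * N := by
  have hgap_le : ∀ i, |φ (i + 1) - φ i| ≤ 2 * Real.pi := by
    intro i
    have h1 := h i
    have h2 := h' i
    rw [nextBar] at h1 h2
    rw [abs_le]
    split_ifs at h1 h2 <;> constructor <;> linarith [Real.pi_pos]
  have key : ∀ n : ℕ, ∀ i : Fin N, i.val = n → |φ i - φ 0| ≤ 2 * Real.pi * n := by
    intro n
    induction n with
    | zero =>
      intro i hi
      have : i = 0 := Fin.ext (by simpa using hi)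
      simp [this]
    | succ n ih =>
      intro i hi
      have hn : n + 1 < N := hi ▸ i.isLt
      let j : Fin N := ⟨n, by omega⟩
      have hj : i = j + 1 := by
        apply Fin.ext
        rw [Fin.val_add, hi, Fin.val_one', Nat.add_mod_mod, Nat.mod_eq_of_lt hn]
      have := hgap_le j
      have h2 := ih j rfl
      rw [hj]
      push_cast
      calc |φ (j + 1) - φ 0| ≤ |φ (j + 1) - φ j| + |φ j - φ 0| := abs_sub_le _ _ _
        _ ≤ 2 * Real.pi * (n + 1) := by linarith
  have bound : ∀ i : Fin N, |φ i - φ 0| ≤ 2 * Real.pi * N := fun i =>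
    (key i.val i rfl).trans (mul_le_mul_of_nonneg_left (by exact_mod_cast i.isLt.le) (by positivity))
  have h1 := bound i
  have h2 := bound j
  rw [abs_le] at *
  constructor <;> linarith [h1.1, h1.2, h2.1, h2.2]

/-- A quantity that decreases at most at a rate proportional to itself stays positive. -/
lemma pos_of_deriv_ge {u u' : ℝ → ℝ} {K : ℝ} (h0 : 0 < u 0)
    (hu : ∀ t, 0 ≤ t → HasDerivWithinAt u (u' t) (Ici 0) t)
    (hb : ∀ t, 0 ≤ t → -(K * max (u t) 0) ≤ u' t) {t : ℝ} (ht : 0 ≤ t) : 0 < u t := by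
  have hB : ∀ s, HasDerivAt (fun s => -(u 0 * Real.exp (-(K + 1) * s)))
      ((K + 1) * (u 0 * Real.exp (-(K + 1) * s))) s := by
    intro s
    have := ((((hasDerivAt_id s).const_mul (-(K + 1))).exp).const_mul (u 0)).neg
    refine this.congr_deriv ?_
    simp only [id]; ring
  -- Comparison with `u 0 * exp (-(K + 1) t)`: the rate `K + 1` instead of `K` makes the inequality
  -- strict at a contact.
  have := image_le_of_deriv_right_lt_deriv_boundary' (f := fun s => -u s) (f' := fun s => -u' s)
    (a := 0) (b := t) (B := fun s => -(u 0 * Real.exp (-(K + 1) * s)))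
    (B' := fun s => (K + 1) * (u 0 * Real.exp (-(K + 1) * s)))
    (fun s hs => ((hu s hs.1).continuousWithinAt.mono fun x hx => hx.1).neg)
    (fun s hs => ((hu s hs.1).mono (Ici_subset_Ici.2 hs.1)).neg) (by simp)
    (fun s _ => (hB s).continuousAt.continuousWithinAt)
    (fun s _ => (hB s).hasDerivWithinAt)
    (fun s hs he => ?_) ⟨ht, le_rfl⟩
  · have := mul_pos h0 (Real.exp_pos (-(K + 1) * t))
    linarith
  · have e : u s = u 0 * Real.exp (-(K + 1) * s) := neg_injective he
    have hpos : 0 < u s := by rw [e]; exact mul_pos h0 (Real.exp_pos _)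
    have := hb s hs.1
    rw [max_eq_left hpos.le] at this
    rw [← e]; linarith

lemma monotoneOn_of_deriv_nonneg_Ici {W W' : ℝ → ℝ}
    (hW : ∀ t, 0 ≤ t → HasDerivWithinAt W (W' t) (Ici 0) t) (h0 : ∀ t, 0 ≤ t → 0 ≤ W' t) :
    MonotoneOn W (Ici 0) := by
  refine monotoneOn_of_hasDerivWithinAt_nonneg (f' := W') (convex_Ici 0)
    (fun t ht => (hW t ht).continuousWithinAt) (fun t ht => ?_) fun t ht => ?_
  · exact (hW t (interior_subset ht)).mono interior_subset
  · exact h0 t (interior_subset ht)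

end Bars

/-! ### Angular primitive, energy of a bar, and absence of collisions. -/

section Bars

variable {N : ℕ} [NeZero N] {g : ℝ → ℝ}

/-- The primitive of the angular density. -/
noncomputable def cumul (g : ℝ → ℝ) (x : ℝ) : ℝ := ∫ θ in (0 : ℝ)..x, g θ

lemma hasDerivAt_cumul (hg : Continuous g) (x : ℝ) : HasDerivAt (cumul g) (g x) x :=
  intervalIntegral.integral_hasDerivAt_right (hg.intervalIntegrable _ _)
    (hg.stronglyMeasurableAtFilter _ _) hg.continuousAt

lemma continuous_cumul (hg : Continuous g) : Continuous (cumul g) :=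
  continuous_iff_continuousAt.2 fun x => (hasDerivAt_cumul hg x).continuousAt

lemma cumul_sub (hg : Continuous g) (α β : ℝ) : cumul g β - cumul g α = ∫ θ in α..β, g θ :=
  intervalIntegral.integral_interval_sub_left (hg.intervalIntegrable _ _) (hg.intervalIntegrable _ _)

lemma cumul_add (hg : Continuous g) (hgp : ∀ θ, g (θ + 2 * Real.pi) = g θ) (x : ℝ) :
    cumul g (x + 2 * Real.pi) = cumul g x + cumul g (2 * Real.pi) := by
  have h := (show Function.Periodic g (2 * Real.pi) from hgp).intervalIntegral_add_eq x 0
  rw [zero_add] at h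
  have := cumul_sub hg x (x + 2 * Real.pi)
  rw [h] at this
  rw [cumul, cumul, cumul] at *
  linarith

lemma strictMono_cumul (hg : Continuous g) (hg0 : ∀ θ, 0 < g θ) : StrictMono (cumul g) :=
  strictMono_of_deriv_pos fun x => by rw [(hasDerivAt_cumul hg x).deriv]; exact hg0 x

/-- In the coordinate `cumul g` the extra turn of the last bar is a constant, which drops out of
derivatives and differences. -/
lemma cumul_nextBar (hg : Continuous g) (hgp : ∀ θ, g (θ + 2 * Real.pi) = g θ) (φ : Fin N → ℝ)
    (i : Fin N) : cumul g (nextBar φ i) =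
      cumul g (φ (i + 1)) + if i + 1 = 0 then cumul g (2 * Real.pi) else 0 := by
  rw [nextBar]
  split_ifs
  · exact cumul_add hg hgp _
  · rw [add_zero, add_zero]

lemma exists_le_of_periodic (hg : Continuous g) (hg0 : ∀ θ, 0 < g θ)
    (hgp : ∀ θ, g (θ + 2 * Real.pi) = g θ) : ∃ c C, 0 < c ∧ ∀ θ, c ≤ g θ ∧ g θ ≤ C := by
  have hc := (show Function.Periodic g (2 * Real.pi) from hgp).compact_of_continuous
    Real.two_pi_pos.ne' hg
  obtain ⟨c, ⟨θ, rfl⟩, hcl⟩ := hc.exists_isLeast (range_nonempty g)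
  obtain ⟨C, -, hC⟩ := hc.exists_isGreatest (range_nonempty g)
  exact ⟨g θ, C, hg0 θ, fun x => ⟨hcl (mem_range_self x), hC (mem_range_self x)⟩⟩

/-- The energy of one bar relative to its limit position. -/
noncomputable def barEnergy (g : ℝ → ℝ) (c x : ℝ) : ℝ := ∫ s in c..x, (cumul g s - cumul g c)

lemma hasDerivAt_barEnergy (hg : Continuous g) (c x : ℝ) :
    HasDerivAt (barEnergy g c) (cumul g x - cumul g c) x := by
  have hc : Continuous fun s => cumul g s - cumul g c := (continuous_cumul hg).sub continuous_const
  exact intervalIntegral.integral_hasDerivAt_right (hc.intervalIntegrable _ _)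
    (hc.stronglyMeasurableAtFilter _ _) hc.continuousAt

/-- The energy has second derivative at least `b` and is critical at `c`; it therefore controls the
distance to `c`. -/
lemma sq_le_barEnergy (hg : Continuous g) {b : ℝ} (hb : ∀ θ, b ≤ g θ) (c x : ℝ) :
    b / 2 * (x - c) ^ 2 ≤ barEnergy g c x := by
  have hmono : Monotone fun s => cumul g s - b * s := by
    refine monotone_of_hasDerivAt_nonneg (f' := fun s => g s - b) (fun s => ?_)
      fun s => sub_nonneg.2 (hb s)
    exact ((hasDerivAt_cumul hg s).sub ((hasDerivAt_id s).const_mul b)).congr_deriv (by rw [mul_one])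
  have hd : ∀ y, HasDerivAt (fun y => barEnergy g c y - b / 2 * (y - c) ^ 2)
      ((cumul g y - cumul g c) - b * (y - c)) y := by
    intro y
    have := ((((hasDerivAt_id y).sub_const c).pow 2).const_mul (b / 2))
    refine ((hasDerivAt_barEnergy hg c y).sub this).congr_deriv ?_
    simp; ring
  have h0 : barEnergy g c c - b / 2 * (c - c) ^ 2 = 0 := by simp [barEnergy]
  suffices h : 0 ≤ barEnergy g c x - b / 2 * (x - c) ^ 2 by linarith
  rw [← h0]
  have hcont : Continuous fun y => barEnergy g c y - b / 2 * (y - c) ^ 2 :=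
    continuous_iff_continuousAt.2 fun y => (hd y).continuousAt
  rcases le_total c x with hx | hx
  · refine monotoneOn_of_hasDerivWithinAt_nonneg (convex_Ici c) hcont.continuousOn
      (fun y _ => (hd y).hasDerivWithinAt) (fun y hy => ?_) self_mem_Ici hx hx
    have := hmono ((interior_subset hy : y ∈ Ici c) : c ≤ y)
    simp only at this; linarith
  · refine antitoneOn_of_hasDerivWithinAt_nonpos (convex_Iic c) hcont.continuousOn
      (fun y _ => (hd y).hasDerivWithinAt) (fun y hy => ?_) hx self_mem_Iic hx
    have := hmono ((interior_subset hy : y ∈ Iic c) : y ≤ c)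
    simp only at this; linarith

variable {m : ℝ → ℝ → ℝ} {T₀ k : ℝ} {held : Set (Fin N)} {ψ : ℝ → Fin N → ℝ}

open Classical in
/-- The law of motion of the bars for the workload `m α β` of the sector between `α` and `β`. -/
noncomputable def barLaw (m : ℝ → ℝ → ℝ) (k : ℝ) (held : Set (Fin N)) (φ : Fin N → ℝ) (i : Fin N) : ℝ :=
  if i ∈ held then 0
  else k * (m (φ i) (nextBar φ i) - m (φ (i - 1)) (nextBar φ (i - 1)))

lemma hasDerivWithinAt_nextBar {v : ℝ → Fin N → ℝ} {t : ℝ} {S : Set ℝ}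
    (hψ : ∀ i, HasDerivWithinAt (fun s => ψ s i) (v t i) S t) (i : Fin N) :
    HasDerivWithinAt (fun s => nextBar (ψ s) i) (v t (i + 1)) S t :=
  (hψ (i + 1)).add_const _

/-- The bars never meet. -/
theorem lt_nextBar_of_barLaw (hg : Continuous g) (hg0 : ∀ θ, 0 < g θ)
    (hgp : ∀ θ, g (θ + 2 * Real.pi) = g θ)
    (hm : ∀ α β, α ≤ β → β - α < 2 * Real.pi → m α β = ∫ θ in α..β, g θ)
    (hm0 : ∀ α β, 0 ≤ m α β) (hm1 : ∀ α β, β < α → m α β = 0) (hmT : ∀ α β, m α β ≤ T₀)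
    (hk : 0 < k) (h0 : ∀ i, ψ 0 i < nextBar (ψ 0) i)
    (hψ : ∀ t, 0 ≤ t → ∀ i, HasDerivWithinAt (fun s => ψ s i) (barLaw m k held (ψ t) i) (Ici 0) t)
    {t : ℝ} (ht : 0 ≤ t) (i : Fin N) : ψ t i < nextBar (ψ t) i := by
  obtain ⟨c, C, hc, hcC⟩ := exists_le_of_periodic hg hg0 hgp
  have hT₀ : 0 ≤ T₀ := (hm0 0 0).trans (hmT 0 0)
  have hC : 0 ≤ C := hc.le.trans ((hcC 0).1.trans (hcC 0).2)
  -- Valid without any order: zero for a negative gap, the maximal density below a full turn, and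
  -- the total workload beyond it.
  have hbound : ∀ α β, m α β ≤ (C + T₀ / (2 * Real.pi)) * max (β - α) 0 := by
    intro α β
    rcases lt_or_ge β α with h | h
    · rw [hm1 _ _ h, max_eq_right (by linarith), mul_zero]
    rw [max_eq_left (sub_nonneg.2 h)]
    have h1 : 0 ≤ T₀ / (2 * Real.pi) := by positivity
    rcases lt_or_ge (β - α) (2 * Real.pi) with h' | h'
    · rw [hm _ _ h h']
      have := intervalIntegral.integral_mono_on h (hg.intervalIntegrable _ _)
        ((continuous_const (y := C)).intervalIntegrable (μ := volume) α β) fun θ _ => (hcC θ).2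
      rw [intervalIntegral.integral_const, smul_eq_mul] at this
      nlinarith [sub_nonneg.2 h]
    · refine (hmT α β).trans ?_
      have : T₀ = T₀ / (2 * Real.pi) * (2 * Real.pi) := by field_simp
      have h2 := mul_le_mul_of_nonneg_left h' h1
      nlinarith [mul_nonneg hC (sub_nonneg.2 h)]
  have hpos := pos_of_deriv_ge (u := fun s => nextBar (ψ s) i - ψ s i)
    (u' := fun s => barLaw m k held (ψ s) (i + 1) - barLaw m k held (ψ s) i)
    (K := 2 * k * (C + T₀ / (2 * Real.pi))) (sub_pos.2 (h0 i))
    (fun s hs => (hasDerivWithinAt_nextBar (v := fun s => barLaw m k held (ψ s)) (hψ s hs) i).sub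
      (hψ s hs i)) (fun s hs => ?_) ht
  · exact sub_pos.1 hpos
  · have hb := mul_le_mul_of_nonneg_left (hbound (ψ s i) (nextBar (ψ s) i)) hk.le
    -- Only the workload of the sector itself can close its gap: each of its two bars moves inwards
    -- at speed at most `k` times that workload.
    have h1 : -(k * m (ψ s i) (nextBar (ψ s) i)) ≤ barLaw m k held (ψ s) (i + 1) := by
      rw [barLaw, add_sub_cancel_right]
      have := mul_nonneg hk.le (hm0 (ψ s i) (nextBar (ψ s) i))
      have := mul_nonneg hk.le (hm0 (ψ s (i + 1)) (nextBar (ψ s) (i + 1)))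
      split_ifs <;> linarith
    have h2 : barLaw m k held (ψ s) i ≤ k * m (ψ s i) (nextBar (ψ s) i) := by
      rw [barLaw]
      have := mul_nonneg hk.le (hm0 (ψ s i) (nextBar (ψ s) i))
      have := mul_nonneg hk.le (hm0 (ψ s (i - 1)) (nextBar (ψ s) (i - 1)))
      split_ifs <;> linarith
    linarith

end Bars

/-! ### Convergence of the bars. -/

section Bars

variable {N : ℕ} [NeZero N] {g : ℝ → ℝ} {m : ℝ → ℝ → ℝ} {k : ℝ} {held : Set (Fin N)}
  {ψ : ℝ → Fin N → ℝ}

/-- The workload of the sector that starts at the bar `i`, as a difference of the primitive. -/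
noncomputable def load (g : ℝ → ℝ) (φ : Fin N → ℝ) (i : Fin N) : ℝ :=
  cumul g (nextBar φ i) - cumul g (φ i)

open Classical in
/-- The law of motion of the bars while they keep their order. -/
noncomputable def loadLaw (g : ℝ → ℝ) (k : ℝ) (held : Set (Fin N)) (φ : Fin N → ℝ) (i : Fin N) : ℝ :=
  if i ∈ held then 0 else k * (load g φ i - load g φ (i - 1))

lemma continuous_load (hg : Continuous g) (i : Fin N) : Continuous fun φ => load g φ i := by
  unfold load nextBar
  have := continuous_cumul hg
  fun_prop

/-- Summation by parts on a cycle, where no boundary term appears. It drives both the entropy and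
the energy estimates. -/
lemma sum_mul_load_sub (x : Fin N → ℝ) (y : Fin N → ℝ) :
    ∑ i, x i * (y i - y (i - 1)) = ∑ i, (x i - x (i + 1)) * y i := by
  have : ∑ i, x i * y (i - 1) = ∑ i, x (i + 1) * y i := by
    rw [← sum_comp_add_one fun i => x i * y (i - 1)]
    simp only [add_sub_cancel_right]
  simp only [mul_sub, sub_mul, Finset.sum_sub_distrib, this]

lemma hasDerivWithinAt_load (hg : Continuous g) (hgp : ∀ θ, g (θ + 2 * Real.pi) = g θ) {v : Fin N → ℝ}
    {t : ℝ} {S : Set ℝ} (hψ : ∀ i, HasDerivWithinAt (fun s => ψ s i) (v i) S t) (i : Fin N) :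
    HasDerivWithinAt (fun s => load g (ψ s) i)
      (g (ψ t (i + 1)) * v (i + 1) - g (ψ t i) * v i) S t := by
  have h1 : ∀ i, HasDerivWithinAt (fun s => cumul g (ψ s i)) (g (ψ t i) * v i) S t := fun i =>
    (hasDerivAt_cumul hg _).comp_hasDerivWithinAt t (hψ i)
  have h2 : HasDerivWithinAt (fun s => cumul g (nextBar (ψ s) i)) (g (ψ t (i + 1)) * v (i + 1)) S t := by
    simp only [cumul_nextBar hg hgp]
    exact (h1 (i + 1)).add_const _
  exact h2.sub (h1 i)

lemma load_pos (hg : Continuous g) (hg0 : ∀ θ, 0 < g θ) {φ : Fin N → ℝ} {i : Fin N}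
    (h : φ i < nextBar φ i) : 0 < load g φ i := sub_pos.2 (strictMono_cumul hg hg0 h)

lemma load_le (hg : Continuous g) (hg0 : ∀ θ, 0 < g θ) (hgp : ∀ θ, g (θ + 2 * Real.pi) = g θ)
    {φ : Fin N → ℝ} {i : Fin N} (h : nextBar φ i - φ i < 2 * Real.pi) :
    load g φ i ≤ cumul g (2 * Real.pi) := by
  have := (strictMono_cumul hg hg0).monotone (show nextBar φ i ≤ φ i + 2 * Real.pi by linarith)
  rw [cumul_add hg hgp] at this
  rw [load]; linarith

/-- The sum of the logarithms of the workloads increases. -/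
lemma exists_entropy (hg : Continuous g) (hg0 : ∀ θ, 0 < g θ) (hgp : ∀ θ, g (θ + 2 * Real.pi) = g θ)
    (hk : 0 < k) (h1 : ∀ t, 0 ≤ t → ∀ i, ψ t i < nextBar (ψ t) i)
    (h2 : ∀ t, 0 ≤ t → ∀ i, nextBar (ψ t) i - ψ t i < 2 * Real.pi)
    (hψ : ∀ t, 0 ≤ t → ∀ i, HasDerivWithinAt (fun s => ψ s i) (loadLaw g k held (ψ t) i) (Ici 0) t) :
    ∃ κ > 0, ∃ W' : ℝ → ℝ,
      (∀ t, 0 ≤ t → HasDerivWithinAt (fun s => ∑ i, Real.log (load g (ψ s) i)) (W' t) (Ici 0) t) ∧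
      ∀ t, 0 ≤ t → κ * ∑ i, loadLaw g k held (ψ t) i ^ 2 ≤ W' t := by
  obtain ⟨c, C, hc, hcC⟩ := exists_le_of_periodic hg hg0 hgp
  set T := cumul g (2 * Real.pi) with hT
  have hTpos : 0 < T := by
    have := strictMono_cumul hg hg0 Real.two_pi_pos
    have e : cumul g 0 = 0 := by simp [cumul]
    rwa [e] at this
  refine ⟨c / (k * T ^ 2), by positivity, fun t => ∑ i, (g (ψ t (i + 1)) * loadLaw g k held (ψ t) (i + 1) -
    g (ψ t i) * loadLaw g k held (ψ t) i) / load g (ψ t) i, fun t ht => ?_, fun t ht => ?_⟩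
  · exact HasDerivWithinAt.fun_sum fun i _ =>
      (hasDerivWithinAt_load hg hgp (hψ t ht) i).log (load_pos hg hg0 (h1 t ht i)).ne'
  · have hl0 : ∀ i, 0 < load g (ψ t) i := fun i => load_pos hg hg0 (h1 t ht i)
    have hlT : ∀ i, load g (ψ t) i ≤ T := fun i => load_le hg hg0 hgp (h2 t ht i)
    have e := sum_mul_load_sub (fun i => g (ψ t i) * loadLaw g k held (ψ t) i)
      (fun i => -(load g (ψ t) i)⁻¹)
    have e2 : ∑ i, (g (ψ t (i + 1)) * loadLaw g k held (ψ t) (i + 1) -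
        g (ψ t i) * loadLaw g k held (ψ t) i) / load g (ψ t) i =
        ∑ i, g (ψ t i) * loadLaw g k held (ψ t) i *
          (-(load g (ψ t) i)⁻¹ - -(load g (ψ t) (i - 1))⁻¹) := by
      rw [e]
      refine Finset.sum_congr rfl fun i _ => ?_
      rw [div_eq_mul_inv]; ring
    refine le_trans ?_ e2.ge
    rw [Finset.mul_sum]
    refine Finset.sum_le_sum fun i _ => ?_
    have p1 := hl0 i
    have p2 := hl0 (i - 1)
    rw [loadLaw]
    split_ifs with hi
    · simp
    -- As `x ↦ -1/x` increases, each term is a nonnegative multiple of a squared difference of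
    -- workloads. The constant `c / (k T²)` uses `c ≤ g` and workloads at most `T`.
    · have e3 : g (ψ t i) * (k * (load g (ψ t) i - load g (ψ t) (i - 1))) *
          (-(load g (ψ t) i)⁻¹ - -(load g (ψ t) (i - 1))⁻¹) =
          k * (load g (ψ t) i - load g (ψ t) (i - 1)) ^ 2 *
            (g (ψ t i) / (load g (ψ t) i * load g (ψ t) (i - 1))) := by
        field_simp; ring
      have e4 : c / (k * T ^ 2) * (k * (load g (ψ t) i - load g (ψ t) (i - 1))) ^ 2 =
          k * (load g (ψ t) i - load g (ψ t) (i - 1)) ^ 2 * (c / T ^ 2) := by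
        field_simp
      rw [e3, e4]
      refine mul_le_mul_of_nonneg_left ?_ (by positivity)
      refine div_le_div₀ (hg0 _).le (hcC _).1 (by positivity) ?_
      rw [sq]
      exact mul_le_mul (hlT _) (hlT _) p2.le hTpos.le

/-- The bars come arbitrarily close to an equilibrium, with workloads bounded from below. -/
lemma exists_equilibrium_clusterPt (hg : Continuous g) (hg0 : ∀ θ, 0 < g θ)
    (hgp : ∀ θ, g (θ + 2 * Real.pi) = g θ)
    (hk : 0 < k) (h1 : ∀ t, 0 ≤ t → ∀ i, ψ t i < nextBar (ψ t) i)
    (h2 : ∀ t, 0 ≤ t → ∀ i, nextBar (ψ t) i - ψ t i < 2 * Real.pi)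
    (hψ : ∀ t, 0 ≤ t → ∀ i, HasDerivWithinAt (fun s => ψ s i) (loadLaw g k held (ψ t) i) (Ici 0) t) :
    ∃ φ : Fin N → ℝ, ∃ t : ℕ → ℝ, Tendsto t atTop atTop ∧ Tendsto (fun n => ψ (t n)) atTop (𝓝 φ) ∧
      (∀ i, φ i < nextBar φ i) ∧ ∀ i, loadLaw g k held φ i = 0 := by
  obtain ⟨κ, hκ, W', hW, hW'⟩ := exists_entropy hg hg0 hgp hk h1 h2 hψ
  set T := cumul g (2 * Real.pi) with hT
  have hl0 : ∀ t, 0 ≤ t → ∀ i, 0 < load g (ψ t) i := fun t ht i => load_pos hg hg0 (h1 t ht i)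
  have hlT : ∀ t, 0 ≤ t → ∀ i, load g (ψ t) i ≤ T := fun t ht i => load_le hg hg0 hgp (h2 t ht i)
  have hlog : ∀ t, 0 ≤ t → ∀ i, Real.log (load g (ψ t) i) ≤ Real.log T := fun t ht i =>
    Real.log_le_log (hl0 t ht i) (hlT t ht i)
  have hS0 : ∀ t, 0 ≤ κ * ∑ i, loadLaw g k held (ψ t) i ^ 2 := fun t =>
    mul_nonneg hκ.le (Finset.sum_nonneg fun i _ => sq_nonneg _)
  have hmono := monotoneOn_of_deriv_nonneg_Ici hW fun t ht => (hS0 t).trans (hW' t ht)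
  -- the workloads are bounded from below
  obtain ⟨δ, hδ, hδl⟩ : ∃ δ > 0, ∀ t, 0 ≤ t → ∀ i, δ ≤ load g (ψ t) i := by
    -- The other `N - 1` logarithms are at most `log T`; what remains of the initial sum bounds the
    -- last one from below.
    refine ⟨Real.exp (∑ i, Real.log (load g (ψ 0) i) - (N - 1) * Real.log T), Real.exp_pos _,
      fun t ht i => ?_⟩
    rw [← Real.le_log_iff_exp_le (hl0 t ht i)]
    have h3 : ∑ i, Real.log (load g (ψ 0) i) ≤ ∑ i, Real.log (load g (ψ t) i) :=
      hmono self_mem_Ici ht ht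
    have h5 := Finset.add_sum_erase _ (fun j => Real.log (load g (ψ t) j)) (Finset.mem_univ i)
    have h4 := Finset.sum_le_card_nsmul (Finset.univ.erase i) (fun j => Real.log (load g (ψ t) j))
      (Real.log T) fun j _ => hlog t ht j
    have hN : 1 ≤ N := NeZero.one_le
    rw [Finset.card_erase_of_mem (Finset.mem_univ i), Finset.card_univ, Fintype.card_fin,
      nsmul_eq_mul, Nat.cast_sub hN, Nat.cast_one] at h4
    linarith
  -- the velocities come arbitrarily close to zero
  have hsmall : ∀ n : ℕ, ∃ t : ℝ, (n : ℝ) ≤ t ∧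
      ∑ i, loadLaw g k held (ψ t) i ^ 2 < 1 / ((n : ℝ) + 1) := by
    intro n
    by_contra! hcon
    have hn : (0 : ℝ) ≤ n := n.cast_nonneg
    set ε := κ * (1 / ((n : ℝ) + 1)) with hε
    have hε0 : 0 < ε := by positivity
    -- With velocities bounded away from zero the sum of logarithms would grow linearly, beyond its
    -- bound `N log T`.
    have hgrow : ∀ t, (n : ℝ) ≤ t → ∑ i, Real.log (load g (ψ n) i) + ε * (t - n) ≤
        ∑ i, Real.log (load g (ψ t) i) := by
      intro t ht
      have hd : MonotoneOn (fun s => ∑ i, Real.log (load g (ψ s) i) - ε * (s - n)) (Ici (n : ℝ)) := by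
        refine monotoneOn_of_hasDerivWithinAt_nonneg (f' := fun s => W' s - ε * 1) (convex_Ici _) ?_ ?_ ?_
        · intro s hs
          exact (((hW s (hn.trans hs)).continuousWithinAt).mono (Ici_subset_Ici.2 hn)).sub
            (by fun_prop)
        · intro s hs
          have hs' : (n : ℝ) ≤ s := interior_subset hs
          refine ((hW s (hn.trans hs')).mono ?_).sub
            ((((hasDerivAt_id s).sub_const _).const_mul ε).hasDerivWithinAt)
          exact interior_subset.trans (Ici_subset_Ici.2 hn)
        · intro s hs
          have hs' : (n : ℝ) ≤ s := interior_subset hs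
          have := hW' s (hn.trans hs')
          have := mul_le_mul_of_nonneg_left (hcon s hs') hκ.le
          simp only [mul_one]; linarith
      have := hd self_mem_Ici ht ht
      simp only [sub_self, mul_zero, sub_zero] at this
      linarith
    have hub : ∀ t, (n : ℝ) ≤ t → ∑ i, Real.log (load g (ψ t) i) ≤ N * Real.log T := by
      intro t ht
      have := Finset.sum_le_card_nsmul Finset.univ (fun j => Real.log (load g (ψ t) j))
        (Real.log T) fun j _ => hlog t (hn.trans ht) j
      simpa using this
    set A := N * Real.log T - ∑ i, Real.log (load g (ψ n) i) with hA
    have hA0 : 0 ≤ A := sub_nonneg.2 (hub n le_rfl)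
    have ht : (n : ℝ) ≤ n + (A + 1) / ε := by
      have : 0 ≤ (A + 1) / ε := by positivity
      linarith
    have h3 := (hgrow _ ht).trans (hub _ ht)
    rw [add_sub_cancel_left, mul_div_cancel₀ _ hε0.ne'] at h3
    linarith
  choose s hs hs' using hsmall
  have hs0 : ∀ n, 0 ≤ s n := fun n => (Nat.cast_nonneg n).trans (hs n)
  -- the bars stay in a bounded region
  obtain ⟨R, hR⟩ : ∃ R, ∀ t, 0 ≤ t → ∀ i, |ψ t i| ≤ R := by
    have hconst : ∀ (u u' : ℝ → ℝ), (∀ t, 0 ≤ t → HasDerivWithinAt u (u' t) (Ici 0) t) →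
        (∀ t, 0 ≤ t → u' t = 0) → ∀ t, 0 ≤ t → u t = u 0 := by
      intro u u' hu hu' t ht
      refine le_antisymm ?_ (monotoneOn_of_deriv_nonneg_Ici hu (fun t ht => (hu' t ht).ge) self_mem_Ici ht ht)
      have := monotoneOn_of_deriv_nonneg_Ici (fun t ht => (hu t ht).neg)
        (fun t ht => by rw [hu' t ht, neg_zero]) self_mem_Ici ht ht
      simpa using this
    -- Differences of angles are bounded; only a common drift must be excluded. Without held bars
    -- the sum of the angles is conserved, and otherwise a held bar is an anchor.
    rcases held.eq_empty_or_nonempty with he | ⟨j, hj⟩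
    · have hsum : ∀ t, 0 ≤ t → ∑ i, ψ t i = ∑ i, ψ 0 i := by
        refine hconst _ (fun t => ∑ i, loadLaw g k held (ψ t) i)
          (fun t ht => HasDerivWithinAt.fun_sum fun i _ => hψ t ht i) fun t _ => ?_
        have := sum_mul_load_sub (fun _ : Fin N => k) (fun i => load g (ψ t) i)
        simp only [sub_self, zero_mul, Finset.sum_const_zero] at this
        rw [← this]
        refine Finset.sum_congr rfl fun i _ => ?_
        rw [loadLaw, if_neg (by rw [he]; exact notMem_empty i)]
      refine ⟨|∑ i, ψ 0 i| / N + 4 * Real.pi * N, fun t ht i => ?_⟩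
      have hN : (0 : ℝ) < N := by exact_mod_cast NeZero.pos N
      have e : ψ t i = (∑ j, ψ 0 j) / N + (∑ j, (ψ t i - ψ t j)) / N := by
        rw [Finset.sum_sub_distrib, hsum t ht]
        simp; field_simp; ring
      rw [e]
      refine (abs_add_le _ _).trans (add_le_add ?_ ?_)
      · rw [abs_div, abs_of_pos hN]
      · rw [abs_div, abs_of_pos hN, div_le_iff₀ hN]
        refine (Finset.abs_sum_le_sum_abs _ _).trans ?_
        refine (Finset.sum_le_card_nsmul _ _ _ fun j _ =>
          abs_sub_le_of_gap (h1 t ht) (h2 t ht) i j).trans_eq ?_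
        simp; ring
    · refine ⟨|ψ 0 j| + 4 * Real.pi * N, fun t ht i => ?_⟩
      have e : ψ t j = ψ 0 j := by
        refine hconst (fun t => ψ t j) _ (fun t ht => hψ t ht j) (fun t _ => ?_) t ht
        rw [loadLaw, if_pos hj]
      have h3 := abs_sub_le_of_gap (h1 t ht) (h2 t ht) i j
      have h4 := abs_add_le (ψ t i - ψ t j) (ψ t j)
      rw [sub_add_cancel] at h4
      rw [← e]; linarith
  have hcomp : IsCompact (Set.pi univ fun _ : Fin N => Icc (-R) R) :=
    isCompact_univ_pi fun _ => isCompact_Icc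
  obtain ⟨φ, -, r, hr, hφ⟩ := hcomp.tendsto_subseq (x := fun n => ψ (s n))
    fun n i _ => abs_le.1 (hR (s n) (hs0 n) i)
  have hload : ∀ i, Tendsto (fun n => load g (ψ (s (r n))) i) atTop (𝓝 (load g φ i)) := fun i =>
    ((continuous_load hg i).tendsto φ).comp hφ
  refine ⟨φ, fun n => s (r n), ?_, hφ, fun i => ?_, fun i => ?_⟩
  · refine tendsto_atTop_mono (fun n => hs (r n)) ?_
    exact tendsto_natCast_atTop_atTop.comp hr.tendsto_atTop
  · have : δ ≤ load g φ i := ge_of_tendsto' (hload i) fun n => hδl _ (hs0 _) i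
    rw [load] at this
    exact (strictMono_cumul hg hg0).lt_iff_lt.1 (by linarith)
  · have hlim : Tendsto (fun n => loadLaw g k held (ψ (s (r n))) i) atTop (𝓝 (loadLaw g k held φ i)) := by
      unfold loadLaw
      split_ifs
      · exact tendsto_const_nhds
      · exact ((hload i).sub (hload (i - 1))).const_mul k
    have hz : Tendsto (fun n => loadLaw g k held (ψ (s (r n))) i ^ 2) atTop (𝓝 0) := by
      refine squeeze_zero (fun n => sq_nonneg _) (fun n => ?_)
        (tendsto_one_div_add_atTop_nhds_zero_nat.comp hr.tendsto_atTop)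
      exact (Finset.single_le_sum (f := fun i => loadLaw g k held (ψ (s (r n))) i ^ 2)
        (fun i _ => sq_nonneg _) (Finset.mem_univ i)).trans (hs' (r n)).le
    have := tendsto_nhds_unique (hlim.pow 2) hz
    exact pow_eq_zero_iff two_ne_zero |>.1 this

/-- The bars converge to an equilibrium. -/
theorem tendsto_equilibrium (hg : Continuous g) (hg0 : ∀ θ, 0 < g θ)
    (hgp : ∀ θ, g (θ + 2 * Real.pi) = g θ)
    (hk : 0 < k) (h1 : ∀ t, 0 ≤ t → ∀ i, ψ t i < nextBar (ψ t) i)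
    (h2 : ∀ t, 0 ≤ t → ∀ i, nextBar (ψ t) i - ψ t i < 2 * Real.pi)
    (hψ : ∀ t, 0 ≤ t → ∀ i, HasDerivWithinAt (fun s => ψ s i) (loadLaw g k held (ψ t) i) (Ici 0) t) :
    ∃ φ : Fin N → ℝ, (∀ i, Tendsto (fun t => ψ t i) atTop (𝓝 (φ i))) ∧
      (∀ i, φ i < nextBar φ i) ∧ ∀ i ∉ held, load g φ i = load g φ (i - 1) := by
  obtain ⟨φ, s, hs, hφ, hgap, heq⟩ := exists_equilibrium_clusterPt hg hg0 hgp hk h1 h2 hψ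
  obtain ⟨c, C, hc, hcC⟩ := exists_le_of_periodic hg hg0 hgp
  have hφi : ∀ i, Tendsto (fun n => ψ (s n) i) atTop (𝓝 (φ i)) := fun i =>
    ((continuous_apply i).tendsto φ).comp hφ
  have hload : ∀ i ∉ held, load g φ i = load g φ (i - 1) := by
    intro i hi
    have := heq i
    rw [loadLaw, if_neg hi] at this
    exact sub_eq_zero.1 ((mul_eq_zero.1 this).resolve_left hk.ne')
  -- A held bar is already at its limit, so its term in the energy vanishes, whatever the workloads
  -- beside it.
  have hheld : ∀ i ∈ held, ∀ t, 0 ≤ t → ψ t i = φ i := by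
    intro i hi
    have hv : ∀ t, loadLaw g k held (ψ t) i = 0 := fun t => by rw [loadLaw, if_pos hi]
    have hc : ∀ t, 0 ≤ t → ψ t i = ψ 0 i := by
      intro t ht
      refine le_antisymm ?_ (monotoneOn_of_deriv_nonneg_Ici (fun t ht => hψ t ht i)
        (fun t _ => (hv t).ge) self_mem_Ici ht ht)
      have := monotoneOn_of_deriv_nonneg_Ici (fun t ht => (hψ t ht i).neg)
        (fun t _ => by rw [hv t, neg_zero]) self_mem_Ici ht ht
      simpa using this
    have hlim : Tendsto (fun n => ψ (s n) i) atTop (𝓝 (ψ 0 i)) :=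
      tendsto_const_nhds.congr' ((hs.eventually_ge_atTop 0).mono fun n hn => (hc _ hn).symm)
    intro t ht
    rw [hc t ht]
    exact tendsto_nhds_unique hlim (hφi i)
  let U : ℝ → ℝ := fun t => ∑ i, barEnergy g (φ i) (ψ t i)
  have hU : ∀ t, 0 ≤ t → HasDerivWithinAt U
      (∑ i, (cumul g (ψ t i) - cumul g (φ i)) * loadLaw g k held (ψ t) i) (Ici 0) t := fun t ht =>
    HasDerivWithinAt.fun_sum fun i _ => HasDerivAt.comp_hasDerivWithinAt (h := fun s => ψ s i)
      (h₂ := barEnergy g (φ i)) t (hasDerivAt_barEnergy hg (φ i) (ψ t i)) (hψ t ht i)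
  have hU' : ∀ t, 0 ≤ t →
      ∑ i, (cumul g (ψ t i) - cumul g (φ i)) * loadLaw g k held (ψ t) i ≤ 0 := by
    intro t ht
    have e1 : ∀ i, (cumul g (ψ t i) - cumul g (φ i)) * loadLaw g k held (ψ t) i =
        k * ((cumul g (ψ t i) - cumul g (φ i)) * ((load g (ψ t) i - load g φ i) -
          (load g (ψ t) (i - 1) - load g φ (i - 1)))) := by
      intro i
      by_cases hi : i ∈ held
      · rw [hheld i hi t ht]; ring
      · rw [loadLaw, if_neg hi, hload i hi]; ring
    have e2 : ∀ i, load g (ψ t) i - load g φ i =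
        (cumul g (ψ t (i + 1)) - cumul g (φ (i + 1))) - (cumul g (ψ t i) - cumul g (φ i)) := by
      intro i
      rw [load, load, cumul_nextBar hg hgp, cumul_nextBar hg hgp]; ring
    -- With `x i = cumul g (ψ t i) - cumul g (φ i)`, summation by parts turns the derivative into
    -- `-k ∑ (x (i + 1) - x i)²`.
    rw [Finset.sum_congr rfl fun i _ => e1 i, ← Finset.mul_sum,
      sum_mul_load_sub (fun i => cumul g (ψ t i) - cumul g (φ i))
        (fun i => load g (ψ t) i - load g φ i)]
    refine mul_nonpos_of_nonneg_of_nonpos hk.le (Finset.sum_nonpos fun i _ => ?_)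
    rw [e2]
    nlinarith [sq_nonneg ((cumul g (ψ t (i + 1)) - cumul g (φ (i + 1))) -
      (cumul g (ψ t i) - cumul g (φ i)))]
  have hanti : ∀ s t, 0 ≤ s → s ≤ t → U t ≤ U s := by
    intro s t hs hst
    have := monotoneOn_of_deriv_nonneg_Ici (fun t ht => (hU t ht).neg)
      (fun t ht => neg_nonneg.2 (hU' t ht)) (show s ∈ Ici 0 from hs) (hs.trans hst) hst
    simpa using this
  -- Small along a sequence and nonincreasing, the energy tends to zero for all times.
  have hUs : Tendsto (fun n => U (s n)) atTop (𝓝 0) := by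
    have : Tendsto (fun n => U (s n)) atTop (𝓝 (∑ i, barEnergy g (φ i) (φ i))) :=
      tendsto_finsetSum _ fun i _ =>
        (hasDerivAt_barEnergy hg (φ i) (φ i)).continuousAt.tendsto.comp (hφi i)
    simpa [barEnergy] using this
  have hUi : ∀ t i, c / 2 * (ψ t i - φ i) ^ 2 ≤ U t := by
    intro t i
    refine (sq_le_barEnergy hg (fun θ => (hcC θ).1) (φ i) (ψ t i)).trans ?_
    refine Finset.single_le_sum (f := fun i => barEnergy g (φ i) (ψ t i)) (fun j _ => ?_)
      (Finset.mem_univ i)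
    exact le_trans (by positivity) (sq_le_barEnergy hg (fun θ => (hcC θ).1) (φ j) (ψ t j))
  refine ⟨φ, fun i => ?_, hgap, hload⟩
  have hsq : Tendsto (fun t => (ψ t i - φ i) ^ 2) atTop (𝓝 0) := by
    rw [Metric.tendsto_atTop]
    intro ε hε
    have hev := (hUs.eventually (gt_mem_nhds (by positivity : 0 < c / 2 * ε))).and
      (hs.eventually_ge_atTop 0)
    obtain ⟨n, hn, hn0⟩ := hev.exists
    refine ⟨s n, fun t ht => ?_⟩
    rw [Real.dist_eq, sub_zero, abs_of_nonneg (sq_nonneg _)]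
    have h3 := (hUi t i).trans ((hanti _ _ hn0 ht).trans_lt hn |>.le)
    have h4 := (hUi t i).trans_lt ((hanti _ _ hn0 ht).trans_lt hn)
    exact lt_of_mul_lt_mul_left h4 (by positivity)
  have habs := hsq.sqrt
  simp only [Real.sqrt_sq_eq_abs, Real.sqrt_zero] at habs
  have := (tendsto_zero_iff_abs_tendsto_zero _).2 habs
  simpa using this.add_const (φ i)

end Bars

/-! ### The bars in the workspace. -/

/-- The angular density of a density `w` in log-polar coordinates. -/
noncomputable def angularDensity (L : ℝ) (w : ℂ → ℝ) (θ : ℝ) : ℝ :=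
  ∫ u in (-(2 * Real.pi * L))..0, w (u + θ * I)

lemma continuous_angularDensity (L : ℝ) {w : ℂ → ℝ} (hw : Continuous w) :
    Continuous (angularDensity L w) :=
  intervalIntegral.continuous_parametric_intervalIntegral_of_continuous'
    (f := fun (θ u : ℝ) => w (u + θ * I)) (by fun_prop) _ _

lemma setIntegral_box_pos {L : ℝ} (hL : 0 < L) {α β : ℝ} (hαβ : α < β) {f : ℂ → ℝ} (hf : Continuous f)
    (hpos : ∀ ζ ∈ box L α β, α < ζ.im → ζ.im < β → 0 < f ζ) : 0 < ∫ ζ in box L α β, f ζ := by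
  have hl : -(2 * Real.pi * L) < 0 := by linarith [mul_pos Real.pi_pos hL]
  rw [setIntegral_box hL hαβ.le hf]
  refine intervalIntegral.intervalIntegral_pos_of_pos_on
    ((continuous_angularDensity L hf).intervalIntegrable _ _) (fun θ hθ => ?_) hαβ
  have hc : Continuous fun u : ℝ => f (u + θ * I) := by fun_prop
  refine intervalIntegral.intervalIntegral_pos_of_pos_on (hc.intervalIntegrable _ _)
    (fun u hu => ?_) hl
  refine hpos _ ⟨⟨?_, ?_⟩, ?_, ?_⟩ ?_ ?_
  · simpa using hu.1.le
  · simpa using hu.2.le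
  · simpa using hθ.1.le
  · simpa using hθ.2.le
  · simpa using hθ.1
  · simpa using hθ.2

namespace IsChart

variable {L : ℝ} {M : Set ℂ} {τ σ : ℂ → ℂ} {ρ : ℂ → ℝ}

/-- The convergence of the bars. -/
theorem bars_tendsto {N : ℕ} [NeZero N] (hN : 2 ≤ N) (h : IsChart L M τ σ) (hL : 0 < L)
    (hρ : ContinuousOn ρ (mappedRegion L)) (hρpos : ∀ q ∈ mappedRegion L, 0 < ρ q)
    {k : ℝ} (hk : 0 < k) {held : Set (Fin N)} {ψ : ℝ → Fin N → ℝ}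
    (hψ0 : StrictMono (ψ 0)) (hψ0_mem : ∀ i, ψ 0 i ∈ Ico 0 (2 * Real.pi))
    (hψ : ∀ t, 0 ≤ t → ∀ i, HasDerivWithinAt (fun s => ψ s i)
      (barVelocity M τ ρ L k held (ψ t) i) (Ici 0) t) :
    (∀ t, 0 ≤ t → ∀ i, ψ t i < nextBar (ψ t) i ∧ nextBar (ψ t) i - ψ t i < 2 * Real.pi) ∧
    ∃ φ : Fin N → ℝ, (∀ i, Tendsto (fun t => ψ t i) atTop (𝓝 (φ i))) ∧
      (∀ i, φ i < nextBar φ i ∧ nextBar φ i - φ i < 2 * Real.pi) ∧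
      ∀ i ∉ held, workload τ ρ (subregion M τ L φ i) = workload τ ρ (subregion M τ L φ (i - 1)) := by
  have hw := h.continuous_weight hL hρ
  have hw0 := h.weight_pos hL hρpos
  have hl : -(2 * Real.pi * L) < 0 := by linarith [mul_pos Real.pi_pos hL]
  set g := angularDensity L (weight L σ ρ) with hgdef
  have hg : Continuous g := continuous_angularDensity L hw
  have hg0 : ∀ θ, 0 < g θ := fun θ =>
    intervalIntegral.intervalIntegral_pos_of_pos_on
      ((by fun_prop : Continuous fun u : ℝ => weight L σ ρ (u + θ * I)).intervalIntegrable _ _)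
      (fun u _ => hw0 _) hl
  have hgp : ∀ θ, g (θ + 2 * Real.pi) = g θ := by
    intro θ
    refine intervalIntegral.integral_congr fun u _ => ?_
    rw [← weight_add_two_pi L σ ρ (u + θ * I)]
    congr 1; push_cast; ring
  have hm : ∀ α β, α ≤ β → β - α < 2 * Real.pi →
      workload τ ρ (cell M τ L α β) = ∫ θ in α..β, g θ := fun α β h1 h2 => by
    rw [h.workload_cell h2, setIntegral_box hL h1 hw]; rfl
  have hm0 : ∀ α β, 0 ≤ workload τ ρ (cell M τ L α β) := fun α β =>
    setIntegral_nonneg (h.measurableSet_cell α β) fun q hq => (hρpos _ (h.mapsTo hq.1)).le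
  have hm1 : ∀ α β, β < α → workload τ ρ (cell M τ L α β) = 0 := by
    intro α β hlt
    have : cell M τ L α β = ∅ := by
      rw [eq_empty_iff_forall_notMem]
      rintro x ⟨-, s, θ, -, -, h3, h4, -⟩
      linarith
    rw [this, workload, setIntegral_empty]
  have h0 : ∀ i, ψ 0 i < nextBar (ψ 0) i := by
    intro i
    rw [nextBar]
    split_ifs with hi
    · linarith [(hψ0_mem i).2, (hψ0_mem (i + 1)).1]
    · rw [add_zero]
      refine hψ0 ?_
      rw [Fin.lt_def]
      have hlt : i.val + 1 < N := by
        by_contra hcon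
        apply hi
        apply Fin.ext
        have : i.val + 1 = N := by omega
        rw [Fin.val_add, Fin.val_one', Nat.add_mod_mod, this]; simp
      rw [Fin.val_add, Fin.val_one', Nat.add_mod_mod, Nat.mod_eq_of_lt hlt]; omega
  -- The order comes first: a workload is an increment of the primitive only for ordered bars less
  -- than a full turn apart.
  have h1 : ∀ t, 0 ≤ t → ∀ i, ψ t i < nextBar (ψ t) i := fun t ht i =>
    lt_nextBar_of_barLaw (m := fun α β => workload τ ρ (cell M τ L α β)) hg hg0 hgp hm hm0 hm1
      (h.workload_cell_le hρ hρpos) hk h0 hψ ht i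
  have h2 : ∀ t, 0 ≤ t → ∀ i, nextBar (ψ t) i - ψ t i < 2 * Real.pi := fun t ht i =>
    gap_lt hN (h1 t ht) i
  have hload : ∀ φ : Fin N → ℝ, (∀ i, φ i < nextBar φ i) → ∀ i,
      workload τ ρ (subregion M τ L φ i) = load g φ i := fun φ hφ i => by
    rw [subregion_eq_cell, hm _ _ (hφ i).le (gap_lt hN hφ i), load, cumul_sub hg]
  have hψ' : ∀ t, 0 ≤ t → ∀ i,
      HasDerivWithinAt (fun s => ψ s i) (loadLaw g k held (ψ t) i) (Ici 0) t := by
    intro t ht i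
    refine (hψ t ht i).congr_deriv ?_
    rw [barVelocity, loadLaw, hload _ (h1 t ht), hload _ (h1 t ht)]
  obtain ⟨φ, hφ, hgap, heq⟩ := tendsto_equilibrium hg hg0 hgp hk h1 h2 hψ'
  refine ⟨fun t ht i => ⟨h1 t ht i, h2 t ht i⟩, φ, hφ, fun i => ⟨hgap i, gap_lt hN hgap i⟩, ?_⟩
  intro i hi
  rw [hload _ hgap, hload _ hgap, heq i hi]

end IsChart

/-! ### The cost of a box and its minimizer. -/

/-- The cost of the point `y` for the box between the angles `α` and `β`. -/
noncomputable def boxCost (L : ℝ) (w : ℂ → ℝ) (α β : ℝ) (y : ℂ) : ℝ :=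
  ∫ ζ in box L α β, w ζ * ‖geoLog (innerRadius L) ζ y‖ ^ 2

/-- The mean of the logarithm maps at the point `y`. -/
noncomputable def boxDrift (L : ℝ) (w : ℂ → ℝ) (α β : ℝ) (y : ℂ) : ℂ :=
  ∫ ζ in box L α β, w ζ • geoLog (innerRadius L) y ζ

/-- A point of the box at which the cost is minimal. -/
def IsBoxCentroid (L : ℝ) (w : ℂ → ℝ) (α β : ℝ) (c : ℂ) : Prop :=
  c ∈ box L α β ∧ ∀ y ∈ box L α β, boxCost L w α β c ≤ boxCost L w α β y

section

variable {L : ℝ} {w : ℂ → ℝ} {α β : ℝ}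

lemma continuous_norm_geoLog_sq (a : ℝ) : Continuous fun x : ℂ × ℂ => ‖geoLog a x.2 x.1‖ ^ 2 :=
  (((continuous_geoLog a).comp continuous_swap).norm.pow 2)

lemma exists_continuous_boxCost (hL : 0 < L) (hw : Continuous w) :
    ∃ Φ : ℂ × ℝ × ℝ → ℝ, Continuous Φ ∧ ∀ α β y, α ≤ β → boxCost L w α β y = Φ (y, α, β) := by
  have hc : Continuous (Function.uncurry fun (y ζ : ℂ) => w ζ * ‖geoLog (innerRadius L) ζ y‖ ^ 2) :=
    (hw.comp continuous_snd).mul (continuous_norm_geoLog_sq _)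
  refine ⟨_, continuous_iterated_integral hc (-(2 * Real.pi * L)), fun α β y hαβ => ?_⟩
  exact setIntegral_box hL hαβ (hc.comp (f := fun ζ => (y, ζ)) (by fun_prop))

lemma continuous_boxDrift (hL : 0 < L) (hw : Continuous w) (hαβ : α ≤ β) :
    Continuous (boxDrift L w α β) := by
  have hc : Continuous (Function.uncurry fun (y ζ : ℂ) => w ζ • geoLog (innerRadius L) y ζ) :=
    (hw.comp continuous_snd).smul (continuous_geoLog _)
  have h1 := (continuous_iterated_integral hc (-(2 * Real.pi * L))).comp
    (f := fun y : ℂ => (y, α, β)) (by fun_prop)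
  refine h1.congr fun y => ?_
  exact (setIntegral_box hL hαβ (hc.comp (f := fun ζ => (y, ζ)) (by fun_prop))).symm

lemma integrableOn_box {E : Type*} [NormedAddCommGroup E] {f : ℂ → E} (hf : Continuous f) :
    IntegrableOn f (box L α β) := hf.continuousOn.integrableOn_compact (isCompact_box L α β)

lemma continuous_cost_integrand (hw : Continuous w) (y : ℂ) :
    Continuous fun ζ => w ζ * ‖geoLog (innerRadius L) ζ y‖ ^ 2 :=
  hw.mul ((continuous_norm_geoLog_sq _).comp (f := fun ζ => (y, ζ)) (by fun_prop))

/-- The variational inequality for the cost. -/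
theorem boxCost_add_le (hw : Continuous w) (hw0 : ∀ ζ, 0 < w ζ) {y c : ℂ}
    (hy : innerRadius L ≤ Real.exp y.re) (hc : innerRadius L ≤ Real.exp c.re) :
    boxCost L w α β y + (∫ ζ in box L α β, w ζ) * ‖geoLog (innerRadius L) y c‖ ^ 2
      - 2 * inner ℝ (geoLog (innerRadius L) y c) (boxDrift L w α β y) ≤ boxCost L w α β c := by
  set v := geoLog (innerRadius L) y c with hv
  have hG : Continuous fun ζ => w ζ • geoLog (innerRadius L) y ζ :=
    hw.smul ((continuous_geoLog _).comp (f := fun ζ => (y, ζ)) (by fun_prop))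
  have e1 : inner ℝ v (boxDrift L w α β y) =
      ∫ ζ in box L α β, inner ℝ v (w ζ • geoLog (innerRadius L) y ζ) :=
    (integral_inner (integrableOn_box hG) v).symm
  have hI : Continuous fun ζ => inner ℝ v (w ζ • geoLog (innerRadius L) y ζ) := by fun_prop
  have hJ := continuous_cost_integrand (L := L) hw y
  have hJ' : Continuous fun ζ => w ζ * ‖geoLog (innerRadius L) ζ y‖ ^ 2 + w ζ * ‖v‖ ^ 2 :=
    hJ.add (by fun_prop)
  rw [e1, boxCost, boxCost, ← integral_mul_const, ← integral_const_mul,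
    ← integral_add (integrableOn_box hJ) (integrableOn_box (by fun_prop)),
    ← integral_sub (integrableOn_box hJ') (integrableOn_box (by fun_prop))]
  refine setIntegral_mono_on (integrableOn_box (hJ'.sub (by fun_prop)))
    (integrableOn_box (continuous_cost_integrand hw c)) (isCompact_box L α β).measurableSet
    fun ζ hζ => ?_
  have ha := innerRadius_pos L
  have hζ' := innerRadius_le_of_mem_box hζ
  -- Comparison seen from `y`, for the points `c` and `ζ`; the square is expanded, weighted and
  -- integrated, so the cost is never differentiated.
  have h1 := pow_le_pow_left₀ (norm_nonneg _) (norm_geoLog_sub_geoLog_le_norm ha hy hc hζ') 2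
  rw [norm_sub_sq_real, ← hv, norm_geoLog_comm ha hc hζ', norm_geoLog_comm ha hy hζ',
    real_inner_comm] at h1
  rw [real_inner_smul_right]
  nlinarith [mul_le_mul_of_nonneg_left h1 (hw0 ζ).le]

/-- The cost is strictly convex. -/
theorem exists_boxCost_midpoint_le (hw : Continuous w) (hw0 : ∀ ζ, 0 < w ζ) {p q : ℂ}
    (hp : p ∈ box L α β) (hq : q ∈ box L α β) :
    ∃ y ∈ box L α β, 2 * boxCost L w α β y +
      (∫ ζ in box L α β, w ζ) * (‖geoLog (innerRadius L) p q‖ ^ 2 / 2) ≤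
        boxCost L w α β p + boxCost L w α β q := by
  obtain ⟨y, hy, hyre, hyim, hmid⟩ := exists_midpoint (innerRadius_pos L)
    (innerRadius_le_of_mem_box hp) (innerRadius_le_of_mem_box hq)
  refine ⟨y, ⟨⟨Real.exp_le_exp.1 hy, hyre.trans (max_le hp.1.2 hq.1.2)⟩,
    uIcc_subset_Icc hp.2 hq.2 hyim⟩, ?_⟩
  have hJ := continuous_cost_integrand (L := L) hw
  have hJy := hJ y
  rw [boxCost, boxCost, boxCost, ← integral_mul_const, ← integral_const_mul,
    ← integral_add (integrableOn_box (by fun_prop)) (integrableOn_box (by fun_prop)),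
    ← integral_add (integrableOn_box (hJ p)) (integrableOn_box (hJ q))]
  refine setIntegral_mono_on (integrableOn_box (by fun_prop))
    (integrableOn_box ((hJ p).add (hJ q))) (isCompact_box L α β).measurableSet fun ζ hζ => ?_
  have := mul_le_mul_of_nonneg_left (hmid ζ (innerRadius_le_of_mem_box hζ)) (hw0 ζ).le
  linarith

lemma setIntegral_weight_pos (hL : 0 < L) (hw : Continuous w) (hw0 : ∀ ζ, 0 < w ζ) (hαβ : α < β) :
    0 < ∫ ζ in box L α β, w ζ := setIntegral_box_pos hL hαβ hw fun ζ _ _ _ => hw0 ζ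

lemma exists_isBoxCentroid (hL : 0 < L) (hw : Continuous w) (hαβ : α ≤ β) :
    ∃ c, IsBoxCentroid L w α β c := by
  obtain ⟨Φ, hΦ, he⟩ := exists_continuous_boxCost hL hw
  have hne : (box L α β).Nonempty := by
    refine ⟨α * I, ⟨?_, ?_⟩, ?_, ?_⟩ <;> simp [hαβ]
    positivity
  have hcont : ContinuousOn (boxCost L w α β) (box L α β) := by
    refine Continuous.continuousOn ?_
    refine (hΦ.comp (f := fun y : ℂ => (y, α, β)) (by fun_prop)).congr fun y => ?_
    exact (he α β y hαβ).symm
  obtain ⟨c, hc, hmin⟩ := (isCompact_box L α β).exists_isMinOn hne hcont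
  exact ⟨c, hc, fun y hy => hmin hy⟩

/-- Otherwise the midpoint of the two would cost strictly less. -/
lemma IsBoxCentroid.eq (hL : 0 < L) (hw : Continuous w) (hw0 : ∀ ζ, 0 < w ζ) (hαβ : α < β) {c c' : ℂ}
    (hc : IsBoxCentroid L w α β c) (hc' : IsBoxCentroid L w α β c') : c = c' := by
  obtain ⟨y, hy, hle⟩ := exists_boxCost_midpoint_le hw hw0 hc.1 hc'.1
  have hm := setIntegral_weight_pos hL hw hw0 hαβ
  have h1 := hc.2 y hy
  have h2 := hc'.2 y hy
  refine eq_of_geoLog_eq_zero (innerRadius_pos L) (innerRadius_le_of_mem_box hc.1)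
    (innerRadius_le_of_mem_box hc'.1) ?_
  have h3 : (∫ ζ in box L α β, w ζ) * (‖geoLog (innerRadius L) c c'‖ ^ 2 / 2) ≤ 0 := by linarith
  have h4 : ‖geoLog (innerRadius L) c c'‖ ^ 2 / 2 ≤ 0 := by
    by_contra hcon
    exact absurd h3 (not_le.2 (mul_pos hm (not_le.1 hcon)))
  exact norm_eq_zero.1 (pow_eq_zero_iff two_ne_zero |>.1
    (le_antisymm (by linarith) (sq_nonneg ‖geoLog (innerRadius L) c c'‖)))

end

/-! ### Position and continuity of the centroid. -/

/-- The logarithm map turns towards the side of its argument. -/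
lemma inner_geoLog_pos {a : ℝ} (ha : 0 < a) {c ζ : ℂ} (hc : a ≤ Real.exp c.re)
    (hζ : a ≤ Real.exp ζ.re) (h : c.im < ζ.im) :
    0 < inner ℝ (geoLog a c ζ) (I * Complex.exp c) := by
  have hΔ : 0 < ζ.im - c.im := sub_pos.2 h
  have h1 := touchAngle_lt ha c.re
  have h2 := touchAngle_lt ha ζ.re
  have hr := Real.exp_pos c.re
  have hr' := Real.exp_pos ζ.re
  rcases le_or_gt (ζ.im - c.im) (touchAngle a c.re + touchAngle a ζ.re) with hv | hf
  · rw [geoLog_of_visible (by rwa [abs_of_pos hΔ])]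
    have hs : 0 < Real.sin (ζ.im - c.im) := Real.sin_pos_of_pos_of_lt_pi hΔ (by linarith)
    have e : inner ℝ (Complex.exp ζ - Complex.exp c) (I * Complex.exp c) =
        Real.exp ζ.re * Real.exp c.re * Real.sin (ζ.im - c.im) := by
      rw [Complex.inner, Real.sin_sub]
      simp only [Complex.mul_re, Complex.mul_im, Complex.conj_re, Complex.conj_im, Complex.sub_re,
        Complex.sub_im, Complex.exp_re, Complex.exp_im, Complex.I_re, Complex.I_im]
      ring
    rw [e]; positivity
  · rw [geoLog_of_far ha hc hζ hf.le]
    have hpos : 0 < involute a c.re + involute a ζ.re + a * (ζ.im - c.im) := by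
      have := involute_nonneg ha hc
      have := involute_nonneg ha hζ
      have := mul_pos ha hΔ
      linarith
    have e : inner ℝ (((involute a c.re + involute a ζ.re + a * (ζ.im - c.im) : ℝ) : ℂ) *
        (I * Complex.exp (((c.im + touchAngle a c.re : ℝ) : ℂ) * I))) (I * Complex.exp c) =
        (involute a c.re + involute a ζ.re + a * (ζ.im - c.im)) *
          (Real.exp c.re * Real.cos (touchAngle a c.re)) := by
      have hcos : Real.cos (touchAngle a c.re) =
          Real.cos (c.im + touchAngle a c.re) * Real.cos c.im +
            Real.sin (c.im + touchAngle a c.re) * Real.sin c.im := by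
        rw [← Real.cos_sub]; congr 1; ring
      rw [Complex.inner, hcos, Complex.exp_mul_I, ← Complex.ofReal_cos, ← Complex.ofReal_sin]
      simp only [Complex.mul_re, Complex.mul_im, Complex.conj_re, Complex.conj_im, Complex.add_re,
        Complex.add_im, Complex.exp_re, Complex.exp_im, Complex.I_re, Complex.I_im,
        Complex.ofReal_re, Complex.ofReal_im]
      ring
    rw [e, exp_mul_cos_touchAngle ha hc]
    exact mul_pos hpos ha

lemma inner_geoLog_neg {a : ℝ} (ha : 0 < a) {c ζ : ℂ} (hc : a ≤ Real.exp c.re)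
    (hζ : a ≤ Real.exp ζ.re) (h : ζ.im < c.im) :
    inner ℝ (geoLog a c ζ) (I * Complex.exp c) < 0 := by
  have := inner_geoLog_pos ha (c := conj c) (ζ := conj ζ) hc hζ (by simpa using h)
  rw [geoLog_conj, Complex.exp_conj, Complex.inner, Complex.conj_conj] at this
  rw [Complex.inner]
  simp only [Complex.mul_re, Complex.mul_im, Complex.conj_re, Complex.conj_im, Complex.I_re,
    Complex.I_im] at this ⊢
  linarith

/-- The velocity of the logarithm map along a path that passes through its base point. -/
lemma tendsto_slope_geoLog {a : ℝ} (ha : 0 < a) {ζ : ℝ → ℂ} {S : Set ℝ} {t : ℝ} {v : ℂ} (htS : t ∉ S)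
    (hmem : ∀ s ∈ S, a ≤ Real.exp (ζ s).re) (ht : a ≤ Real.exp (ζ t).re)
    (hc : ContinuousWithinAt ζ S t)
    (hd : HasDerivWithinAt (fun s => Complex.exp (ζ s)) v S t) :
    Tendsto (fun s => (s - t)⁻¹ • geoLog a (ζ t) (ζ s)) (𝓝[S] t) (𝓝 v) := by
  have h1 : Tendsto (fun s => (s - t)⁻¹ • (Complex.exp (ζ s) - Complex.exp (ζ t))) (𝓝[S] t) (𝓝 v) :=
    (hasDerivWithinAt_iff_tendsto_slope' htS).1 hd
  have him : Tendsto (fun s => |(ζ s).im - (ζ t).im|) (𝓝[S] t) (𝓝 0) := by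
    have : ContinuousWithinAt (fun s => |(ζ s).im - (ζ t).im|) S t :=
      ((Complex.continuous_im.continuousAt.comp_continuousWithinAt hc).sub
        continuousWithinAt_const).abs
    simpa [ContinuousWithinAt] using this
  have h2 : Tendsto (fun s => (s - t)⁻¹ • geoLog a (ζ t) (ζ s) -
      (s - t)⁻¹ • (Complex.exp (ζ s) - Complex.exp (ζ t))) (𝓝[S] t) (𝓝 0) := by
    have hb : Tendsto (fun s => |(ζ s).im - (ζ t).im| *
        (2 * ‖(s - t)⁻¹ • (Complex.exp (ζ s) - Complex.exp (ζ t))‖)) (𝓝[S] t) (𝓝 0) := by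
      have := him.mul (h1.norm.const_mul 2)
      rwa [zero_mul] at this
    refine squeeze_zero_norm' ?_ hb
    filter_upwards [him.eventually (Iic_mem_nhds (by norm_num : (0 : ℝ) < 1 / 2)),
      self_mem_nhdsWithin] with s hs hsS
    have h3 := norm_geoLog_sub_sub_le ha ht (hmem s hsS) (hs.trans (by norm_num))
    -- Once the angle is at most `1/2`, the error is at most half the logarithm and can be absorbed.
    have h4 : ‖geoLog a (ζ t) (ζ s)‖ ≤ 2 * ‖Complex.exp (ζ s) - Complex.exp (ζ t)‖ := by
      have h5 := norm_sub_norm_le (geoLog a (ζ t) (ζ s)) (Complex.exp (ζ s) - Complex.exp (ζ t))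
      have h6 := mul_le_mul_of_nonneg_right hs (norm_nonneg (geoLog a (ζ t) (ζ s)))
      linarith
    rw [← smul_sub, norm_smul, norm_smul]
    calc ‖(s - t)⁻¹‖ * ‖geoLog a (ζ t) (ζ s) - (Complex.exp (ζ s) - Complex.exp (ζ t))‖
        ≤ ‖(s - t)⁻¹‖ * (|(ζ s).im - (ζ t).im| * (2 * ‖Complex.exp (ζ s) - Complex.exp (ζ t)‖)) :=
          mul_le_mul_of_nonneg_left (h3.trans (mul_le_mul_of_nonneg_left h4 (abs_nonneg _)))
            (norm_nonneg _)
      _ = _ := by ring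
  simpa using h2.add h1

section

variable {L : ℝ} {w : ℂ → ℝ} {α β : ℝ}

/-- The logarithm map along a coordinate circle, seen from the moving end. -/
lemma tendsto_smul_geoLog_rotate {a : ℝ} (ha : 0 < a) {c : ℂ} (hc : a ≤ Real.exp c.re) (s : ℝ) :
    Tendsto (fun h : ℝ => h⁻¹ • geoLog a (c + ((s * h : ℝ) : ℂ) * I) c) (𝓝[>] 0)
      (𝓝 (-(s • (I * Complex.exp c)))) := by
  have hre : ∀ h : ℝ, (c + ((s * h : ℝ) : ℂ) * I).re = c.re := fun h => by simp
  have him : ∀ h : ℝ, (c + ((s * h : ℝ) : ℂ) * I).im = c.im + s * h := fun h => by simp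
  have hd : HasDerivAt (fun h : ℝ => Complex.exp (c + ((s * h : ℝ) : ℂ) * I))
      (s • (I * Complex.exp c)) 0 := by
    have h1 : HasDerivAt (fun h : ℝ => ((s * h : ℝ) : ℂ)) (s : ℂ) 0 := by
      simpa using ((hasDerivAt_id (0 : ℝ)).const_mul s).ofReal_comp
    have h2 := ((h1.mul_const I).const_add c).cexp
    refine h2.congr_deriv ?_
    rw [Complex.real_smul]; simp; ring
  have h1 : Tendsto (fun h : ℝ => h⁻¹ • (Complex.exp c - Complex.exp (c + ((s * h : ℝ) : ℂ) * I)))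
      (𝓝[>] 0) (𝓝 (-(s • (I * Complex.exp c)))) := by
    have h3 := ((hasDerivWithinAt_iff_tendsto_slope' (s := Ioi (0 : ℝ)) self_notMem_Ioi).1
      hd.hasDerivWithinAt).neg
    refine h3.congr fun h => ?_
    simp [slope_def_module, smul_sub]
  have hcont : Continuous fun h : ℝ => |s| * ‖geoLog a (c + ((s * h : ℝ) : ℂ) * I) c‖ :=
    continuous_const.mul ((continuous_geoLog a).comp
      (f := fun h : ℝ => (c + ((s * h : ℝ) : ℂ) * I, c)) (by fun_prop)).norm
  have h0 : Tendsto (fun h : ℝ => |s| * ‖geoLog a (c + ((s * h : ℝ) : ℂ) * I) c‖) (𝓝[>] 0) (𝓝 0) := by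
    have := (hcont.tendsto 0).mono_left (nhdsWithin_le_nhds (s := Ioi 0))
    simpa [geoLog_self] using this
  have hsmall : ∀ᶠ h : ℝ in 𝓝[>] 0, |s * h| ≤ 1 := by
    have : Tendsto (fun h : ℝ => |s * h|) (𝓝[>] 0) (𝓝 0) := by
      have := ((by fun_prop : Continuous fun h : ℝ => |s * h|).tendsto 0).mono_left
        (nhdsWithin_le_nhds (s := Ioi 0))
      simpa using this
    exact this.eventually (Iic_mem_nhds one_pos)
  have h2 : Tendsto (fun h : ℝ => h⁻¹ • geoLog a (c + ((s * h : ℝ) : ℂ) * I) c -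
      h⁻¹ • (Complex.exp c - Complex.exp (c + ((s * h : ℝ) : ℂ) * I))) (𝓝[>] 0) (𝓝 0) := by
    refine squeeze_zero_norm' ?_ h0
    filter_upwards [hsmall, self_mem_nhdsWithin] with h hh (hpos : 0 < h)
    have e : c.im - (c + ((s * h : ℝ) : ℂ) * I).im = -(s * h) := by rw [him]; ring
    have h3 := norm_geoLog_sub_sub_le ha (p := c + ((s * h : ℝ) : ℂ) * I) (q := c)
      (by rwa [hre]) hc (by rwa [e, abs_neg])
    rw [e, abs_neg, abs_mul, abs_of_pos hpos] at h3
    rw [← smul_sub, norm_smul, norm_inv, Real.norm_eq_abs, abs_of_pos hpos]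
    calc _ ≤ h⁻¹ * (|s| * h * ‖geoLog a (c + ((s * h : ℝ) : ℂ) * I) c‖) :=
          mul_le_mul_of_nonneg_left h3 (by positivity)
      _ = _ := by field_simp
  simpa using h2.add h1

/-- The first-order condition at a centroid, in the direction of the angle. -/
lemma IsBoxCentroid.mul_inner_boxDrift_nonpos (hL : 0 < L) (hw : Continuous w)
    (hw0 : ∀ ζ, 0 < w ζ) (hαβ : α ≤ β) {c : ℂ} (hc : IsBoxCentroid L w α β c) {s δ : ℝ} (hδ : 0 < δ)
    (hmem : ∀ h ∈ Ioo 0 δ, c + ((s * h : ℝ) : ℂ) * I ∈ box L α β) :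
    s * inner ℝ (I * Complex.exp c) (boxDrift L w α β c) ≤ 0 := by
  have hca := innerRadius_le_of_mem_box hc.1
  have h1 := tendsto_smul_geoLog_rotate (innerRadius_pos L) hca s
  have h2 : Tendsto (fun h : ℝ => boxDrift L w α β (c + ((s * h : ℝ) : ℂ) * I)) (𝓝[>] 0)
      (𝓝 (boxDrift L w α β c)) := by
    have := (((continuous_boxDrift hL hw hαβ).comp
      (f := fun h : ℝ => c + ((s * h : ℝ) : ℂ) * I) (by fun_prop)).tendsto 0).mono_left
        (nhdsWithin_le_nhds (s := Ioi 0))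
    simpa [Function.comp_def] using this
  have h3 := h1.inner (𝕜 := ℝ) h2
  -- The variational inequality is applied at the displaced point, with `c` as the competitor: since
  -- `c` is cheaper, the drift there does not point away from `c`.
  have h4 : ∀ᶠ h : ℝ in 𝓝[>] 0, 0 ≤ inner ℝ
      (h⁻¹ • geoLog (innerRadius L) (c + ((s * h : ℝ) : ℂ) * I) c)
      (boxDrift L w α β (c + ((s * h : ℝ) : ℂ) * I)) := by
    filter_upwards [Ioo_mem_nhdsGT hδ] with h hh
    have hy := hmem h hh
    have h5 := boxCost_add_le (α := α) (β := β) hw hw0 (innerRadius_le_of_mem_box hy) hca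
    have h6 := hc.2 _ hy
    have h7 : 0 ≤ ∫ ζ in box L α β, w ζ := integral_nonneg fun ζ => (hw0 ζ).le
    have h8 := mul_nonneg h7
      (sq_nonneg ‖geoLog (innerRadius L) (c + ((s * h : ℝ) : ℂ) * I) c‖)
    rw [real_inner_smul_left]
    exact mul_nonneg (inv_nonneg.2 hh.1.le) (by linarith)
  have h5 := ge_of_tendsto h3 h4
  rw [inner_neg_left, real_inner_smul_left] at h5
  linarith

lemma inner_boxDrift (hw : Continuous w) (c v : ℂ) : inner ℝ v (boxDrift L w α β c) =
    ∫ ζ in box L α β, w ζ * inner ℝ (geoLog (innerRadius L) c ζ) v := by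
  have hG : Continuous fun ζ => w ζ • geoLog (innerRadius L) c ζ :=
    hw.smul ((continuous_geoLog _).comp (f := fun ζ => (c, ζ)) (by fun_prop))
  rw [boxDrift, ← integral_inner (integrableOn_box hG) v]
  refine integral_congr_ae (ae_of_all _ fun ζ => ?_)
  simp only [real_inner_smul_right]
  rw [real_inner_comm]

/-- A centroid does not lie on the bars. -/
theorem IsBoxCentroid.im_mem_Ioo (hL : 0 < L) (hw : Continuous w)
    (hw0 : ∀ ζ, 0 < w ζ) (hαβ : α < β) {c : ℂ} (hc : IsBoxCentroid L w α β c) :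
    c.im ∈ Ioo α β := by
  have hca := innerRadius_le_of_mem_box hc.1
  have hcont : Continuous fun ζ => w ζ * inner ℝ (geoLog (innerRadius L) c ζ) (I * Complex.exp c) :=
    hw.mul (((continuous_geoLog _).comp (f := fun ζ => (c, ζ)) (by fun_prop)).inner
      continuous_const)
  have hmem : ∀ h : ℝ, α ≤ c.im + h → c.im + h ≤ β → c + (h : ℂ) * I ∈ box L α β := by
    intro h h1 h2
    have := hc.1.1
    refine ⟨by simpa using this, by simpa using h1, by simpa using h2⟩
  refine ⟨lt_of_le_of_ne hc.1.2.1 fun hα => ?_, lt_of_le_of_ne hc.1.2.2 fun hβ => ?_⟩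
  -- On the bar `α` the whole mass lies on the inner side, so the drift has a positive inward
  -- component, which contradicts the first-order condition.
  · have h1 := hc.mul_inner_boxDrift_nonpos (s := 1) hL hw hw0 hαβ.le (sub_pos.2 hαβ)
      fun h hh => hmem _ (by linarith [hh.1]) (by linarith [hh.2])
    rw [one_mul, inner_boxDrift hw] at h1
    refine absurd h1 (not_le.2 (setIntegral_box_pos hL hαβ hcont fun ζ hζ h2 _ => ?_))
    exact mul_pos (hw0 ζ) (inner_geoLog_pos (innerRadius_pos L) hca
      (innerRadius_le_of_mem_box hζ) (hα ▸ h2))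
  · have h1 := hc.mul_inner_boxDrift_nonpos (s := -1) hL hw hw0 hαβ.le (sub_pos.2 hαβ)
      fun h hh => hmem _ (by linarith [hh.2]) (by linarith [hh.1])
    rw [inner_boxDrift hw] at h1
    have h3 := setIntegral_box_pos hL hαβ hcont.neg fun ζ hζ _ h2 => by
      rw [Pi.neg_apply, Left.neg_pos_iff]
      exact mul_neg_of_pos_of_neg (hw0 ζ) (inner_geoLog_neg (innerRadius_pos L) hca
        (innerRadius_le_of_mem_box hζ) (hβ ▸ h2))
    simp only [Pi.neg_apply, integral_neg] at h3
    linarith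

/-- The centroid depends continuously on the box. -/
theorem IsBoxCentroid.tendsto (hL : 0 < L) (hw : Continuous w) (hw0 : ∀ ζ, 0 < w ζ)
    (hαβ : α < β) {c : ℂ} (hc : IsBoxCentroid L w α β c) {α' β' : ℝ → ℝ} {c' : ℝ → ℂ}
    (hα : Tendsto α' atTop (𝓝 α)) (hβ : Tendsto β' atTop (𝓝 β))
    (hc' : ∀ᶠ t in atTop, IsBoxCentroid L w (α' t) (β' t) (c' t)) :
    Tendsto c' atTop (𝓝 c) := by
  obtain ⟨Φ, hΦ, he⟩ := exists_continuous_boxCost hL hw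
  have hcim := hc.im_mem_Ioo hL hw hw0 hαβ
  have hK : ∀ᶠ t in atTop, c' t ∈ box L (α - 1) (β + 1) := by
    filter_upwards [hc', hα.eventually (lt_mem_nhds (sub_one_lt α)),
      hβ.eventually (gt_mem_nhds (lt_add_one β))] with t h1 h2 h3
    exact ⟨h1.1.1, h2.le.trans h1.1.2.1, h1.1.2.2.trans h3.le⟩
  refine (isCompact_box L (α - 1) (β + 1)).tendsto_nhds_of_unique_mapClusterPt hK fun y hy hcl => ?_
  obtain ⟨U, hU, hUy⟩ := mapClusterPt_iff_ultrafilter.1 hcl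
  have hα' := hα.mono_left hU
  have hβ' := hβ.mono_left hU
  have hev : ∀ᶠ t in (U : Filter ℝ), IsBoxCentroid L w (α' t) (β' t) (c' t) := hU hc'
  have him : Tendsto (fun t => (c' t).im) U (𝓝 y.im) := (Complex.continuous_im.tendsto y).comp hUy
  refine IsBoxCentroid.eq hL hw hw0 hαβ ⟨⟨hy.1, ?_, ?_⟩, fun z hz => ?_⟩ hc
  · exact le_of_tendsto_of_tendsto hα' him (hev.mono fun t ht => ht.1.2.1)
  · exact le_of_tendsto_of_tendsto him hβ' (hev.mono fun t ht => ht.1.2.2)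
  -- `c` is an admissible competitor in the nearby boxes because it lies strictly between the limit
  -- bars.
  · have h1 : boxCost L w α β y ≤ boxCost L w α β c := by
      rw [he _ _ _ hαβ.le, he _ _ _ hαβ.le]
      refine le_of_tendsto_of_tendsto
        ((hΦ.tendsto (y, α, β)).comp (hUy.prodMk_nhds (hα'.prodMk_nhds hβ')))
        ((hΦ.tendsto (c, α, β)).comp (tendsto_const_nhds.prodMk_nhds (hα'.prodMk_nhds hβ'))) ?_
      filter_upwards [hev, hα'.eventually (gt_mem_nhds hcim.1),
        hβ'.eventually (lt_mem_nhds hcim.2)] with t h2 h3 h4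
      have := h2.2 c ⟨hc.1.1, h3.le, h4.le⟩
      have h5 : α' t ≤ β' t := (h3.trans h4).le
      rwa [he _ _ _ h5, he _ _ _ h5] at this
    exact h1.trans (hc.2 z hz)

end

/-! ### The gradient flow in a moving box. -/

/-- A nonnegative function with `U' ≤ -κ U + δ` in the sense of left Dini derivatives, where `δ`
vanishes at infinity, vanishes at infinity. -/
theorem tendsto_zero_of_leftDini_le {U δ : ℝ → ℝ} {T κ : ℝ} (hκ : 0 < κ) (hU0 : ∀ t, 0 ≤ U t)
    (hU : ContinuousOn U (Ici T)) (hδ : Tendsto δ atTop (𝓝 0))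
    (hD : ∀ᶠ t in atTop, ∀ r < κ * U t - δ t, ∀ᶠ s in 𝓝[<] t, r * (t - s) ≤ U s - U t) :
    Tendsto U atTop (𝓝 0) := by
  rw [Metric.tendsto_atTop']
  intro ε' hε'
  set ε := ε' / 2 with hε_def
  have hε : 0 < ε := by positivity
  obtain ⟨T₀, hT₀⟩ := eventually_atTop.1
    ((hδ.eventually (gt_mem_nhds (mul_pos hκ hε))).and hD)
  set T' := max T T₀ with hT'
  -- A barrier with `B' = -κ (B - ε)` that starts above `U`; after `T'` the perturbation `δ` is
  -- below `κ ε`.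
  set B : ℝ → ℝ := fun t => ε + U T' * Real.exp (-κ * (t - T')) with hB
  have hBd : ∀ t, HasDerivAt B (-κ * (B t - ε)) t := by
    intro t
    have h1 : HasDerivAt (fun t => -κ * (t - T')) (-κ) t := by
      simpa using ((hasDerivAt_id t).sub_const T').const_mul (-κ)
    refine ((h1.exp.const_mul (U T')).const_add ε).congr_deriv ?_
    simp only [hB]; ring
  have hle : ∀ t, T' ≤ t → U t ≤ B t := by
    intro t₁ ht₁
    by_contra! hcon
    have hcont : ContinuousOn (fun t => U t - B t) (Icc T' t₁) := by
      refine (hU.mono fun s hs => (le_max_left _ _).trans hs.1).sub ?_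
      exact fun s _ => (hBd s).continuousAt.continuousWithinAt
    obtain ⟨t, ht, hmax⟩ := isCompact_Icc.exists_isMaxOn ⟨t₁, right_mem_Icc.2 ht₁⟩ hcont
    have hgt : 0 < U t - B t := (sub_pos.2 hcon).trans_le (hmax (right_mem_Icc.2 ht₁))
    have hBT : B T' = ε + U T' := by simp [hB]
    have htT : T' < t := by
      refine lt_of_le_of_ne ht.1 fun h => ?_
      rw [← h, hBT] at hgt
      linarith
    obtain ⟨h1, h2⟩ := hT₀ t ((le_max_right _ _).trans ht.1)
    -- At a positive maximum of `U - B`, the function `U` falls more steeply than `B`; the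
    -- difference was then larger just before.
    have h3 : κ * (B t - ε) < κ * U t - δ t := by nlinarith [mul_pos hκ hgt]
    obtain ⟨r, hr1, hr2⟩ := exists_between h3
    have h4 : ∀ᶠ s in 𝓝[<] t, slope B t s ∈ Ioi (-r) :=
      ((hasDerivWithinAt_iff_tendsto_slope' self_notMem_Iio).1 (hBd t).hasDerivWithinAt).eventually
        (Ioi_mem_nhds (by linarith))
    obtain ⟨s, ⟨h5, h6⟩, h7⟩ := ((h4.and (h2 r hr2)).and (Ioo_mem_nhdsLT htT)).exists
    have h8 := hmax ⟨h7.1.le, h7.2.le.trans ht.2⟩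
    simp only [mem_ofPred_eq] at h8
    rw [mem_Ioi, slope_def_field, lt_div_iff_of_neg (sub_neg.2 h7.2)] at h5
    linarith
  have hlim : Tendsto B atTop (𝓝 (ε + U T' * 0)) := by
    refine ((Real.tendsto_exp_atBot.comp ?_).const_mul (U T')).const_add ε
    exact (tendsto_atTop_add_const_right _ _ tendsto_id).const_mul_atTop_of_neg (by linarith)
  obtain ⟨T₁, hT₁⟩ := eventually_atTop.1
    (hlim.eventually (gt_mem_nhds (by rw [mul_zero, add_zero]; linarith : ε + U T' * 0 < ε')))
  refine ⟨max T' T₁, fun t ht => ?_⟩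
  rw [Real.dist_eq, sub_zero, abs_of_nonneg (hU0 t)]
  exact (hle t ((le_max_left _ _).trans ht.le)).trans_lt (hT₁ t ((le_max_right _ _).trans ht.le))

section

variable {L : ℝ} {w : ℂ → ℝ} {α β : ℝ}

/-- The gradient flow of the cost of a box that converges to a limit box converges to the centroid
of the latter. -/
theorem tendsto_of_gradientFlow (hL : 0 < L) (hw : Continuous w) (hw0 : ∀ ζ, 0 < w ζ)
    (hαβ : α < β) {c : ℂ} (hc : IsBoxCentroid L w α β c) {α' β' : ℝ → ℝ} {ζ : ℝ → ℂ} {T k : ℝ}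
    (hk : 0 < k) (hα : Tendsto α' atTop (𝓝 α)) (hβ : Tendsto β' atTop (𝓝 β))
    (hmem : ∀ t, T ≤ t → ζ t ∈ box L (α' t) (β' t)) (hζ : ContinuousOn ζ (Ici T))
    (hd : ∀ t, T ≤ t → HasDerivWithinAt (fun s => Complex.exp (ζ s))
      ((2 * k) • boxDrift L w (α' t) (β' t) (ζ t)) (Ici T) t) :
    Tendsto (fun t => ‖geoLog (innerRadius L) (ζ t) c‖) atTop (𝓝 0) := by
  obtain ⟨Φ, hΦ, he⟩ := exists_continuous_boxCost hL hw
  have ha := innerRadius_pos L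
  have hca := innerRadius_le_of_mem_box hc.1
  have hlt : ∀ᶠ t in atTop, α' t < β' t := hα.eventually_lt hβ hαβ
  have hex : ∀ t, ∃ c', α' t < β' t → IsBoxCentroid L w (α' t) (β' t) c' := by
    intro t
    by_cases h : α' t < β' t
    · obtain ⟨c', h'⟩ := exists_isBoxCentroid hL hw h.le
      exact ⟨c', fun _ => h'⟩
    · exact ⟨0, fun h' => absurd h' h⟩
  choose c' hc' using hex
  have hcc : Tendsto c' atTop (𝓝 c) :=
    hc.tendsto hL hw hw0 hαβ hα hβ (hlt.mono fun t ht => hc' t ht)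
  have hm := setIntegral_weight_pos hL hw hw0 hαβ
  set m := ∫ ζ in box L α β, w ζ with hm_def
  have hmt : ∀ᶠ t in atTop, m / 2 < ∫ ζ in box L (α' t) (β' t), w ζ := by
    have h1 := continuous_iterated_integral (X := ℂ) (f := fun _ ζ => w ζ)
      (hw.comp continuous_snd) (-(2 * Real.pi * L))
    have h2 := (h1.tendsto ((0 : ℂ), α, β)).comp
      ((tendsto_const_nhds (x := (0 : ℂ))).prodMk_nhds (hα.prodMk_nhds hβ))
    have h3 : m / 2 < ∫ θ in α..β, ∫ u in (-(2 * Real.pi * L))..0, w (u + θ * I) := by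
      rw [← setIntegral_box hL hαβ.le hw]; linarith
    filter_upwards [h2.eventually (lt_mem_nhds h3), hlt] with t h4 h5
    rw [setIntegral_box hL h5.le hw]
    exact h4
  -- The price of aiming at the limit centroid `c` instead of the current centroid `c' t`.
  set δ : ℝ → ℝ := fun t => 2 * k * (Φ (c, α' t, β' t) - Φ (c' t, α' t, β' t)) with hδ_def
  have hδ : Tendsto δ atTop (𝓝 0) := by
    have h1 := (hΦ.tendsto (c, α, β)).comp
      ((tendsto_const_nhds (x := c)).prodMk_nhds (hα.prodMk_nhds hβ))
    have h2 := (hΦ.tendsto (c, α, β)).comp (hcc.prodMk_nhds (hα.prodMk_nhds hβ))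
    have h3 := (h1.sub h2).const_mul (2 * k)
    rwa [sub_self, mul_zero] at h3
  set U : ℝ → ℝ := fun t => ‖geoLog (innerRadius L) (ζ t) c‖ ^ 2 with hU_def
  have hUlim : Tendsto U atTop (𝓝 0) := by
    refine tendsto_zero_of_leftDini_le (T := T) (mul_pos hk hm) (fun t => sq_nonneg _) ?_ hδ ?_
    · have := (continuous_norm_geoLog_sq (innerRadius L)).comp_continuousOn
        (f := fun t => (c, ζ t)) (continuousOn_const.prodMk hζ)
      exact this
    filter_upwards [hlt, hmt, eventually_gt_atTop T] with t h1 h2 h3 r hr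
    set x := ζ t with hx_def
    have hx := hmem t h3.le
    have hxa := innerRadius_le_of_mem_box hx
    set G := boxDrift L w (α' t) (β' t) x with hG
    set v := geoLog (innerRadius L) x c with hv
    -- The variational inequality at the agent against `c`, and minimality of `c' t`. The mass is at
    -- least `m / 2`, hence the rate `k m`.
    have h4 : r < 2 * inner ℝ v ((2 * k) • G) := by
      have h5 := boxCost_add_le (α := α' t) (β := β' t) hw hw0 hxa hca
      have h6 := (hc' t h1).2 x hx
      rw [he _ _ _ h1.le, he _ _ _ h1.le] at h5 h6
      have h7 : U t = ‖v‖ ^ 2 := rfl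
      rw [h7] at hr
      simp only [hδ_def] at hr
      rw [real_inner_smul_right]
      have h8 := mul_le_mul_of_nonneg_right h2.le (sq_nonneg ‖v‖)
      have h9 := mul_le_mul_of_nonneg_left (h5.trans le_rfl) (by linarith : 0 ≤ 2 * k)
      have h10 := mul_le_mul_of_nonneg_left h6 (by linarith : 0 ≤ 2 * k)
      have h11 := mul_le_mul_of_nonneg_left h8 (by linarith : 0 ≤ 2 * k)
      rw [← hv, ← hG] at h9
      nlinarith
    have h5 : Tendsto (fun s => (s - t)⁻¹ • geoLog (innerRadius L) x (ζ s)) (𝓝[<] t)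
        (𝓝 ((2 * k) • G)) := by
      rw [← nhdsWithin_Ico_eq_nhdsLT h3]
      refine tendsto_slope_geoLog ha (fun h => lt_irrefl _ h.2)
        (fun s hs => innerRadius_le_of_mem_box (hmem s hs.1)) hxa
        ((hζ t h3.le).mono fun s hs => hs.1) ((hd t h3.le).mono fun s hs => hs.1)
    have h6 := ((tendsto_const_nhds (x := v)).inner (𝕜 := ℝ) h5).const_mul 2
    filter_upwards [h6.eventually (lt_mem_nhds h4), Ioo_mem_nhdsLT h3] with s h7 h8
    -- Comparison seen from `x` bounds `U s` from below only, which for `s < t` is the direction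
    -- that the left Dini estimate needs.
    have h9 := pow_le_pow_left₀ (norm_nonneg _) (norm_geoLog_sub_geoLog_le_norm ha hxa
      (innerRadius_le_of_mem_box (hmem s h8.1.le)) hca) 2
    rw [← hv, norm_sub_sq_real] at h9
    rw [real_inner_smul_right] at h7
    have h10 : U t = ‖v‖ ^ 2 := rfl
    have h11 : U s = ‖geoLog (innerRadius L) (ζ s) c‖ ^ 2 := rfl
    have h12 : (s - t)⁻¹ * (t - s) = -1 := by
      have : s - t ≠ 0 := by linarith [h8.2]
      field_simp; ring
    have h13 := mul_le_mul_of_nonneg_right h7.le (sub_nonneg.2 h8.2.le)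
    have h14 : 2 * ((s - t)⁻¹ * inner ℝ v (geoLog (innerRadius L) x (ζ s))) * (t - s) =
        -(2 * inner ℝ v (geoLog (innerRadius L) x (ζ s))) := by
      linear_combination 2 * inner ℝ v (geoLog (innerRadius L) x (ζ s)) * h12
    rw [h10, h11]
    nlinarith [sq_nonneg ‖geoLog (innerRadius L) x (ζ s)‖]
  have h := hUlim.sqrt
  rw [Real.sqrt_zero] at h
  exact h.congr fun t => Real.sqrt_sq (norm_nonneg _)

end

/-! ### Return to the workspace. -/

lemma box_subset_box {L α β A B : ℝ} (hA : A ≤ α) (hB : β ≤ B) : box L α β ⊆ box L A B :=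
  fun _ h => ⟨h.1, hA.trans h.2.1, h.2.2.trans hB⟩

lemma lift_eq_lift {L α β A B : ℝ} (hA : A ≤ α) (hB : β ≤ B) (hAB : B - A < 2 * Real.pi) {z : ℂ}
    (hz : z ∈ sector L α β) : lift A B z = lift α β z := by
  have hαβ : β - α < 2 * Real.pi := by linarith
  conv_lhs => rw [← exp_lift hαβ hz]
  exact lift_exp hAB (box_subset_box hA hB (lift_mem_box hαβ hz))

lemma lengthDist_anti {M E F : Set ℂ} (τ : ℂ → ℂ) (hEF : E ⊆ F) (x y : ℂ) :
    lengthDist M τ F x y ≤ lengthDist M τ E x y :=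
  le_iInf₂ fun γ hγ => iInf₂_le γ ⟨hγ.1, hγ.2.1.mono_right hEF, hγ.2.2⟩

namespace IsChart

variable {L : ℝ} {M : Set ℂ} {τ σ : ℂ → ℂ} {ρ : ℂ → ℝ}

/-- The optimal centroids of a cell are the centroids of the corresponding box. -/
lemma isOptimalCentroid_iff (h : IsChart L M τ σ) {α β : ℝ} (hαβ : β - α < 2 * Real.pi) {x : ℂ}
    (hx : x ∈ cell M τ L α β) : IsOptimalCentroid M τ ρ (cell M τ L α β) x ↔
      IsBoxCentroid L (weight L σ ρ) α β (lift α β (τ x)) := by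
  constructor
  · rintro ⟨-, hmin⟩
    refine ⟨lift_mem_box hαβ hx.2, fun y hy => ?_⟩
    have hy' := h.symm_exp_mem_cell hy
    have := hmin _ hy'
    rwa [h.cost_cell hαβ hx, h.cost_cell hαβ hy', h.lift_apply_symm_exp hαβ hy] at this
  · rintro ⟨-, hmin⟩
    refine ⟨hx, fun y hy => ?_⟩
    rw [h.cost_cell hαβ hx, h.cost_cell hαβ hy]
    exact hmin _ (lift_mem_box hαβ hy.2)

lemma isOptimalCentroid_symm_exp (h : IsChart L M τ σ) {α β : ℝ} (hαβ : β - α < 2 * Real.pi) {c : ℂ}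
    (hc : IsBoxCentroid L (weight L σ ρ) α β c) :
    IsOptimalCentroid M τ ρ (cell M τ L α β) (σ (Complex.exp c)) := by
  rw [h.isOptimalCentroid_iff hαβ (h.symm_exp_mem_cell hc.1), h.lift_apply_symm_exp hαβ hc.1]
  exact hc

lemma existsUnique_isOptimalCentroid (h : IsChart L M τ σ) (hL : 0 < L)
    (hρ : ContinuousOn ρ (mappedRegion L)) (hρpos : ∀ q ∈ mappedRegion L, 0 < ρ q) {α β : ℝ}
    (hlt : α < β) (hαβ : β - α < 2 * Real.pi) :
    ∃! c, IsOptimalCentroid M τ ρ (cell M τ L α β) c := by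
  have hw := h.continuous_weight hL hρ
  obtain ⟨c, hc⟩ := exists_isBoxCentroid hL hw hlt.le
  refine ⟨_, h.isOptimalCentroid_symm_exp hαβ hc, fun x hx => ?_⟩
  have := ((h.isOptimalCentroid_iff hαβ hx.1).1 hx).eq hL hw (h.weight_pos hL hρpos) hlt hc
  rw [← this, h.symm_exp_lift hαβ hx.1]

/-- An agent that follows the control law in a converging cell tracks the optimal centroid of the
cell and converges to the optimal centroid of the limit cell. -/
theorem agent_tendsto (h : IsChart L M τ σ) (hL : 0 < L) (hρ : ContinuousOn ρ (mappedRegion L))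
    (hρpos : ∀ q ∈ mappedRegion L, 0 < ρ q) {k : ℝ} (hk : 0 < k) {α' β' : ℝ → ℝ} {α β : ℝ}
    (hα : Tendsto α' atTop (𝓝 α)) (hβ : Tendsto β' atTop (𝓝 β)) (hlt : α < β)
    (hαβ : β - α < 2 * Real.pi) {p : ℝ → ℂ}
    (hmem : ∀ t, 0 ≤ t → p t ∈ cell M τ L (α' t) (β' t))
    (hp : ∀ t, 0 ≤ t → HasDerivWithinAt p
      (controlInput M τ ρ k (cell M τ L (α' t) (β' t)) (p t)) (Ici 0) t) :
    (∀ c : ℝ → ℂ, (∀ t, 0 ≤ t → IsOptimalCentroid M τ ρ (cell M τ L (α' t) (β' t)) (c t)) →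
      Tendsto (fun t => lengthDist M τ (cell M τ L (α' t) (β' t)) (p t) (c t)) atTop (𝓝 0)) ∧
    ∃ q, IsOptimalCentroid M τ ρ (cell M τ L α β) q ∧
      (∀ q', IsOptimalCentroid M τ ρ (cell M τ L α β) q' → q' = q) ∧
      Tendsto (fun t => lengthDist M τ (cell M τ L (α' t) (β' t)) (p t) q) atTop (𝓝 0) ∧
      Tendsto (fun t => lengthDist M τ M (p t) q) atTop (𝓝 0) := by
  have hw := h.continuous_weight hL hρ
  have hw0 := h.weight_pos hL hρpos
  have ha := innerRadius_pos L
  obtain ⟨c, hc⟩ := exists_isBoxCentroid hL hw hlt.le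
  have hcim := hc.im_mem_Ioo hL hw hw0 hlt
  have hca := innerRadius_le_of_mem_box hc.1
  -- A fixed sector, slightly wider than the limit but still below a full turn, provides one
  -- continuous lift for all large times.
  obtain ⟨ε, hε, hεlt⟩ : ∃ ε, 0 < ε ∧ β + ε - (α - ε) < 2 * Real.pi :=
    ⟨(2 * Real.pi - (β - α)) / 4, by linarith, by linarith⟩
  set A := α - ε
  set B := β + ε
  obtain ⟨T, hT⟩ := eventually_atTop.1 (((hα.eventually (lt_mem_nhds (sub_lt_self α hε))).and
    (hβ.eventually (gt_mem_nhds (lt_add_of_pos_right β hε)))).and (eventually_ge_atTop 0))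
  have hgap : ∀ t, T ≤ t → β' t - α' t < 2 * Real.pi := fun t ht => by
    have h1 := (hT t ht).1.1
    have h2 := (hT t ht).1.2
    linarith
  have hlift : ∀ t, T ≤ t → ∀ z ∈ sector L (α' t) (β' t), lift A B z = lift (α' t) (β' t) z :=
    fun t ht z hz => lift_eq_lift (hT t ht).1.1.le (hT t ht).1.2.le hεlt hz
  set ζ : ℝ → ℂ := fun t => lift A B (τ (p t)) with hζ_def
  have hζ : ∀ t, T ≤ t → ζ t = lift (α' t) (β' t) (τ (p t)) := fun t ht =>
    hlift t ht _ (hmem t (hT t ht).2).2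
  have hζmem : ∀ t, T ≤ t → ζ t ∈ box L (α' t) (β' t) := fun t ht => by
    rw [hζ t ht]
    exact lift_mem_box (hgap t ht) (hmem t (hT t ht).2).2
  have hexp : ∀ t, T ≤ t → Complex.exp (ζ t) = τ (p t) := fun t ht => by
    rw [hζ t ht]
    exact exp_lift (hgap t ht) (hmem t (hT t ht).2).2
  have hsec : MapsTo (fun t => τ (p t)) (Ici T) (sector L A B) := fun t ht => by
    simp only
    rw [← hexp t ht, ← image_exp_box]
    exact mem_image_of_mem _ (box_subset_box (hT t ht).1.1.le (hT t ht).1.2.le (hζmem t ht))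
  have hder : ∀ t, T ≤ t → HasDerivWithinAt (fun s => τ (p s))
      ((2 * k) • boxDrift L (weight L σ ρ) (α' t) (β' t) (ζ t)) (Ici T) t := by
    intro t ht
    have ht0 := (hT t ht).2
    have h1 := (h.hasDerivWithinAt_comp (hp t ht0) (fun s hs => (hmem s hs).1) ht0).mono
      (Ici_subset_Ici.2 (hT T le_rfl).2)
    refine h1.congr_deriv ?_
    rw [h.fderivWithin_controlInput hL (hgap t ht) (h.measurableSet_cell _ _) ρ k (hmem t ht0),
      h.setIntegral_cell (hgap t ht) (fun ξ => geoLog (innerRadius L)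
        (lift (α' t) (β' t) (τ (p t))) ξ), hζ t ht]
    rfl
  have hζc : ContinuousOn ζ (Ici T) :=
    (continuousOn_lift hεlt).comp (fun t ht => (hder t ht).continuousWithinAt) hsec
  have hlim := tendsto_of_gradientFlow hL hw hw0 hlt hc hk hα hβ hζmem hζc fun t ht =>
    (hder t ht).congr (fun s hs => hexp s hs) (hexp t ht)
  -- Being off the limit bars, the limit centroid ends up inside the moving sector, where its
  -- distance to the agent is finite.
  have hcmem : ∀ᶠ t in atTop, c ∈ box L (α' t) (β' t) := by
    filter_upwards [hα.eventually (gt_mem_nhds hcim.1), hβ.eventually (lt_mem_nhds hcim.2)]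
      with t h1 h2
    exact ⟨hc.1.1, h1.le, h2.le⟩
  have hltev : ∀ᶠ t in atTop, α' t < β' t := hα.eventually_lt hβ hlt
  have hofReal : ∀ {f : ℝ → ℝ}, Tendsto f atTop (𝓝 0) →
      Tendsto (fun t => ENNReal.ofReal (f t)) atTop (𝓝 0) := fun hf => by
    simpa using ENNReal.tendsto_ofReal hf
  have hq : Tendsto (fun t => lengthDist M τ (cell M τ L (α' t) (β' t)) (p t) (σ (Complex.exp c)))
      atTop (𝓝 0) := by
    refine (hofReal hlim).congr' ?_
    filter_upwards [eventually_ge_atTop T, hcmem] with t ht h1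
    rw [h.lengthDist_eq (hgap t ht) (hmem t (hT t ht).2) (h.symm_exp_mem_cell h1),
      h.lift_apply_symm_exp (hgap t ht) h1, hζ t ht]
  refine ⟨fun c' hc' => ?_, σ (Complex.exp c), h.isOptimalCentroid_symm_exp hαβ hc, fun q' hq' => ?_,
    hq, ?_⟩
  · set e : ℝ → ℂ := fun t => lift (α' t) (β' t) (τ (c' t)) with he_def
    have he : ∀ᶠ t in atTop, IsBoxCentroid L (weight L σ ρ) (α' t) (β' t) (e t) := by
      filter_upwards [eventually_ge_atTop T] with t ht
      have h1 := hc' t (hT t ht).2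
      exact (h.isOptimalCentroid_iff (hgap t ht) h1.1).1 h1
    have het := hc.tendsto hL hw hw0 hlt hα hβ he
    have h1 : Tendsto (fun t => ‖geoLog (innerRadius L) c (e t)‖) atTop (𝓝 0) := by
      have h2 := (((continuous_geoLog (innerRadius L)).tendsto (c, c)).comp
        ((tendsto_const_nhds (x := c)).prodMk_nhds het)).norm
      simpa [geoLog_self, Function.comp_def] using h2
    have h2 : Tendsto (fun t => ‖geoLog (innerRadius L) (ζ t) (e t)‖) atTop (𝓝 0) := by
      have h3 := hlim.add h1
      rw [add_zero] at h3
      refine squeeze_zero' (Eventually.of_forall fun t => norm_nonneg _) ?_ h3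
      filter_upwards [eventually_ge_atTop T, he] with t ht h4
      exact norm_geoLog_triangle ha (innerRadius_le_of_mem_box (hζmem t ht)) hca
        (innerRadius_le_of_mem_box h4.1)
    refine (hofReal h2).congr' ?_
    filter_upwards [eventually_ge_atTop T] with t ht
    rw [h.lengthDist_eq (hgap t ht) (hmem t (hT t ht).2) (hc' t (hT t ht).2).1, hζ t ht]
  · exact (h.existsUnique_isOptimalCentroid hL hρ hρpos hlt hαβ).unique hq'
      (h.isOptimalCentroid_symm_exp hαβ hc)
  · exact tendsto_of_tendsto_of_tendsto_of_le_of_le tendsto_const_nhds hq (fun t => zero_le)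
      fun t => lengthDist_anti τ (fun x hx => hx.1) _ _

end IsChart

end Coverage

theorem theorem38 {N : ℕ} [NeZero N] (hN : 2 ≤ N)
    (L : ℝ) (hL : 0 < L) (Ω O : Set ℂ) (M : Set ℂ) (hM : M = Coverage.workspace Ω O)
    (τ : ℂ → ℂ) (hτ : Coverage.IsDiffeo τ M (Coverage.mappedRegion L))
    (ρ : ℂ → ℝ) (hρ : ContinuousOn ρ (Coverage.mappedRegion L))
    (hρpos : ∀ q ∈ Coverage.mappedRegion L, 0 < ρ q)
    (kψ kp : ℝ) (hkψ : 0 < kψ) (hkp : 0 < kp) (held : Set (Fin N))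
    -- `ψ t i` is the phase angle of the `i`-th bar and `p t i` the position of the `i`-th agent
    (ψ : ℝ → Fin N → ℝ) (p : ℝ → Fin N → ℂ)
    (hψ0 : StrictMono (ψ 0)) (hψ0_mem : ∀ i, ψ 0 i ∈ Set.Ico 0 (2 * Real.pi))
    (hψ : ∀ t, 0 ≤ t → ∀ i, HasDerivWithinAt (fun s => ψ s i)
      (Coverage.barVelocity M τ ρ L kψ held (ψ t) i) (Set.Ici 0) t)
    (hp_mem : ∀ t, 0 ≤ t → ∀ i, p t i ∈ Coverage.subregion M τ L (ψ t) i)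
    (hp : ∀ t, 0 ≤ t → ∀ i, HasDerivWithinAt (fun s => p s i)
      (Coverage.controlInput M τ ρ kp (Coverage.subregion M τ L (ψ t) i) (p t i)) (Set.Ici 0) t) :
    ∃ ψlim : Fin N → ℝ,
      (∀ i, Tendsto (fun t => ψ t i) atTop (𝓝 (ψlim i))) ∧
      (∀ i, i ∉ held → Coverage.workload τ ρ (Coverage.subregion M τ L ψlim i) =
        Coverage.workload τ ρ (Coverage.subregion M τ L ψlim (i - 1))) ∧
      ∀ i,
        -- the agent tracks the optimal centroid of its current subregion
        (∀ t, 0 ≤ t →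
          ∃! c, Coverage.IsOptimalCentroid M τ ρ (Coverage.subregion M τ L (ψ t) i) c) ∧
        (∀ c : ℝ → ℂ,
          (∀ t, 0 ≤ t →
            Coverage.IsOptimalCentroid M τ ρ (Coverage.subregion M τ L (ψ t) i) (c t)) →
          Tendsto (fun t => Coverage.lengthDist M τ (Coverage.subregion M τ L (ψ t) i) (p t i) (c t))
            atTop (𝓝 0)) ∧
        -- and it converges to the optimal centroid of its limiting subregion
        ∃ q, Coverage.IsOptimalCentroid M τ ρ (Coverage.subregion M τ L ψlim i) q ∧
          (∀ q', Coverage.IsOptimalCentroid M τ ρ (Coverage.subregion M τ L ψlim i) q' → q' = q) ∧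
          Tendsto (fun t => Coverage.lengthDist M τ (Coverage.subregion M τ L (ψ t) i) (p t i) q)
            atTop (𝓝 0) ∧
          Tendsto (fun t => Coverage.lengthDist M τ M (p t i) q) atTop (𝓝 0) := by
  obtain ⟨σ, h⟩ := hτ.exists_isChart
  obtain ⟨hgap, φ, hφ, hφgap, hload⟩ := h.bars_tendsto hN hL hρ hρpos hkψ hψ0 hψ0_mem hψ
  exact ⟨φ, hφ, hload, fun i =>
    ⟨fun t ht => h.existsUnique_isOptimalCentroid hL hρ hρpos (hgap t ht i).1 (hgap t ht i).2,
      h.agent_tendsto hL hρ hρpos hkp (hφ i) ((hφ (i + 1)).add_const _) (hφgap i).1 (hφgap i).2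
        (fun t ht => hp_mem t ht i) fun t ht => hp t ht i⟩⟩
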